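/- Let $R>0$, $b\in\mathbb R^n\setminus\{0\}$, and let $\sigma(x)=b+\frac{R^2}{|x-b|^2}(x-b)$ be the reflection in the sphere $S^{n-1}(b,R)$. Put $a=\sigma(0)$, and let $B_r$ and $S_r$ be the open ball and the sphere of radius $r$ about $0$ in $\mathbb R^n$. On the half-space $P=\{x\in\mathbb R^n: 2|b|^2-R^2-2\langle b,x\rangle>0\}$ one has $|\sigma(x)|<|b|$, and the function $$f(x)=\frac{R^2|\sigma(x)|^2}{|b|^2-|\sigma(x)|^2}$$ satisfies $$f(x)=\frac{|b|^2|x-a|^2}{2|b|^2-R^2-2\langle b,x\rangle}.$$ For $0<r<|b|$ one has $\sigma(B_r)=\{x\in P: f(x)<\frac{R^2r^2}{|b|^2-r^2}\}$ and $\partial\sigma(B_r)=\sigma(S_r)$. Let $0<\bar r<|b|$, let $k\ge 1$, and let $\Sigma\subset\sigma(B_{\bar r})$ be a $k$-dimensional smooth embedded minimal submanifold (its mean curvature vector vanishes) whose boundary $\partial\Sigma=\overline\Sigma\setminus\Sigma$ lies in $\partial\sigma(B_{\bar r})$. Integrals over subsets of $\Sigma$ are with respect to the $k$-dimensional volume,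 $|\cdot|$ of a subset of $\Sigma$ is its $k$-dimensional volume, and $X^\top$, $X^\perp$ are the components of $X$ tangent and normal to $\Sigma$ at $x$. For $r\in(0,\bar r)$ define $$J(r)=\Big(\frac{|b|^2-r^2}{r^2}\Big)^{\frac k2}|\Sigma\cap\sigma(B_r)|,\qquad I(r)=\Big(\frac{|b|^2-r^2}{r^2}\Big)^{\frac k2}\int_{\Sigma\cap\sigma(B_r)}\frac{|(x-a)^\top|^2}{|x-a|^2}.$$ Then these quantities and all the integrals below are finite, and for $0<r<q<\bar r$ $$J(q)-J(r)=R^k\int_{\Sigma\cap(\sigma(B_q)\setminus\sigma(B_r))}f^{-\frac k2}\,\frac{|b|^4|(x-a)^\perp|^2+f^2|b^\top|^2}{|b|^4|x-a|^2}$$ and $$I(q)-I(r)=R^k\int_{\Sigma\cap(\sigma(B_q)\setminus\sigma(B_r))}f^{-\frac{k-4}2}\frac{|b^\top|^2}{|b|^4|x-a|^2}+k|b|^2\int_r^q\frac{(|b|^2-\rho^2)^{\frac{k-2}2}}{\rho^{k+1}}\left(\int_{\Sigma\cap\sigma(B_\rho)}\frac{|(x-a)^\perp|^2}{|x-a|^2}\right)d\rho.$$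 In particular $I$ and $J$ are nondecreasing on $(0,\bar r)$. Moreover, if $\Sigma\neq\emptyset$ and $I$ or $J$ is constant on $(0,\bar r)$, then $\Sigma$ is a totally geodesic disk containing $a$ and orthogonal to $b$: there is a $k$-dimensional linear subspace $T\perp b$ with $$\Sigma=\Big\{x: x-a\in T,\ |x-a|<\frac{R^2\bar r}{|b|\sqrt{|b|^2-\bar r^2}}\Big\}.$$ -/

import Mathlib

open MeasureTheory Set
open scoped ContDiff

noncomputable section

namespace MinimalMonotonicity

variable {n k : ℕ}

/-! ### Embedded submanifolds of Euclidean space -/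

/-- `F : V → ℝⁿ` is a smooth local parametrization of the set `M ⊆ ℝⁿ`, with `k`-dimensional
parameter domain `V`: a smooth immersion on the open set `V` which is a homeomorphism from `V`
onto a relatively open subset of `M`. -/
structure IsLocalParametrization (M : Set (EuclideanSpace ℝ (Fin n)))
    (V : Set (EuclideanSpace ℝ (Fin k)))
    (F : EuclideanSpace ℝ (Fin k) → EuclideanSpace ℝ (Fin n)) : Prop where
  isOpen_domain : IsOpen V
  contDiffOn : ContDiffOn ℝ ∞ F V
  injective_fderiv : ∀ v ∈ V, Function.Injective (fderiv ℝ F v)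
  isEmbedding : Topology.IsEmbedding (V.domRestrict F)
  isOpen_image : ∃ W : Set (EuclideanSpace ℝ (Fin n)), IsOpen W ∧ F '' V = M ∩ W

/-- `M` is a `k`-dimensional smooth embedded submanifold (without boundary points in `M`) of
`ℝⁿ`. It need be neither closed nor connected. -/
def IsSubmanifold (k : ℕ) (M : Set (EuclideanSpace ℝ (Fin n))) : Prop :=
  ∀ x ∈ M, ∃ (V : Set (EuclideanSpace ℝ (Fin k)))
    (F : EuclideanSpace ℝ (Fin k) → EuclideanSpace ℝ (Fin n)),
    IsLocalParametrization M V F ∧ x ∈ F '' V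

/-- The matrix `gᵢⱼ = ⟨∂ᵢF, ∂ⱼF⟩` of the first fundamental form of `F` at `v`. -/
def firstFundamentalForm (F : EuclideanSpace ℝ (Fin k) → EuclideanSpace ℝ (Fin n))
    (v : EuclideanSpace ℝ (Fin k)) : Matrix (Fin k) (Fin k) ℝ :=
  Matrix.of fun i j => inner ℝ (fderiv ℝ F v (EuclideanSpace.single i 1))
    (fderiv ℝ F v (EuclideanSpace.single j 1))

/-- The mean curvature vector `∑ᵢⱼ gⁱʲ (∂ᵢ∂ⱼF)^⊥` of the immersion `F` at the parameter `v`,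
that is the trace of the second fundamental form. -/
def meanCurvature (F : EuclideanSpace ℝ (Fin k) → EuclideanSpace ℝ (Fin n))
    (v : EuclideanSpace ℝ (Fin k)) : EuclideanSpace ℝ (Fin n) :=
  ∑ i, ∑ j, (firstFundamentalForm F v)⁻¹ i j •
    ((fderiv ℝ F v).range)ᗮ.starProjection
      (fderiv ℝ (fderiv ℝ F) v (EuclideanSpace.single i 1) (EuclideanSpace.single j 1))

/-- `M` is a `k`-dimensional minimal submanifold: its mean curvature vanishes (in every local
parametrization; the mean curvature vector at a point does not depend on the parametrization). -/
structure IsMinimalSubmanifold (k : ℕ) (M : Set (EuclideanSpace ℝ (Fin n))) : Prop where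
  isSubmanifold : IsSubmanifold k M
  meanCurvature_eq_zero : ∀ (V : Set (EuclideanSpace ℝ (Fin k)))
    (F : EuclideanSpace ℝ (Fin k) → EuclideanSpace ℝ (Fin n)),
    IsLocalParametrization M V F → ∀ v ∈ V, meanCurvature F v = 0

/-- The tangent space of `M` at `x`. For a submanifold `tangentConeAt ℝ M x` is itself the
tangent space. -/
def tangentSpace (M : Set (EuclideanSpace ℝ (Fin n))) (x : EuclideanSpace ℝ (Fin n)) :
    Submodule ℝ (EuclideanSpace ℝ (Fin n)) :=
  Submodule.span ℝ (tangentConeAt ℝ M x)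

/-- `X^⊤`, the orthogonal projection of the vector `X` onto the tangent space of `M` at `x`. -/
def tangential (M : Set (EuclideanSpace ℝ (Fin n))) (x X : EuclideanSpace ℝ (Fin n)) :
    EuclideanSpace ℝ (Fin n) :=
  (tangentSpace M x).starProjection X

/-- `X^⊥`, the orthogonal projection of `X` onto the normal space of `M` at `x`. -/
def normal (M : Set (EuclideanSpace ℝ (Fin n))) (x X : EuclideanSpace ℝ (Fin n)) :
    EuclideanSpace ℝ (Fin n) :=
  (tangentSpace M x)ᗮ.starProjection X

/-! ### Reflections and images of balls -/

/-- The reflection in the sphere `S(b,R)`, `x ↦ b + (R²/|x-b|²)(x-b)`, away from its pole `b`. -/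
abbrev refl (b : EuclideanSpace ℝ (Fin n)) (R : ℝ) :
    EuclideanSpace ℝ (Fin n) → EuclideanSpace ℝ (Fin n) :=
  EuclideanGeometry.inversion b R

/-- The image under the reflection in `S(b,R)` of the open ball of radius `r` about `0`. -/
def ballImage (b : EuclideanSpace ℝ (Fin n)) (R r : ℝ) : Set (EuclideanSpace ℝ (Fin n)) :=
  refl b R '' Metric.ball 0 r

/-- The half-space `2|b|² - R² - 2⟨b,x⟩ > 0`. -/
def halfSpace (b : EuclideanSpace ℝ (Fin n)) (R : ℝ) : Set (EuclideanSpace ℝ (Fin n)) :=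
  {x | 0 < 2 * ‖b‖ ^ 2 - R ^ 2 - 2 * inner ℝ b x}

/-- The function `f(x) = R²|σ(x)|² / (|b|² - |σ(x)|²)`, used on the half-space. -/
def levelFun (b : EuclideanSpace ℝ (Fin n)) (R : ℝ) (x : EuclideanSpace ℝ (Fin n)) : ℝ :=
  R ^ 2 * ‖refl b R x‖ ^ 2 / (‖b‖ ^ 2 - ‖refl b R x‖ ^ 2)

/-! ### The volume ratios -/

/-- `J(r) = ((|b|² - r²)/r²)^{k/2} |M ∩ σ(B_r)|`, with the `k`-dimensional volume. -/
def volRatio (k : ℕ) (M : Set (EuclideanSpace ℝ (Fin n))) (b : EuclideanSpace ℝ (Fin n))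
    (R r : ℝ) : ℝ :=
  ((‖b‖ ^ 2 - r ^ 2) / r ^ 2) ^ ((k : ℝ) / 2) * (μHE[k] (M ∩ ballImage b R r)).toReal

/-- `I(r) = ((|b|² - r²)/r²)^{k/2} ∫_{M ∩ σ(B_r)} |(x-a)^⊤|²/|x-a|²`, where `a = σ(0)`. -/
def weightedRatio (k : ℕ) (M : Set (EuclideanSpace ℝ (Fin n))) (b : EuclideanSpace ℝ (Fin n))
    (R r : ℝ) : ℝ :=
  ((‖b‖ ^ 2 - r ^ 2) / r ^ 2) ^ ((k : ℝ) / 2) *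
    ∫ x in M ∩ ballImage b R r,
      ‖tangential M x (x - refl b R 0)‖ ^ 2 / ‖x - refl b R 0‖ ^ 2 ∂μHE[k]

end MinimalMonotonicity

end

/-! Multiplying out the inversion gives |σ(x)||x-b| = |b||x-a| and (|b|²-|σ(x)|²)|x-b|² = R²D, where
D(x) = 2|b|²-R²-2⟨b,x⟩ = R²-2⟨b,x-a⟩. Hence f·D = |b|²|x-a|² on the half-space D > 0, and the sets
σ(B_r) are sublevel sets of f; they are round balls. Differentiating f·D shows that the gradient of
f is (2/D)(|b|²(x-a) + f b).

The analytic tool is the first variation formula: the tangential divergence of a compactly supported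
C¹ field integrates to zero over a minimal submanifold
(`IsMinimalSubmanifold.integral_tangentTrace_fderiv_eq_zero`). It is proved in charts from the area
formula and from the identity that the divergence of the fields √g Σⱼ gⁱʲ∂ⱼF is √g times the mean
curvature vector, and is then globalized with bump functions.

The test field is X = H(f)(x-a) + m(f)b with H' = ψ and m' = -tψ/|b|². Since |b|²(x-a) + f b is then
paired with |b|²(x-a) - f b, the mixed terms cancel and div X = kH(f) +
ψ(f)(2/(|b|²D))(|b|⁴|(x-a)^⊤|² - f²|b^⊤|²). By f·D = |b|²|x-a|² and Pythagoras the last term equals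
2fψ(f)(1-g), where g is the density `volDefect` (`tangentTrace_fderiv_test`, `radialCoeff_eq`).
Letting ψ approach (k/2)t^{-k/2-1} on the interval of levels between r and q, and zero elsewhere,
leaves exactly the formula for J (`integral_volDefect`, `volRatio_sub`).

For I, write I = J - wN with w(r) = ((|b|²-r²)/r²)^{k/2} and N(r) the integral of |(x-a)^⊥|²/|x-a|²
over M ∩ σ(B_r). Fubini expresses the integral of -w'N through the boundary values of wN and an
integral over the annulus (`integral_normalMass`). This cancels the normal part of the formula for J
and leaves the b^⊤ part (`weightedRatio_sub`).

If I or J is constant, the nonnegative integrands vanish, so x-a is tangent and b is normal to M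
everywhere. A submanifold with tangential position vector contains its rays from a inside the convex
ball; being smooth at a, it is a piece of its tangent space there
(`IsSubmanifold.eq_of_forall_sub_mem_tangentSpace`), and b^⊤ = 0 makes that space orthogonal to b.
-/

namespace MinimalMonotonicity

/-! ### Inversion in a sphere and the images of balls about the origin. -/

section Reflection

variable {n : ℕ} {b x : EuclideanSpace ℝ (Fin n)} {R : ℝ}

lemma refl_eq (b x : EuclideanSpace ℝ (Fin n)) (R : ℝ) :
    refl b R x = (R ^ 2 / ‖x - b‖ ^ 2) • (x - b) + b := by
  simp [refl, EuclideanGeometry.inversion, dist_eq_norm, div_pow]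

lemma refl_zero (b : EuclideanSpace ℝ (Fin n)) (R : ℝ) :
    refl b R 0 = (1 - R ^ 2 / ‖b‖ ^ 2) • b := by
  rw [refl_eq]
  simp [sub_smul]
  abel

lemma norm_sq_smul_add (c : ℝ) (u v : EuclideanSpace ℝ (Fin n)) :
    ‖c • u + v‖ ^ 2 = c ^ 2 * ‖u‖ ^ 2 + 2 * c * inner ℝ u v + ‖v‖ ^ 2 := by
  rw [norm_add_sq_real, norm_smul, inner_smul_left, mul_pow, Real.norm_eq_abs, sq_abs]
  simp; ring

lemma norm_refl_sq_mul (hx : x ≠ b) :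
    ‖refl b R x‖ ^ 2 * ‖x - b‖ ^ 2 =
      R ^ 4 + 2 * R ^ 2 * inner ℝ (x - b) b + ‖b‖ ^ 2 * ‖x - b‖ ^ 2 := by
  have h : ‖x - b‖ ≠ 0 := norm_ne_zero_iff.2 (sub_ne_zero.2 hx)
  rw [refl_eq, norm_sq_smul_add]
  field_simp

lemma norm_sq_mul_norm_sub_refl_zero_sq (hb : b ≠ 0) (x : EuclideanSpace ℝ (Fin n)) :
    ‖b‖ ^ 2 * ‖x - refl b R 0‖ ^ 2 =
      R ^ 4 + 2 * R ^ 2 * inner ℝ (x - b) b + ‖b‖ ^ 2 * ‖x - b‖ ^ 2 := by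
  have h : ‖b‖ ≠ 0 := norm_ne_zero_iff.2 hb
  have : x - refl b R 0 = (R ^ 2 / ‖b‖ ^ 2) • b + (x - b) := by
    rw [refl_zero, sub_smul, one_smul]; abel
  rw [this, norm_sq_smul_add, real_inner_comm]
  field_simp

lemma two_mul_inner_sub (b x : EuclideanSpace ℝ (Fin n)) :
    2 * inner ℝ (x - b) b = 2 * inner ℝ b x - 2 * ‖b‖ ^ 2 := by
  rw [inner_sub_left, real_inner_self_eq_norm_sq, real_inner_comm]; ring

/-- Both sides expand to the same polynomial in x-b. This is the distance distortion of the
inversion for the pair x, a = σ(0), squared and cleared of denominators. -/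
lemma norm_refl_sq_mul' (hb : b ≠ 0) (hx : x ≠ b) :
    ‖refl b R x‖ ^ 2 * ‖x - b‖ ^ 2 = ‖b‖ ^ 2 * ‖x - refl b R 0‖ ^ 2 := by
  rw [norm_refl_sq_mul hx, norm_sq_mul_norm_sub_refl_zero_sq hb]

lemma norm_sq_sub_norm_refl_sq_mul (hx : x ≠ b) :
    (‖b‖ ^ 2 - ‖refl b R x‖ ^ 2) * ‖x - b‖ ^ 2 =
      R ^ 2 * (2 * ‖b‖ ^ 2 - R ^ 2 - 2 * inner ℝ b x) := by
  have h1 := norm_refl_sq_mul (R := R) hx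
  have h2 := two_mul_inner_sub b x
  linear_combination -h1 - R ^ 2 * h2

/-- The affine function defining the half-space, centred at `σ(0)`. -/
lemma two_mul_norm_sq_sub_inner (hb : b ≠ 0) (x : EuclideanSpace ℝ (Fin n)) :
    2 * ‖b‖ ^ 2 - R ^ 2 - 2 * inner ℝ b x = R ^ 2 - 2 * inner ℝ b (x - refl b R 0) := by
  have h : ‖b‖ ≠ 0 := norm_ne_zero_iff.2 hb
  rw [refl_zero, inner_sub_right, inner_smul_right, real_inner_self_eq_norm_sq]
  field_simp
  ring

lemma ne_of_mem_halfSpace (hR : 0 < R) (hx : x ∈ halfSpace b R) : x ≠ b := by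
  rintro rfl
  have hx : 0 < 2 * ‖x‖ ^ 2 - R ^ 2 - 2 * inner ℝ x x := hx
  rw [real_inner_self_eq_norm_sq] at hx
  nlinarith

lemma norm_refl_lt (hR : 0 < R) (hx : x ∈ halfSpace b R) :
    0 < ‖b‖ ^ 2 - ‖refl b R x‖ ^ 2 := by
  have hne := ne_of_mem_halfSpace hR hx
  have h := norm_sq_sub_norm_refl_sq_mul (R := R) hne
  have hx : 0 < 2 * ‖b‖ ^ 2 - R ^ 2 - 2 * inner ℝ b x := hx
  have h1 : 0 < ‖x - b‖ := norm_pos_iff.2 (sub_ne_zero.2 hne)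
  have h2 : 0 < (‖b‖ ^ 2 - ‖refl b R x‖ ^ 2) * ‖x - b‖ ^ 2 := by rw [h]; positivity
  exact pos_of_mul_pos_left h2 (by positivity)

lemma levelFun_eq (hR : 0 < R) (hb : b ≠ 0) (hx : x ∈ halfSpace b R) :
    levelFun b R x =
      ‖b‖ ^ 2 * ‖x - refl b R 0‖ ^ 2 / (2 * ‖b‖ ^ 2 - R ^ 2 - 2 * inner ℝ b x) := by
  have hne := ne_of_mem_halfSpace hR hx
  have hD : 0 < 2 * ‖b‖ ^ 2 - R ^ 2 - 2 * inner ℝ b x := hx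
  have h1 : 0 < ‖x - b‖ ^ 2 := by
    have := norm_pos_iff.2 (sub_ne_zero.2 hne); positivity
  rw [levelFun, div_eq_div_iff (norm_refl_lt hR hx).ne' hD.ne']
  apply mul_right_cancel₀ h1.ne'
  linear_combination (R ^ 2 * (2 * ‖b‖ ^ 2 - R ^ 2 - 2 * inner ℝ b x)) * norm_refl_sq_mul' (R := R) hb hne
    - (‖b‖ ^ 2 * ‖x - refl b R 0‖ ^ 2) * norm_sq_sub_norm_refl_sq_mul (R := R) hne

/-- The level of `f` corresponding to the radius `r`. -/
noncomputable def level (b : EuclideanSpace ℝ (Fin n)) (R r : ℝ) : ℝ :=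
  R ^ 2 * r ^ 2 / (‖b‖ ^ 2 - r ^ 2)

lemma norm_sq_sub_sq_pos {r : ℝ} (hr : 0 < r) (hrb : r < ‖b‖) : 0 < ‖b‖ ^ 2 - r ^ 2 := by
  nlinarith

lemma level_pos {r : ℝ} (hR : 0 < R) (hr : 0 < r) (hrb : r < ‖b‖) : 0 < level b R r := by
  have := norm_sq_sub_sq_pos hr hrb
  unfold level; positivity

/-- A combination of the product identities for |σ(x)|² and |b|²-|σ(x)|² that isolates the sign of
|σ(x)|-r as the sign of a quadratic polynomial in x. Membership of x in the half-space is not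
needed. -/
lemma norm_refl_sq_sub_sq {r : ℝ} (hb : b ≠ 0) (hr : 0 < r) (hrb : r < ‖b‖) (hx : x ≠ b) :
    ‖b‖ ^ 2 * ((‖refl b R x‖ ^ 2 - r ^ 2) * ‖x - b‖ ^ 2) = (‖b‖ ^ 2 - r ^ 2) *
      (‖b‖ ^ 2 * ‖x - refl b R 0‖ ^ 2 -
        level b R r * (R ^ 2 - 2 * inner ℝ b (x - refl b R 0))) := by
  have h0 := (norm_sq_sub_sq_pos hr hrb).ne'
  rw [← two_mul_norm_sq_sub_inner hb, level]
  field_simp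
  linear_combination (‖b‖ ^ 2 - r ^ 2) * norm_refl_sq_mul' (R := R) hb hx
    - r ^ 2 * (norm_sq_sub_norm_refl_sq_mul (R := R) hx)

/-- The centre of the ball `σ(B_r)`. -/
noncomputable def imageCenter (b : EuclideanSpace ℝ (Fin n)) (R r : ℝ) :
    EuclideanSpace ℝ (Fin n) :=
  refl b R 0 - (level b R r / ‖b‖ ^ 2) • b

/-- The radius of the ball `σ(B_r)`. -/
noncomputable def imageRadius (b : EuclideanSpace ℝ (Fin n)) (R r : ℝ) : ℝ :=
  √((R ^ 2 * level b R r + level b R r ^ 2) / ‖b‖ ^ 2)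

lemma imageRadius_pos {r : ℝ} (hR : 0 < R) (hr : 0 < r) (hrb : r < ‖b‖) :
    0 < imageRadius b R r := by
  have := level_pos hR hr hrb
  have : 0 < ‖b‖ := hr.trans hrb
  unfold imageRadius; positivity

/-- Completing the square in that quadratic polynomial; the centre and the radius are read off from
it. -/
lemma norm_sub_imageCenter_sq {r : ℝ} (hb : b ≠ 0) (hR : 0 < R) (hr : 0 < r) (hrb : r < ‖b‖)
    (x : EuclideanSpace ℝ (Fin n)) :
    ‖b‖ ^ 2 * (‖x - imageCenter b R r‖ ^ 2 - imageRadius b R r ^ 2) =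
      ‖b‖ ^ 2 * ‖x - refl b R 0‖ ^ 2 -
        level b R r * (R ^ 2 - 2 * inner ℝ b (x - refl b R 0)) := by
  have h : ‖b‖ ≠ 0 := norm_ne_zero_iff.2 hb
  have hl := level_pos hR hr hrb
  have : x - imageCenter b R r = (level b R r / ‖b‖ ^ 2) • b + (x - refl b R 0) := by
    rw [imageCenter]; abel
  rw [this, norm_sq_smul_add, imageRadius, Real.sq_sqrt (by positivity)]
  field_simp
  ring

lemma mem_ballImage_iff {r : ℝ} (hR : 0 < R) : x ∈ ballImage b R r ↔ ‖refl b R x‖ < r := by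
  constructor
  · rintro ⟨z, hz, rfl⟩
    simpa [EuclideanGeometry.inversion_inversion b hR.ne'] using hz
  · intro h
    exact ⟨refl b R x, by simpa using h, EuclideanGeometry.inversion_inversion b hR.ne' x⟩

lemma mem_refl_image_sphere_iff {r : ℝ} (hR : 0 < R) :
    x ∈ refl b R '' Metric.sphere 0 r ↔ ‖refl b R x‖ = r := by
  constructor
  · rintro ⟨z, hz, rfl⟩
    simpa [EuclideanGeometry.inversion_inversion b hR.ne'] using hz
  · intro h
    exact ⟨refl b R x, by simpa using h, EuclideanGeometry.inversion_inversion b hR.ne' x⟩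

/-- A positive factor transfers <, = and ≤ at once, so open balls, spheres and closed balls all
follow from this comparison. -/
lemma norm_refl_sub_radius_sign {r : ℝ} (hb : b ≠ 0) (hR : 0 < R) (hr : 0 < r) (hrb : r < ‖b‖) :
    ∃ c > 0, ‖x - imageCenter b R r‖ - imageRadius b R r = c * (‖refl b R x‖ - r) := by
  have h0 : 0 < ‖b‖ := hr.trans hrb
  have hρ := imageRadius_pos hR hr hrb
  have h1 := norm_sq_sub_sq_pos hr hrb
  have key := norm_sub_imageCenter_sq hb hR hr hrb x
  -- The pole is a genuine case: `inversion` fixes its centre, so |σ(b)| = |b| > r, and b has to be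
  -- shown to lie outside the closed image ball.
  by_cases hx : x = b
  · subst hx
    have hl := level_pos hR hr hrb
    have hpos : imageRadius x R r < ‖x - imageCenter x R r‖ := by
      have h2 := norm_sq_mul_norm_sub_refl_zero_sq (R := R) hb x
      have h3 := two_mul_norm_sq_sub_inner (R := R) hb x
      rw [real_inner_self_eq_norm_sq] at h3
      rw [← h3, h2] at key
      simp only [sub_self, inner_zero_left, norm_zero] at key
      have : 0 < ‖x‖ ^ 2 * (‖x - imageCenter x R r‖ ^ 2 - imageRadius x R r ^ 2) := by
        rw [key]
        have : 0 < R ^ 4 := by positivity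
        nlinarith [mul_pos hl (pow_pos hR 2)]
      have := pos_of_mul_pos_right this (by positivity)
      exact lt_of_pow_lt_pow_left₀ 2 (norm_nonneg _) (by linarith)
    refine ⟨(‖x - imageCenter x R r‖ - imageRadius x R r) / (‖x‖ - r),
      div_pos (by linarith) (by linarith), ?_⟩
    rw [refl, EuclideanGeometry.inversion_self, div_mul_cancel₀ _ (by linarith)]
  · have h2 := norm_refl_sq_sub_sq (R := R) hb hr hrb hx
    rw [← key] at h2
    have h3 : 0 < ‖x - b‖ := norm_pos_iff.2 (sub_ne_zero.2 hx)
    have h4 : 0 < ‖x - imageCenter b R r‖ + imageRadius b R r := by positivity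
    have h5 : 0 < ‖refl b R x‖ + r := by positivity
    refine ⟨(‖refl b R x‖ + r) * ‖x - b‖ ^ 2 /
      ((‖b‖ ^ 2 - r ^ 2) * (‖x - imageCenter b R r‖ + imageRadius b R r)), by positivity, ?_⟩
    field_simp
    apply mul_left_cancel₀ (pow_pos h0 2).ne'
    linear_combination -h2

lemma ballImage_eq_ball {r : ℝ} (hb : b ≠ 0) (hR : 0 < R) (hr : 0 < r) (hrb : r < ‖b‖) :
    ballImage b R r = Metric.ball (imageCenter b R r) (imageRadius b R r) := by
  ext x
  obtain ⟨c, hc, h⟩ := norm_refl_sub_radius_sign (x := x) hb hR hr hrb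
  rw [mem_ballImage_iff hR, Metric.mem_ball, dist_eq_norm, ← sub_neg, ← sub_neg (b := imageRadius b R r),
    h, mul_neg_iff]
  constructor
  · intro h; exact Or.inl ⟨hc, h⟩
  · rintro (h | h)
    · exact h.2
    · linarith [h.1]

lemma image_sphere_eq_sphere {r : ℝ} (hb : b ≠ 0) (hR : 0 < R) (hr : 0 < r) (hrb : r < ‖b‖) :
    refl b R '' Metric.sphere 0 r = Metric.sphere (imageCenter b R r) (imageRadius b R r) := by
  ext x
  obtain ⟨c, hc, h⟩ := norm_refl_sub_radius_sign (x := x) hb hR hr hrb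
  rw [mem_refl_image_sphere_iff hR, mem_sphere_iff_norm, ← sub_eq_zero,
    ← sub_eq_zero (b := imageRadius b R r), h, mul_eq_zero]
  simp [hc.ne']

lemma frontier_ballImage {r : ℝ} (hb : b ≠ 0) (hR : 0 < R) (hr : 0 < r) (hrb : r < ‖b‖) :
    frontier (ballImage b R r) = refl b R '' Metric.sphere 0 r := by
  rw [ballImage_eq_ball hb hR hr hrb, image_sphere_eq_sphere hb hR hr hrb,
    frontier_ball _ (imageRadius_pos hR hr hrb).ne']

lemma mem_ballImage_iff_mul {r : ℝ} (hb : b ≠ 0) (hR : 0 < R) (hr : 0 < r) (hrb : r < ‖b‖) :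
    x ∈ ballImage b R r ↔ ‖b‖ ^ 2 * ‖x - refl b R 0‖ ^ 2 <
      level b R r * (R ^ 2 - 2 * inner ℝ b (x - refl b R 0)) := by
  have h0 : 0 < ‖b‖ ^ 2 := pow_pos (hr.trans hrb) 2
  have hρ := (imageRadius_pos hR hr hrb).le
  rw [ballImage_eq_ball hb hR hr hrb, Metric.mem_ball, dist_eq_norm,
    ← pow_lt_pow_iff_left₀ (norm_nonneg _) hρ two_ne_zero, ← sub_neg,
    ← sub_neg (a := ‖b‖ ^ 2 * _), ← norm_sub_imageCenter_sq hb hR hr hrb, mul_neg_iff]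
  constructor
  · intro h; exact Or.inl ⟨h0, h⟩
  · rintro (h | h)
    · exact h.2
    · linarith [h.1]

lemma levelFun_lt_iff {s : ℝ} (hb : b ≠ 0) (hR : 0 < R) (hx : x ∈ halfSpace b R) :
    levelFun b R x < s ↔ ‖b‖ ^ 2 * ‖x - refl b R 0‖ ^ 2 <
      s * (R ^ 2 - 2 * inner ℝ b (x - refl b R 0)) := by
  rw [levelFun_eq hR hb hx, div_lt_iff₀ hx, two_mul_norm_sq_sub_inner hb]

lemma ballImage_eq {r : ℝ} (hb : b ≠ 0) (hR : 0 < R) (hr : 0 < r) (hrb : r < ‖b‖) :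
    ballImage b R r = {x ∈ halfSpace b R | levelFun b R x < level b R r} := by
  ext x
  rw [mem_ballImage_iff_mul hb hR hr hrb]
  constructor
  · intro h
    -- The half-space condition is automatic, because a positive level times the affine function
    -- exceeds a nonnegative number.
    have hx : x ∈ halfSpace b R := by
      change 0 < 2 * ‖b‖ ^ 2 - R ^ 2 - 2 * inner ℝ b x
      rw [two_mul_norm_sq_sub_inner hb]
      exact pos_of_mul_pos_right (lt_of_le_of_lt (by positivity) h) (level_pos hR hr hrb).le
    exact ⟨hx, (levelFun_lt_iff hb hR hx).2 h⟩
  · rintro ⟨hx, h⟩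
    exact (levelFun_lt_iff hb hR hx).1 h

lemma level_lt_level {r q : ℝ} (hR : 0 < R) (hr : 0 < r) (hrq : r < q) (hq : q < ‖b‖) :
    level b R r < level b R q := by
  have h1 := norm_sq_sub_sq_pos (b := b) (hr.trans hrq) hq
  have h2 : r ^ 2 < q ^ 2 := by gcongr
  unfold level
  have : 0 < R ^ 2 * q ^ 2 := by have := hr.trans hrq; positivity
  gcongr

end Reflection

end MinimalMonotonicity

namespace MinimalMonotonicity

/-! ### Traces over subspaces and Gram matrices. -/

section TangentTrace

variable {n k : ℕ}

/-- The trace over the subspace `T` of the bilinear form `(u, w) ↦ ⟨B u, w⟩`. For the derivative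
`B` of a vector field this is the divergence of the field along `T`. -/
noncomputable def tangentTrace (T : Submodule ℝ (EuclideanSpace ℝ (Fin n)))
    (B : EuclideanSpace ℝ (Fin n) →L[ℝ] EuclideanSpace ℝ (Fin n)) : ℝ :=
  LinearMap.trace ℝ _ ((B ∘L T.starProjection : EuclideanSpace ℝ (Fin n) →L[ℝ] _) :
    EuclideanSpace ℝ (Fin n) →ₗ[ℝ] EuclideanSpace ℝ (Fin n))

variable (T : Submodule ℝ (EuclideanSpace ℝ (Fin n)))

lemma tangentTrace_add (B C : EuclideanSpace ℝ (Fin n) →L[ℝ] EuclideanSpace ℝ (Fin n)) :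
    tangentTrace T (B + C) = tangentTrace T B + tangentTrace T C := by
  simp [tangentTrace, ContinuousLinearMap.add_comp]

lemma tangentTrace_smul (c : ℝ) (B : EuclideanSpace ℝ (Fin n) →L[ℝ] EuclideanSpace ℝ (Fin n)) :
    tangentTrace T (c • B) = c * tangentTrace T B := by
  simp [tangentTrace, ContinuousLinearMap.smul_comp]

lemma tangentTrace_zero : tangentTrace T 0 = 0 := by
  simp [tangentTrace]

/-- Trace of a rank-one operator. It supplies the gradient terms in the divergence of a function
times a vector field. -/
lemma tangentTrace_smulRight (φ : EuclideanSpace ℝ (Fin n) →L[ℝ] ℝ)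
    (w : EuclideanSpace ℝ (Fin n)) :
    tangentTrace T (φ.smulRight w) = φ (T.starProjection w) := by
  rw [tangentTrace]
  exact LinearMap.trace_smulRight ((φ ∘L T.starProjection : EuclideanSpace ℝ (Fin n) →L[ℝ] ℝ) :
    EuclideanSpace ℝ (Fin n) →ₗ[ℝ] ℝ) w

/-- The Gram matrix of the images of the standard basis vectors. -/
noncomputable def gramOf (A : EuclideanSpace ℝ (Fin k) →L[ℝ] EuclideanSpace ℝ (Fin n)) :
    Matrix (Fin k) (Fin k) ℝ :=
  Matrix.of fun i j => inner ℝ (A (EuclideanSpace.single i 1)) (A (EuclideanSpace.single j 1))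

variable {A : EuclideanSpace ℝ (Fin k) →L[ℝ] EuclideanSpace ℝ (Fin n)}

lemma gramOf_apply (i j : Fin k) : gramOf A i j =
    inner ℝ (A (EuclideanSpace.single i 1)) (A (EuclideanSpace.single j 1)) := rfl

lemma gramOf_symm (i j : Fin k) : gramOf A i j = gramOf A j i := by
  simp [gramOf_apply, real_inner_comm]

lemma gramOf_inv_symm (i j : Fin k) : (gramOf A)⁻¹ i j = (gramOf A)⁻¹ j i := by
  have h : (gramOf A).transpose = gramOf A := by
    ext i j; exact gramOf_symm j i
  conv_lhs => rw [← h, ← Matrix.transpose_nonsing_inv]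
  rfl

lemma linearIndependent_of_injective (hA : Function.Injective A) :
    LinearIndependent ℝ fun i => A (EuclideanSpace.single i (1 : ℝ)) := by
  have h := (EuclideanSpace.basisFun (Fin k) ℝ).toBasis.linearIndependent
  have := h.map' A.toLinearMap (LinearMap.ker_eq_bot.2 hA)
  simpa [Function.comp_def] using this

lemma det_gramOf_ne_zero (hA : Function.Injective A) : (gramOf A).det ≠ 0 :=
  Matrix.det_gram_ne_zero_iff_linearIndependent.2 (linearIndependent_of_injective hA)

lemma det_gramOf_eq_normDet_sq (A : EuclideanSpace ℝ (Fin k) →L[ℝ] EuclideanSpace ℝ (Fin n)) :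
    (gramOf A).det = A.toLinearMap.normDet ^ 2 := by
  have := LinearMap.normDet_sq_eq_det_gram A.toLinearMap
    (EuclideanSpace.basisFun (Fin k) ℝ)
  simp only [RCLike.ofReal_real_eq_id, id] at this
  rw [this]
  congr 1
  ext i j
  simp [gramOf_apply, Matrix.gram_apply]

lemma det_gramOf_pos (hA : Function.Injective A) : 0 < (gramOf A).det := by
  have h := det_gramOf_ne_zero hA
  rw [det_gramOf_eq_normDet_sq] at h ⊢
  positivity

lemma sum_gramOf_inv_mul (hA : Function.Injective A) (i l : Fin k) :
    ∑ j, (gramOf A)⁻¹ i j * gramOf A j l = if i = l then 1 else 0 := by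
  have := Matrix.nonsing_inv_mul (gramOf A) (isUnit_iff_ne_zero.2 (det_gramOf_ne_zero hA))
  rw [← Matrix.mul_apply, this, Matrix.one_apply]

/-- The orthogonal projection to the range of an injective map in terms of the Gram matrix. -/
lemma starProjection_range_eq (hA : Function.Injective A) (u : EuclideanSpace ℝ (Fin n)) :
    A.range.starProjection u = ∑ i, ∑ j, ((gramOf A)⁻¹ i j *
      inner ℝ u (A (EuclideanSpace.single i 1))) • A (EuclideanSpace.single j 1) := by
  refine Submodule.eq_starProjection_of_mem_of_inner_eq_zero ?_ ?_
  · refine Submodule.sum_mem _ fun i _ => Submodule.sum_mem _ fun j _ => Submodule.smul_mem _ _ ?_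
    exact LinearMap.mem_range_self A.toLinearMap _
  · rintro w ⟨z, rfl⟩
    have hz : z = ∑ l, z l • EuclideanSpace.single l (1 : ℝ) := by
      conv_lhs => rw [← (EuclideanSpace.basisFun (Fin k) ℝ).sum_repr z]
      simp
    have key : ∀ l : Fin k, inner ℝ (u - ∑ i, ∑ j, ((gramOf A)⁻¹ i j *
        inner ℝ u (A (EuclideanSpace.single i 1))) • A (EuclideanSpace.single j 1))
        (A (EuclideanSpace.single l 1)) = 0 := by
      intro l
      simp only [inner_sub_left, sum_inner, inner_smul_left, conj_trivial, ← gramOf_apply]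
      have : ∀ i, ∑ j, (gramOf A)⁻¹ i j * inner ℝ u (A (EuclideanSpace.single i 1)) * gramOf A j l
          = if i = l then inner ℝ u (A (EuclideanSpace.single i 1)) else 0 := by
        intro i
        have := congrArg (· * inner ℝ u (A (EuclideanSpace.single i 1)))
          (sum_gramOf_inv_mul hA i l)
        simp only [Finset.sum_mul, ite_mul, one_mul, zero_mul] at this
        rw [← this]
        exact Finset.sum_congr rfl fun j _ => by ring
      simp [this]
    rw [hz]
    simp only [ContinuousLinearMap.coe_coe, map_sum, map_smul, inner_sum, inner_smul_right, key,
      mul_zero, Finset.sum_const_zero]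

/-- Expanding the projection in the frame splits the operator into rank-one pieces. This turns the
invariant divergence into its coordinate expression in a chart. -/
lemma tangentTrace_range (hA : Function.Injective A)
    (B : EuclideanSpace ℝ (Fin n) →L[ℝ] EuclideanSpace ℝ (Fin n)) :
    tangentTrace A.range B = ∑ i, ∑ j, (gramOf A)⁻¹ i j *
      inner ℝ (B (A (EuclideanSpace.single i 1))) (A (EuclideanSpace.single j 1)) := by
  have : B ∘L A.range.starProjection = ∑ j, ∑ i, (gramOf A)⁻¹ j i •
      ((innerSL ℝ (A (EuclideanSpace.single j 1))).smulRight
        (B (A (EuclideanSpace.single i 1)))) := by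
    ext1 u
    simp [starProjection_range_eq hA, map_sum, mul_smul,
      real_inner_comm]
  rw [tangentTrace, this, Finset.sum_comm]
  simp only [ContinuousLinearMap.toLinearMap_sum, ContinuousLinearMap.toLinearMap_smul, map_sum,
    map_smul, smul_eq_mul]
  refine Finset.sum_congr rfl fun i _ => Finset.sum_congr rfl fun j _ => ?_
  rw [gramOf_inv_symm]
  congr 1
  have := LinearMap.trace_smulRight
    ((innerSL ℝ (A (EuclideanSpace.single j 1)) : EuclideanSpace ℝ (Fin n) →L[ℝ] ℝ) :
      EuclideanSpace ℝ (Fin n) →ₗ[ℝ] ℝ) (B (A (EuclideanSpace.single i 1)))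
  rw [real_inner_comm]
  exact this

lemma tangentTrace_range_id (hA : Function.Injective A) :
    tangentTrace A.range (ContinuousLinearMap.id ℝ _) = k := by
  rw [tangentTrace_range hA]
  simp only [ContinuousLinearMap.id_apply, ← gramOf_apply]
  have : ∀ i, ∑ j, (gramOf A)⁻¹ i j * gramOf A i j = 1 := by
    intro i
    have := sum_gramOf_inv_mul hA i i
    simp only [if_true] at this
    rw [← this]
    exact Finset.sum_congr rfl fun j _ => by rw [gramOf_symm]
  simp [this]

end TangentTrace

/-! ### Charts and tangent spaces. -/

section Chart

variable {n k : ℕ} {M : Set (EuclideanSpace ℝ (Fin n))} {V : Set (EuclideanSpace ℝ (Fin k))}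
  {F : EuclideanSpace ℝ (Fin k) → EuclideanSpace ℝ (Fin n)}

namespace IsLocalParametrization

lemma hasStrictFDerivAt (h : IsLocalParametrization M V F) {v : EuclideanSpace ℝ (Fin k)}
    (hv : v ∈ V) : HasStrictFDerivAt F (fderiv ℝ F v) v :=
  (h.contDiffOn.contDiffAt (h.isOpen_domain.mem_nhds hv)).hasStrictFDerivAt (by simp)

lemma hasFDerivAt (h : IsLocalParametrization M V F) {v : EuclideanSpace ℝ (Fin k)}
    (hv : v ∈ V) : HasFDerivAt F (fderiv ℝ F v) v :=
  (h.hasStrictFDerivAt hv).hasFDerivAt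

lemma contDiffOn_fderiv (h : IsLocalParametrization M V F) :
    ContDiffOn ℝ ∞ (fderiv ℝ F) V :=
  h.contDiffOn.fderiv_of_isOpen h.isOpen_domain (by simp)

lemma injOn (h : IsLocalParametrization M V F) : InjOn F V :=
  injOn_iff_injective.2 h.isEmbedding.injective

lemma image_subset (h : IsLocalParametrization M V F) : F '' V ⊆ M := by
  obtain ⟨W, -, hW⟩ := h.isOpen_image
  rw [hW]; exact inter_subset_left

lemma mem (h : IsLocalParametrization M V F) {v : EuclideanSpace ℝ (Fin k)}
    (hv : v ∈ V) : F v ∈ M := h.image_subset ⟨v, hv, rfl⟩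

/-- A chart has a continuous inverse. -/
lemma tendsto_of_tendsto (h : IsLocalParametrization M V F) {α : Type*} {l : Filter α}
    {w : α → EuclideanSpace ℝ (Fin k)} {v : EuclideanSpace ℝ (Fin k)} (hv : v ∈ V)
    (hw : ∀ᶠ i in l, w i ∈ V) (ht : Filter.Tendsto (fun i => F (w i)) l (nhds (F v))) :
    Filter.Tendsto w l (nhds v) := by
  classical
  let w' : α → V := fun i => if hi : w i ∈ V then ⟨w i, hi⟩ else ⟨v, hv⟩
  have hw' : ∀ᶠ i in l, (w' i : EuclideanSpace ℝ (Fin k)) = w i := by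
    filter_upwards [hw] with i hi
    simp [w', hi]
  have h1 : Filter.Tendsto w' l (nhds ⟨v, hv⟩) := by
    rw [h.isEmbedding.tendsto_nhds_iff]
    refine Filter.Tendsto.congr' ?_ ht
    filter_upwards [hw'] with i hi
    simp [Set.domRestrict, hi]
  exact Filter.Tendsto.congr' hw' ((continuous_subtype_val.tendsto _).comp h1)

/-- Small displacements within M lift through the continuous inverse of the chart to parameters
tending to v. After rescaling, the error of the linear approximation tends to zero, so the limit
lies in the closed range of the derivative. The converse is the image of the full tangent cone of
the open set V. -/
lemma tangentCone_eq (h : IsLocalParametrization M V F) {v : EuclideanSpace ℝ (Fin k)}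
    (hv : v ∈ V) : tangentConeAt ℝ M (F v) = ((fderiv ℝ F v).range : Set _) := by
  apply Subset.antisymm
  · intro y hy
    obtain ⟨α, l, hl, c, d, hd, hdM, hcd⟩ := exists_fun_of_mem_tangentConeAt hy
    obtain ⟨W, hWo, hW⟩ := h.isOpen_image
    have hFvW : F v ∈ W := by
      have : F v ∈ M ∩ W := hW ▸ ⟨v, hv, rfl⟩
      exact this.2
    have hsum : Filter.Tendsto (fun i => F v + d i) l (nhds (F v)) := by
      simpa using tendsto_const_nhds.add hd
    have hex : ∀ᶠ i in l, ∃ w ∈ V, F w = F v + d i := by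
      filter_upwards [hdM, hsum.eventually (hWo.mem_nhds hFvW)] with i h1 h2
      have : F v + d i ∈ F '' V := hW ▸ ⟨h1, h2⟩
      exact this
    classical
    let w : α → EuclideanSpace ℝ (Fin k) := fun i =>
      if hi : ∃ w ∈ V, F w = F v + d i then hi.choose else v
    have hw : ∀ᶠ i in l, w i ∈ V ∧ F (w i) = F v + d i := by
      filter_upwards [hex] with i hi
      simp only [w, hi, dif_pos]
      exact hi.choose_spec
    have hwt : Filter.Tendsto w l (nhds v) := by
      refine h.tendsto_of_tendsto hv (hw.mono fun i hi => hi.1) (hsum.congr' ?_)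
      filter_upwards [hw] with i hi using hi.2.symm
    obtain ⟨C, -, hC⟩ := LinearMap.exists_antilipschitzWith
      (fderiv ℝ F v).toLinearMap
      (LinearMap.ker_eq_bot.2 (h.injective_fderiv v hv))
    -- Injectivity of the derivative bounds the parameter displacement by the displacement in space,
    -- so the remainder is o(d) and remains negligible after multiplication by c.
    have hO := ((HasFDerivAt.isTheta_sub (h.hasFDerivAt hv)
      (hC.isInducing (fderiv ℝ F v).continuous)).isBigO_symm.comp_tendsto hwt)
    have ho := ((h.hasFDerivAt hv).isLittleO.comp_tendsto hwt).trans_isBigO hO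
    have hd' : (fun i => F (w i) - F v) =ᶠ[l] d := by
      filter_upwards [hw] with i hi
      simp [hi.2]
    have ho2 : (fun i => c i • (F (w i) - F v - fderiv ℝ F v (w i - v))) =o[l] (fun i => c i • d i) := by
      refine Asymptotics.IsBigO.smul_isLittleO (Asymptotics.isBigO_refl c l) ?_
      exact ho.trans_eventuallyEq hd'
    have ht0 : Filter.Tendsto (fun i => c i • (F (w i) - F v - fderiv ℝ F v (w i - v))) l (nhds 0) :=
      (ho2.trans_isBigO (hcd.isBigO_one ℝ)).tendsto_zero_of_tendsto tendsto_const_nhds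
    have hlim : Filter.Tendsto (fun i => fderiv ℝ F v (c i • (w i - v))) l (nhds y) := by
      have := hcd.sub ht0
      rw [sub_zero] at this
      refine this.congr' ?_
      filter_upwards [hw] with i hi
      rw [hi.2, map_smul, smul_sub, smul_sub]
      simp
    exact (Submodule.closed_of_finiteDimensional (fderiv ℝ F v).range).mem_of_tendsto hlim
      (Filter.Eventually.of_forall fun i => ⟨_, rfl⟩)
  · rintro _ ⟨z, rfl⟩
    refine tangentConeAt_mono h.image_subset ?_
    refine (h.hasFDerivAt hv).hasFDerivWithinAt.mapsTo_tangent_cone ?_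
    rw [tangentConeAt_of_mem_nhds (h.isOpen_domain.mem_nhds hv)]
    trivial

lemma tangentSpace_eq (h : IsLocalParametrization M V F) {v : EuclideanSpace ℝ (Fin k)}
    (hv : v ∈ V) : tangentSpace M (F v) = (fderiv ℝ F v).range := by
  rw [tangentSpace, h.tangentCone_eq hv, Submodule.span_eq]

end IsLocalParametrization

lemma norm_tangential_sq_add_norm_normal_sq (M : Set (EuclideanSpace ℝ (Fin n)))
    (x X : EuclideanSpace ℝ (Fin n)) :
    ‖tangential M x X‖ ^ 2 + ‖normal M x X‖ ^ 2 = ‖X‖ ^ 2 :=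
  ((tangentSpace M x).norm_sq_eq_add_norm_sq_starProjection X).symm

lemma tangential_add_normal (M : Set (EuclideanSpace ℝ (Fin n)))
    (x X : EuclideanSpace ℝ (Fin n)) : tangential M x X + normal M x X = X :=
  (tangentSpace M x).starProjection_add_starProjection_orthogonal X

lemma inner_tangential (M : Set (EuclideanSpace ℝ (Fin n))) (x X Y : EuclideanSpace ℝ (Fin n)) :
    inner ℝ X (tangential M x Y) = inner ℝ (tangential M x X) (tangential M x Y) := by
  rw [tangential, tangential, Submodule.inner_starProjection_left_eq_right]
  congr 1
  exact (Submodule.starProjection_eq_self_iff.2 (Submodule.starProjection_apply_mem _ _)).symm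

end Chart

end MinimalMonotonicity

namespace MinimalMonotonicity

/-! ### The area formula for local parametrizations. -/

section AreaFormula

open scoped NNReal ENNReal
open Filter Topology

variable {n k : ℕ}

/-- Comparison of the Hausdorff measures of two images of the same set. -/
lemma euclideanHausdorffMeasure_image_le_of_edist_le {X Y Z : Type*} [Nonempty X]
    [EMetricSpace Y] [MeasurableSpace Y] [BorelSpace Y] [EMetricSpace Z] [MeasurableSpace Z]
    [BorelSpace Z] {f : X → Y} {g : X → Z} {A : Set X} {c : ℝ≥0} (d : ℕ)
    (h : ∀ x ∈ A, ∀ y ∈ A, edist (f x) (f y) ≤ c * edist (g x) (g y)) :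
    μHE[d] (f '' A) ≤ (c : ℝ≥0∞) ^ d * μHE[d] (g '' A) := by
  -- The hypothesis forces f to be constant on the fibres of g in A, so f factors through g by a
  -- c-Lipschitz map even when g is not injective.
  have hinv : ∀ x ∈ A, Function.invFunOn g A (g x) ∈ A ∧ g (Function.invFunOn g A (g x)) = g x :=
    fun x hx => ⟨Function.invFunOn_mem ⟨x, hx, rfl⟩, Function.invFunOn_eq ⟨x, hx, rfl⟩⟩
  have himg : f '' A = (f ∘ Function.invFunOn g A) '' (g '' A) := by
    rw [← image_comp]
    refine image_congr fun x hx => ?_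
    have h1 := h x hx _ (hinv x hx).1
    rw [(hinv x hx).2, edist_self, mul_zero, nonpos_iff_eq_zero, edist_eq_zero] at h1
    exact h1
  have hlip : LipschitzOnWith c (f ∘ Function.invFunOn g A) (g '' A) := by
    rintro _ ⟨x, hx, rfl⟩ _ ⟨y, hy, rfl⟩
    refine (h _ (hinv x hx).1 _ (hinv y hy).1).trans ?_
    rw [(hinv x hx).2, (hinv y hy).2]
  have := hlip.hausdorffMeasure_image_le (d := (d : ℝ)) (by positivity)
  rw [← himg, ENNReal.rpow_natCast] at this
  simp only [Measure.euclideanHausdorffMeasure_def, Measure.smul_apply, Measure.nnreal_smul_coe_apply]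
  rw [mul_left_comm]
  gcongr

/-- A linear approximation with small error changes distances by a factor close to `1`. -/
lemma exists_nhds_edist_le {F : EuclideanSpace ℝ (Fin k) → EuclideanSpace ℝ (Fin n)}
    {L : EuclideanSpace ℝ (Fin k) →L[ℝ] EuclideanSpace ℝ (Fin n)} {v : EuclideanSpace ℝ (Fin k)}
    (hF : HasStrictFDerivAt F L v) (hL : Function.Injective L) {s : ℝ≥0} (hs : 1 < s) :
    ∃ B ∈ 𝓝 v, ∀ x ∈ B, ∀ y ∈ B, edist (F x) (F y) ≤ s * edist (L x) (L y) ∧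
      edist (L x) (L y) ≤ s * edist (F x) (F y) := by
  obtain ⟨C, hC0, hC⟩ := LinearMap.exists_antilipschitzWith L.toLinearMap
    (LinearMap.ker_eq_bot.2 hL)
  have hs' : (1 : ℝ) < s := by exact_mod_cast hs
  have hs0 : (0 : ℝ) < s := by linarith
  have hC0' : (0 : ℝ) < C := by exact_mod_cast hC0
  -- This constant makes the error at most (1 - 1/s)|L(x-y)|. The lower bound for |F x - F y| is
  -- then |L(x-y)|/s, and the upper factor 2 - 1/s is at most s because s + 1/s ≥ 2.
  obtain ⟨B, hB, hBF⟩ := hF.approximates_deriv_on_nhds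
    (c := ((1 - (s : ℝ)⁻¹) / C).toNNReal) (Or.inr (by
      rw [Real.toNNReal_pos]
      have : (s : ℝ)⁻¹ < 1 := inv_lt_one_of_one_lt₀ hs'
      have : 0 < 1 - (s : ℝ)⁻¹ := by linarith
      positivity))
  have hinv : (s : ℝ)⁻¹ < 1 := inv_lt_one_of_one_lt₀ hs'
  refine ⟨B, hB, fun x hx y hy => ?_⟩
  have h1 := hBF x hx y hy
  have h2 : ‖x - y‖ ≤ C * ‖L (x - y)‖ := by
    have := hC.le_mul_dist x y
    simpa [dist_eq_norm] using this
  rw [Real.coe_toNNReal _ (div_nonneg (by linarith) hC0'.le)] at h1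
  have h3 : ‖F x - F y - L (x - y)‖ ≤ (1 - (s : ℝ)⁻¹) * ‖L (x - y)‖ := by
    refine h1.trans ?_
    rw [div_mul_eq_mul_div, div_le_iff₀ hC0']
    have : (0 : ℝ) ≤ 1 - (s : ℝ)⁻¹ := by linarith
    nlinarith
  have h4 : ‖F x - F y‖ ≤ ‖F x - F y - L (x - y)‖ + ‖L (x - y)‖ := by
    simpa using norm_add_le (F x - F y - L (x - y)) (L (x - y))
  have h5 : ‖L (x - y)‖ ≤ ‖F x - F y‖ + ‖F x - F y - L (x - y)‖ := by
    simpa using norm_sub_le (F x - F y) (F x - F y - L (x - y))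
  have h6 : ‖F x - F y‖ ≤ s * ‖L (x - y)‖ := by
    have : 2 - (s : ℝ)⁻¹ ≤ s := by
      have : (s : ℝ) * (s : ℝ)⁻¹ = 1 := mul_inv_cancel₀ hs0.ne'
      nlinarith [mul_pos hs0 (inv_pos.2 hs0), sq_nonneg ((s : ℝ) - 1), inv_pos.2 hs0]
    nlinarith [norm_nonneg (L (x - y))]
  have h7 : ‖L (x - y)‖ ≤ s * ‖F x - F y‖ := by
    have : (s : ℝ)⁻¹ * ‖L (x - y)‖ ≤ ‖F x - F y‖ := by linarith
    rwa [inv_mul_le_iff₀ hs0] at this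
  constructor
  · rw [edist_nndist, edist_nndist, ← ENNReal.coe_mul, ENNReal.coe_le_coe, ← NNReal.coe_le_coe]
    simpa [dist_eq_norm, ← map_sub] using h6
  · rw [edist_nndist, edist_nndist, ← ENNReal.coe_mul, ENNReal.coe_le_coe, ← NNReal.coe_le_coe]
    simpa [dist_eq_norm, ← map_sub] using h7

/-- The density `√det(gᵢⱼ)` of the volume in a parametrization. -/
noncomputable def volDensity (F : EuclideanSpace ℝ (Fin k) → EuclideanSpace ℝ (Fin n))
    (v : EuclideanSpace ℝ (Fin k)) : ℝ :=
  √(gramOf (fderiv ℝ F v)).det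

lemma volDensity_eq_normDet (F : EuclideanSpace ℝ (Fin k) → EuclideanSpace ℝ (Fin n))
    (v : EuclideanSpace ℝ (Fin k)) : volDensity F v = (fderiv ℝ F v).toLinearMap.normDet := by
  rw [volDensity, det_gramOf_eq_normDet_sq, Real.sqrt_sq (LinearMap.normDet_nonneg _)]

lemma euclideanHausdorffMeasure_image_linear
    (L : EuclideanSpace ℝ (Fin k) →L[ℝ] EuclideanSpace ℝ (Fin n))
    (A : Set (EuclideanSpace ℝ (Fin k))) :
    μHE[k] (L '' A) = ENNReal.ofReal L.toLinearMap.normDet * volume A := by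
  have := LinearMap.euclideanHausdorffMeasure_image_eq_normDet_mul_volume L.toLinearMap A
  rwa [finrank_euclideanSpace_fin] at this

lemma ENNReal.le_of_forall_one_lt_le_mul' {a b : ℝ≥0∞}
    (h : ∀ t : ℝ≥0, 1 < t → a ≤ t * b) : a ≤ b := by
  have h1 : Tendsto (fun t : ℝ≥0 => (t : ℝ≥0∞) * b) (𝓝[>] 1) (𝓝 ((1 : ℝ≥0) * b)) := by
    refine ENNReal.Tendsto.mul_const ?_ (Or.inl (by simp))
    exact (ENNReal.continuous_coe.tendsto 1).mono_left nhdsWithin_le_nhds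
  rw [ENNReal.coe_one, one_mul] at h1
  refine ge_of_tendsto h1 ?_
  filter_upwards [self_mem_nhdsWithin] with t ht using h t ht

variable {M : Set (EuclideanSpace ℝ (Fin n))} {V : Set (EuclideanSpace ℝ (Fin k))}
  {F : EuclideanSpace ℝ (Fin k) → EuclideanSpace ℝ (Fin n)}

namespace IsLocalParametrization

lemma contDiffOn_gramOf (h : IsLocalParametrization M V F) (i j : Fin k) :
    ContDiffOn ℝ ∞ (fun v => gramOf (fderiv ℝ F v) i j) V :=
  (h.contDiffOn_fderiv.clm_apply contDiffOn_const).inner ℝ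
    (h.contDiffOn_fderiv.clm_apply contDiffOn_const)

lemma contDiffOn_det (h : IsLocalParametrization M V F) :
    ContDiffOn ℝ ∞ (fun v => (gramOf (fderiv ℝ F v)).det) V := by
  simp only [Matrix.det_apply]
  refine ContDiffOn.sum fun σ _ => ContDiffOn.const_smul _ ?_
  exact contDiffOn_prod fun i _ => h.contDiffOn_gramOf _ _

lemma contDiffOn_volDensity (h : IsLocalParametrization M V F) :
    ContDiffOn ℝ ∞ (volDensity F) V :=
  h.contDiffOn_det.sqrt fun v hv => (det_gramOf_pos (h.injective_fderiv v hv)).ne'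

lemma volDensity_pos (h : IsLocalParametrization M V F) {v : EuclideanSpace ℝ (Fin k)}
    (hv : v ∈ V) : 0 < volDensity F v :=
  Real.sqrt_pos.2 (det_gramOf_pos (h.injective_fderiv v hv))

lemma continuousOn (h : IsLocalParametrization M V F) : ContinuousOn F V :=
  h.contDiffOn.continuousOn

/-- Near v the map differs from its derivative by a factor s in distances, hence by s^k in measure,
and the density differs from its value at v by another factor s. The area formula for linear maps
does the rest, which is why s^(k+1) ≤ t is arranged. -/
lemma exists_nhds_measure_image (h : IsLocalParametrization M V F) {t : ℝ≥0} (ht : 1 < t)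
    {v : EuclideanSpace ℝ (Fin k)} (hv : v ∈ V) :
    ∃ B ∈ 𝓝 v, ∀ A ⊆ B, MeasurableSet A →
      μHE[k] (F '' A) ≤ t * ∫⁻ w in A, ENNReal.ofReal (volDensity F w) ∧
      ∫⁻ w in A, ENNReal.ofReal (volDensity F w) ≤ t * μHE[k] (F '' A) := by
  obtain ⟨s, hs, hst⟩ : ∃ s : ℝ≥0, 1 < s ∧ s ^ (k + 1) ≤ t := by
    have : ∀ᶠ s : ℝ≥0 in 𝓝[>] 1, s ^ (k + 1) < t := by
      refine Filter.Eventually.filter_mono nhdsWithin_le_nhds ?_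
      exact (continuous_pow (k + 1)).tendsto' (1 : ℝ≥0) 1 (by simp) |>.eventually_lt_const ht
    obtain ⟨s, h1, h2⟩ := (this.and self_mem_nhdsWithin).exists
    exact ⟨s, h2, h1.le⟩
  have hs' : (1 : ℝ) < s := by exact_mod_cast hs
  have hs0 : (0 : ℝ) < s := by linarith
  obtain ⟨B, hB, hBF⟩ := exists_nhds_edist_le (h.hasStrictFDerivAt hv) (h.injective_fderiv v hv) hs
  have hJ := h.volDensity_pos hv
  have hJc : ContinuousAt (volDensity F) v :=
    h.contDiffOn_volDensity.continuousOn.continuousAt (h.isOpen_domain.mem_nhds hv)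
  have hB2 : {w | volDensity F w ≤ s * volDensity F v ∧ volDensity F v ≤ s * volDensity F w} ∈ 𝓝 v := by
    have e1 : ∀ᶠ w in 𝓝 v, volDensity F w < s * volDensity F v :=
      hJc.eventually_lt_const (by nlinarith)
    have e2 : ∀ᶠ w in 𝓝 v, volDensity F v < s * volDensity F w :=
      (hJc.const_mul (s : ℝ)).eventually_const_lt (by nlinarith)
    filter_upwards [e1, e2] with w h1 h2 using ⟨h1.le, h2.le⟩
  refine ⟨_, inter_mem hB hB2, fun A hA hAm => ?_⟩
  have hL := euclideanHausdorffMeasure_image_linear (fderiv ℝ F v) A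
  rw [← volDensity_eq_normDet] at hL
  have h1 := euclideanHausdorffMeasure_image_le_of_edist_le k
    fun x hx y hy => (hBF x (hA hx).1 y (hA hy).1).1
  have h2 := euclideanHausdorffMeasure_image_le_of_edist_le k
    fun x hx y hy => (hBF x (hA hx).1 y (hA hy).1).2
  rw [hL] at h1 h2
  have h3 : ENNReal.ofReal (volDensity F v) * volume A ≤
      s * ∫⁻ w in A, ENNReal.ofReal (volDensity F w) := by
    rw [← setLIntegral_const, ← lintegral_const_mul' _ _ (by simp)]
    refine setLIntegral_mono' hAm fun w hw => ?_
    rw [← ENNReal.ofReal_coe_nnreal, ← ENNReal.ofReal_mul hs0.le]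
    exact ENNReal.ofReal_le_ofReal (hA hw).2.2
  have h4 : ∫⁻ w in A, ENNReal.ofReal (volDensity F w) ≤
      s * (ENNReal.ofReal (volDensity F v) * volume A) := by
    rw [← setLIntegral_const, ← lintegral_const_mul' _ _ (by simp)]
    refine setLIntegral_mono' hAm fun w hw => ?_
    rw [← ENNReal.ofReal_coe_nnreal, ← ENNReal.ofReal_mul hs0.le]
    exact ENNReal.ofReal_le_ofReal (hA hw).2.1
  have hst' : (s : ℝ≥0∞) ^ (k + 1) ≤ t := by exact_mod_cast hst
  constructor
  · calc μHE[k] (F '' A) ≤ (s : ℝ≥0∞) ^ k * (s * ∫⁻ w in A, ENNReal.ofReal (volDensity F w)) := by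
          refine h1.trans ?_; gcongr
      _ = (s : ℝ≥0∞) ^ (k + 1) * ∫⁻ w in A, ENNReal.ofReal (volDensity F w) := by
          rw [pow_succ, mul_assoc]
      _ ≤ _ := by gcongr
  · calc ∫⁻ w in A, ENNReal.ofReal (volDensity F w) ≤ s * ((s : ℝ≥0∞) ^ k * μHE[k] (F '' A)) := by
          refine h4.trans ?_; gcongr
      _ = (s : ℝ≥0∞) ^ (k + 1) * μHE[k] (F '' A) := by rw [pow_succ', mul_assoc]
      _ ≤ _ := by gcongr

lemma measurableSet_image (h : IsLocalParametrization M V F) {A : Set (EuclideanSpace ℝ (Fin k))}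
    (hA : MeasurableSet A) (hAV : A ⊆ V) : MeasurableSet (F '' A) :=
  hA.image_of_continuousOn_injOn (h.continuousOn.mono hAV) (h.injOn.mono hAV)

/-- The area formula for the image of a set under a local parametrization. -/
lemma measure_image (h : IsLocalParametrization M V F) {A : Set (EuclideanSpace ℝ (Fin k))}
    (hA : MeasurableSet A) (hAV : A ⊆ V) :
    μHE[k] (F '' A) = ∫⁻ w in A, ENNReal.ofReal (volDensity F w) := by
  have key : ∀ t : ℝ≥0, 1 < t →
      μHE[k] (F '' A) ≤ t * ∫⁻ w in A, ENNReal.ofReal (volDensity F w) ∧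
      ∫⁻ w in A, ENNReal.ofReal (volDensity F w) ≤ t * μHE[k] (F '' A) := by
    intro t ht
    rcases A.eq_empty_or_nonempty with rfl | hne
    · simp
    choose! B hB hBA using fun v (hv : v ∈ V) => h.exists_nhds_measure_image ht hv
    -- Countably many of the good neighbourhoods cover A and are made disjoint. The factor t is the
    -- same on every piece, so it survives summation and can be sent to 1 at the end.
    obtain ⟨T, hTA, hTc, hT⟩ := TopologicalSpace.countable_cover_nhdsWithin
      (f := fun v => interior (B v)) (s := A)
      fun v hv => mem_nhdsWithin_of_mem_nhds (interior_mem_nhds.2 (hB v (hAV hv)))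
    have hTne : T.Nonempty := by
      by_contra hT0
      rw [not_nonempty_iff_eq_empty] at hT0
      subst hT0
      obtain ⟨x, hx⟩ := hne
      simpa using hT hx
    obtain ⟨e, rfl⟩ := hTc.exists_eq_range hTne
    let D : ℕ → Set (EuclideanSpace ℝ (Fin k)) :=
      fun i => A ∩ disjointed (fun i => interior (B (e i))) i
    have hDm : ∀ i, MeasurableSet (D i) := fun i =>
      hA.inter (MeasurableSet.disjointed (fun i => isOpen_interior.measurableSet) i)
    have hDd : Pairwise (Function.onFun Disjoint D) := fun i j hij =>
      ((disjoint_disjointed _) hij).mono inter_subset_right inter_subset_right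
    have hDU : ⋃ i, D i = A := by
      rw [← inter_iUnion, iUnion_disjointed, inter_eq_left]
      simpa using hT
    have hDA : ∀ i, D i ⊆ A := fun i => inter_subset_left
    have hDB : ∀ i, D i ⊆ B (e i) := fun i =>
      inter_subset_right.trans ((disjointed_subset _ i).trans interior_subset)
    have heV : ∀ i, e i ∈ V := fun i => hAV (hTA ⟨i, rfl⟩)
    have e1 : μHE[k] (F '' A) = ∑' i, μHE[k] (F '' (D i)) := by
      conv_lhs => rw [← hDU, image_iUnion]
      refine measure_iUnion ?_ fun i => h.measurableSet_image (hDm i) ((hDA i).trans hAV)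
      intro i j hij
      exact (hDd hij).image (h.injOn.mono hAV) (hDA i) (hDA j)
    have e2 : ∫⁻ w in A, ENNReal.ofReal (volDensity F w) =
        ∑' i, ∫⁻ w in D i, ENNReal.ofReal (volDensity F w) := by
      conv_lhs => rw [← hDU]
      exact lintegral_iUnion hDm hDd _
    rw [e1, e2, ← ENNReal.tsum_mul_left, ← ENNReal.tsum_mul_left]
    exact ⟨ENNReal.tsum_le_tsum fun i => (hBA _ (heV i) _ (hDB i) (hDm i)).1,
      ENNReal.tsum_le_tsum fun i => (hBA _ (heV i) _ (hDB i) (hDm i)).2⟩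
  exact le_antisymm (ENNReal.le_of_forall_one_lt_le_mul' fun t ht => (key t ht).1)
    (ENNReal.le_of_forall_one_lt_le_mul' fun t ht => (key t ht).2)

lemma measurableEmbedding (h : IsLocalParametrization M V F) :
    MeasurableEmbedding (V.domRestrict F) :=
  h.continuousOn.measurableEmbedding h.isOpen_domain.measurableSet h.injOn

lemma aemeasurable_volDensity (h : IsLocalParametrization M V F) :
    AEMeasurable (volDensity F) (volume.restrict V) :=
  h.contDiffOn_volDensity.continuousOn.aemeasurable h.isOpen_domain.measurableSet

/-- The area formula as an equality of measures. F is a measurable embedding only on the subtype V;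
in this form integrals transfer for arbitrary integrands, with no measurability assumption. -/
lemma map_comap_withDensity (h : IsLocalParametrization M V F) :
    Measure.map (V.domRestrict F) (Measure.comap (↑)
      (volume.withDensity fun v => ENNReal.ofReal (volDensity F v))) =
      μHE[k].restrict (F '' V) := by
  have hV := h.isOpen_domain.measurableSet
  ext A hA
  rw [h.measurableEmbedding.map_apply, Measure.restrict_apply hA,
    comap_subtype_coe_apply hV]
  have : (Subtype.val '' (V.domRestrict F ⁻¹' A)) = V ∩ (V.domRestrict F ⁻¹' A : Set V) := by
    ext x; simp
  have hm : MeasurableSet (Subtype.val '' (V.domRestrict F ⁻¹' A)) :=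
    (MeasurableEmbedding.subtype_coe hV).measurableSet_image.2 (h.measurableEmbedding.measurable hA)
  have hs : (Subtype.val '' (V.domRestrict F ⁻¹' A)) ⊆ V := by simp
  rw [withDensity_apply _ hm, ← h.measure_image hm hs]
  congr 1
  ext x
  constructor
  · rintro ⟨_, ⟨⟨v, hv⟩, hvA, rfl⟩, rfl⟩
    exact ⟨hvA, v, hv, rfl⟩
  · rintro ⟨hxA, v, hv, rfl⟩
    exact ⟨v, ⟨⟨v, hv⟩, hxA, rfl⟩, rfl⟩

/-- The area formula for integrals over the image of a local parametrization. -/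
lemma integral_image (h : IsLocalParametrization M V F) (g : EuclideanSpace ℝ (Fin n) → ℝ) :
    ∫ x in F '' V, g x ∂μHE[k] = ∫ v in V, volDensity F v * g (F v) := by
  have hV := h.isOpen_domain.measurableSet
  rw [← h.map_comap_withDensity, h.measurableEmbedding.integral_map]
  simp only [Set.domRestrict_apply, ← Function.comp_apply (f := g), ENNReal.ofReal]
  rw [← (MeasurableEmbedding.subtype_coe hV).integral_map, map_comap_subtype_coe hV,
    setIntegral_withDensity_eq_setIntegral_smul₀ h.aemeasurable_volDensity.real_toNNReal _ hV]
  refine setIntegral_congr_fun hV fun v hv => ?_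
  simp only [Function.comp_apply]
  rw [NNReal.smul_def, Real.coe_toNNReal _ (h.volDensity_pos hv).le, smul_eq_mul]

end IsLocalParametrization

end AreaFormula

end MinimalMonotonicity

namespace MinimalMonotonicity

/-! ### The coordinate fields and the mean curvature vector. -/

section ChartDivergence

open Filter Topology

variable {n k : ℕ}

/-- Jacobi's formula for the derivative of a determinant along a curve of matrices. -/
lemma hasDerivAt_det {ι : Type*} [Fintype ι] [DecidableEq ι] {G : ℝ → Matrix ι ι ℝ}
    {G' : Matrix ι ι ℝ} {t : ℝ} (hG : ∀ i j, HasDerivAt (fun s => G s i j) (G' i j) t) :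
    HasDerivAt (fun s => (G s).det) (((G t).adjugate * G').trace) t := by
  simp only [Matrix.det_apply']
  have h1 : HasDerivAt (fun s => ∑ σ : Equiv.Perm ι, ((Equiv.Perm.sign σ : ℤ) : ℝ) *
      ∏ i, G s (σ i) i) (∑ σ : Equiv.Perm ι, ((Equiv.Perm.sign σ : ℤ) : ℝ) *
      ∑ i, (∏ j ∈ Finset.univ.erase i, G t (σ j) j) * G' (σ i) i) t := by
    refine HasDerivAt.fun_sum fun σ _ => HasDerivAt.const_mul _ ?_
    simpa [smul_eq_mul] using HasDerivAt.fun_finsetProd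
      (u := Finset.univ) (f := fun i s => G s (σ i) i) (f' := fun i => G' (σ i) i)
      (x := t) fun i _ => hG (σ i) i
  convert h1 using 1
  have h2 : ∀ i, ((G t).adjugate * G') i i = ((G t).updateCol i (fun a => G' a i)).det := by
    intro i
    rw [← Matrix.cramer_apply, Matrix.cramer_eq_adjugate_mulVec]
    rfl
  simp only [Matrix.trace, Matrix.diag_apply, h2, Matrix.det_apply', Finset.mul_sum]
  rw [Finset.sum_comm]
  refine Finset.sum_congr rfl fun σ _ => Finset.sum_congr rfl fun i _ => ?_
  congr 1
  rw [← Finset.prod_erase_mul _ _ (Finset.mem_univ i)]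
  congr 1
  · refine Finset.prod_congr rfl fun j hj => ?_
    rw [Matrix.updateCol_ne (Finset.ne_of_mem_erase hj)]
  · rw [Matrix.updateCol_self]

/-- The derivative of the inverse along a curve of matrices. -/
lemma deriv_inv_matrix {ι : Type*} [Fintype ι] [DecidableEq ι] {G : ℝ → Matrix ι ι ℝ}
    {G' H' : Matrix ι ι ℝ} {t : ℝ} (hG : ∀ i j, HasDerivAt (fun s => G s i j) (G' i j) t)
    (hH : ∀ i j, HasDerivAt (fun s => (G s)⁻¹ i j) (H' i j) t)
    (hu : ∀ᶠ s in 𝓝 t, IsUnit (G s).det) :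
    H' = -((G t)⁻¹ * G' * (G t)⁻¹) := by
  have hut := hu.self_of_nhds
  -- Differentiate the constant product G⁻¹G.
  have h0 : (G t)⁻¹ * G' + H' * G t = 0 := by
    ext i j
    have h1 : HasDerivAt (fun s => ∑ l, (G s)⁻¹ i l * G s l j)
        (∑ l, (H' i l * G t l j + (G t)⁻¹ i l * G' l j)) t :=
      HasDerivAt.fun_sum fun l _ => (hH i l).mul (hG l j)
    have h2 : (fun s => ∑ l, (G s)⁻¹ i l * G s l j) =ᶠ[𝓝 t] fun _ => (1 : Matrix ι ι ℝ) i j := by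
      filter_upwards [hu] with s hs
      rw [← Matrix.mul_apply, Matrix.nonsing_inv_mul _ hs]
    have h3 := h1.unique ((hasDerivAt_const t _).congr_of_eventuallyEq h2)
    rw [Finset.sum_add_distrib] at h3
    rw [Matrix.add_apply, Matrix.mul_apply, Matrix.mul_apply, Matrix.zero_apply, add_comm]
    exact h3
  have h4 : H' * G t = -((G t)⁻¹ * G') := by
    rw [eq_neg_iff_add_eq_zero, add_comm]; exact h0
  calc H' = H' * G t * (G t)⁻¹ := by
        rw [Matrix.mul_assoc, Matrix.mul_nonsing_inv _ hut, Matrix.mul_one]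
    _ = _ := by rw [h4, Matrix.neg_mul]

variable {M : Set (EuclideanSpace ℝ (Fin n))} {V : Set (EuclideanSpace ℝ (Fin k))}
  {F : EuclideanSpace ℝ (Fin k) → EuclideanSpace ℝ (Fin n)}

/-- The `i`-th partial derivative of a parametrization. -/
noncomputable def partialD (F : EuclideanSpace ℝ (Fin k) → EuclideanSpace ℝ (Fin n)) (i : Fin k)
    (v : EuclideanSpace ℝ (Fin k)) : EuclideanSpace ℝ (Fin n) :=
  fderiv ℝ F v (EuclideanSpace.single i 1)

/-- The second partial derivatives of a parametrization. -/
noncomputable def partialD₂ (F : EuclideanSpace ℝ (Fin k) → EuclideanSpace ℝ (Fin n)) (i j : Fin k)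
    (v : EuclideanSpace ℝ (Fin k)) : EuclideanSpace ℝ (Fin n) :=
  fderiv ℝ (fderiv ℝ F) v (EuclideanSpace.single i 1) (EuclideanSpace.single j 1)

/-- The inverse of the first fundamental form. -/
noncomputable def gramInv (F : EuclideanSpace ℝ (Fin k) → EuclideanSpace ℝ (Fin n))
    (i j : Fin k) (v : EuclideanSpace ℝ (Fin k)) : ℝ := (gramOf (fderiv ℝ F v))⁻¹ i j

/-- The field `√g ∑ⱼ gⁱʲ ∂ⱼF`. -/
noncomputable def coField (F : EuclideanSpace ℝ (Fin k) → EuclideanSpace ℝ (Fin n)) (i : Fin k)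
    (v : EuclideanSpace ℝ (Fin k)) : EuclideanSpace ℝ (Fin n) :=
  ∑ j, (volDensity F v * gramInv F i j v) • partialD F j v

namespace IsLocalParametrization

lemma contDiffOn_partialD (h : IsLocalParametrization M V F) (i : Fin k) :
    ContDiffOn ℝ ∞ (partialD F i) V :=
  h.contDiffOn_fderiv.clm_apply contDiffOn_const

lemma contDiffOn_gramInv (h : IsLocalParametrization M V F) (i j : Fin k) :
    ContDiffOn ℝ ∞ (gramInv F i j) V := by
  have : ∀ v, gramInv F i j v = ((gramOf (fderiv ℝ F v)).det)⁻¹ *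
      ((gramOf (fderiv ℝ F v)).updateRow j (Pi.single i 1)).det := by
    intro v
    rw [gramInv, Matrix.inv_def, Matrix.smul_apply, Matrix.adjugate_apply, Ring.inverse_eq_inv',
      smul_eq_mul]
  simp only [funext this]
  refine (h.contDiffOn_det.inv fun v hv => (det_gramOf_pos (h.injective_fderiv v hv)).ne').mul ?_
  simp only [Matrix.det_apply]
  refine ContDiffOn.sum fun σ _ => ContDiffOn.const_smul _ (contDiffOn_prod fun a _ => ?_)
  by_cases ha : σ a = j
  · simp only [Matrix.updateRow_apply, ha, if_true]
    exact contDiffOn_const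
  · simp only [Matrix.updateRow_apply, ha, if_false]
    exact h.contDiffOn_gramOf _ _

lemma contDiffOn_coField (h : IsLocalParametrization M V F) (i : Fin k) :
    ContDiffOn ℝ ∞ (coField F i) V :=
  ContDiffOn.sum fun j _ =>
    (h.contDiffOn_volDensity.mul (h.contDiffOn_gramInv i j)).smul (h.contDiffOn_partialD j)

lemma differentiableAt_of_contDiffOn (h : IsLocalParametrization M V F) {E : Type*}
    [NormedAddCommGroup E] [NormedSpace ℝ E] {φ : EuclideanSpace ℝ (Fin k) → E}
    (hφ : ContDiffOn ℝ ∞ φ V) {v : EuclideanSpace ℝ (Fin k)} (hv : v ∈ V) :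
    DifferentiableAt ℝ φ v :=
  (hφ.contDiffAt (h.isOpen_domain.mem_nhds hv)).differentiableAt (by simp)

lemma hasDerivAt_line (h : IsLocalParametrization M V F) {E : Type*}
    [NormedAddCommGroup E] [NormedSpace ℝ E] {φ : EuclideanSpace ℝ (Fin k) → E}
    (hφ : ContDiffOn ℝ ∞ φ V) {v : EuclideanSpace ℝ (Fin k)} (hv : v ∈ V)
    (e : EuclideanSpace ℝ (Fin k)) :
    HasDerivAt (fun t : ℝ => φ (v + t • e)) (fderiv ℝ φ v e) 0 :=
  (h.differentiableAt_of_contDiffOn hφ hv).hasFDerivAt.hasLineDerivAt e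

lemma hasDerivAt_line_partialD (h : IsLocalParametrization M V F)
    {v : EuclideanSpace ℝ (Fin k)} (hv : v ∈ V) (i j : Fin k) :
    HasDerivAt (fun t : ℝ => partialD F j (v + t • EuclideanSpace.single i 1))
      (partialD₂ F i j v) 0 := by
  have := (h.hasDerivAt_line h.contDiffOn_fderiv hv (EuclideanSpace.single i 1)).clm_apply
    (hasDerivAt_const (0 : ℝ) (EuclideanSpace.single j (1 : ℝ)))
  rw [map_zero, add_zero] at this
  exact this

lemma partialD₂_symm (h : IsLocalParametrization M V F)
    {v : EuclideanSpace ℝ (Fin k)} (hv : v ∈ V) (i j : Fin k) :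
    partialD₂ F i j v = partialD₂ F j i v := by
  have hc : ContDiffAt ℝ 2 F v :=
    (h.contDiffOn.contDiffAt (h.isOpen_domain.mem_nhds hv)).of_le (WithTop.coe_le_coe.2 le_top)
  exact (hc.isSymmSndFDerivAt (by simp)).eq _ _

lemma eventually_line_mem (h : IsLocalParametrization M V F)
    {v : EuclideanSpace ℝ (Fin k)} (hv : v ∈ V) (e : EuclideanSpace ℝ (Fin k)) :
    ∀ᶠ t : ℝ in 𝓝 0, v + t • e ∈ V := by
  have : Continuous fun t : ℝ => v + t • e := by fun_prop
  exact this.continuousAt.eventually (by simpa using h.isOpen_domain.mem_nhds hv)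

/-- The divergence of the coordinate fields is the mean curvature vector. -/
lemma sum_fderiv_coField (h : IsLocalParametrization M V F)
    {v : EuclideanSpace ℝ (Fin k)} (hv : v ∈ V) :
    ∑ i, fderiv ℝ (coField F i) v (EuclideanSpace.single i 1) =
      volDensity F v • meanCurvature F v := by
  have hinj := h.injective_fderiv v hv
  -- Christoffel symbols of the first kind. Every derivative of the metric is a sum of two of them.
  set C : Fin k → Fin k → Fin k → ℝ := fun a b c => inner ℝ (partialD₂ F a b v) (partialD F c v)
    with hC
  have hCs : ∀ a b c, C a b c = C b a c := fun a b c => by simp only [hC, h.partialD₂_symm hv a b]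
  set H : Matrix (Fin k) (Fin k) ℝ := (gramOf (fderiv ℝ F v))⁻¹ with hH
  have hHs : ∀ a b, H a b = H b a := fun a b => gramOf_inv_symm a b
  have hdG : ∀ i a b, HasDerivAt
      (fun t : ℝ => gramOf (fderiv ℝ F (v + t • EuclideanSpace.single i 1)) a b)
      (C i a b + C i b a) 0 := by
    intro i a b
    have := (h.hasDerivAt_line_partialD hv i a).inner ℝ (h.hasDerivAt_line_partialD hv i b)
    simp only [zero_smul, add_zero] at this
    rw [add_comm (C i a b)]
    simp only [hC]
    rw [real_inner_comm (partialD F a v)]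
    exact this
  have hu : ∀ i, ∀ᶠ t : ℝ in 𝓝 0,
      IsUnit (gramOf (fderiv ℝ F (v + t • EuclideanSpace.single i 1))).det := by
    intro i
    filter_upwards [h.eventually_line_mem hv (EuclideanSpace.single i 1)] with t ht
    exact isUnit_iff_ne_zero.2 (det_gramOf_ne_zero (h.injective_fderiv _ ht))
  have hdH : ∀ i a b, fderiv ℝ (gramInv F a b) v (EuclideanSpace.single i 1) =
      -∑ c, ∑ d, H a c * (C i c d + C i d c) * H d b := by
    intro i a b
    have := deriv_inv_matrix (t := 0) (G := fun t : ℝ =>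
      gramOf (fderiv ℝ F (v + t • EuclideanSpace.single i 1)))
      (G' := Matrix.of fun a b => C i a b + C i b a)
      (H' := Matrix.of fun a b => fderiv ℝ (gramInv F a b) v (EuclideanSpace.single i 1))
      (fun a b => hdG i a b)
      (fun a b => h.hasDerivAt_line (h.contDiffOn_gramInv a b) hv _) (hu i)
    have := congrFun (congrFun this a) b
    simp only [zero_smul, add_zero, Matrix.of_apply, Matrix.neg_apply, Matrix.mul_apply] at this
    rw [this, Finset.sum_comm]
    simp only [Finset.sum_mul, hH]
  -- Jacobi's formula; the two symmetric halves of the derivative of the metric cancel the 1/2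
  -- coming from the square root.
  have hdJ : ∀ i, fderiv ℝ (volDensity F) v (EuclideanSpace.single i 1) =
      volDensity F v * ∑ a, ∑ b, H a b * C i a b := by
    intro i
    have h1 := hasDerivAt_det (t := 0) (G := fun t : ℝ =>
      gramOf (fderiv ℝ F (v + t • EuclideanSpace.single i 1)))
      (G' := Matrix.of fun a b => C i a b + C i b a) (fun a b => hdG i a b)
    have hdet := det_gramOf_pos hinj
    have h2 := h1.sqrt (by simpa using hdet.ne')
    have h3 := h2.unique (h.hasDerivAt_line h.contDiffOn_volDensity hv (EuclideanSpace.single i 1))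
    rw [← h3]
    simp only [zero_smul, add_zero]
    have hadj : (gramOf (fderiv ℝ F v)).adjugate = (gramOf (fderiv ℝ F v)).det • H := by
      rw [hH, Matrix.inv_def, smul_smul, Ring.inverse_eq_inv', mul_inv_cancel₀ hdet.ne', one_smul]
    have htr : (H * Matrix.of fun a b => C i a b + C i b a).trace =
        2 * ∑ a, ∑ b, H a b * C i a b := by
      simp only [Matrix.trace, Matrix.diag_apply, Matrix.mul_apply, Matrix.of_apply, mul_add,
        Finset.sum_add_distrib, two_mul]
      congr 1
      rw [Finset.sum_comm]
      exact Finset.sum_congr rfl fun a _ => Finset.sum_congr rfl fun b _ => by rw [hHs]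
    rw [hadj, Matrix.smul_mul, Matrix.trace_smul, htr, volDensity, smul_eq_mul]
    have hs : √(gramOf (fderiv ℝ F v)).det ≠ 0 := (Real.sqrt_pos.2 hdet).ne'
    field_simp
    rw [Real.sq_sqrt hdet.le]
    ring
  have hdW : ∀ i, fderiv ℝ (coField F i) v (EuclideanSpace.single i 1) =
      volDensity F v • ∑ j, (((∑ a, ∑ b, H a b * C i a b) * H i j -
        ∑ c, ∑ d, H i c * (C i c d + C i d c) * H d j) • partialD F j v +
        H i j • partialD₂ F i j v) := by
    intro i
    have h1 := h.hasDerivAt_line (h.contDiffOn_coField i) hv (EuclideanSpace.single i 1)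
    have h2 : HasDerivAt (fun t : ℝ => coField F i (v + t • EuclideanSpace.single i 1)) _ 0 :=
      HasDerivAt.fun_sum fun j _ =>
      ((h.hasDerivAt_line h.contDiffOn_volDensity hv (EuclideanSpace.single i 1)).mul
        (h.hasDerivAt_line (h.contDiffOn_gramInv i j) hv (EuclideanSpace.single i 1))).smul
        (h.hasDerivAt_line_partialD hv i j)
    rw [h1.unique h2, Finset.smul_sum]
    refine Finset.sum_congr rfl fun j _ => ?_
    simp only [zero_smul, add_zero, hdJ, hdH, Pi.mul_apply]
    have : gramInv F i j v = H i j := rfl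
    rw [this]
    module
  simp only [hdW]
  rw [← Finset.smul_sum]
  congr 1
  have hproj : ∀ u, ((fderiv ℝ F v).range)ᗮ.starProjection u =
      u - ∑ l, ∑ m, (H l m * inner ℝ u (partialD F l v)) • partialD F m v := by
    intro u
    rw [Submodule.starProjection_orthogonal_val, starProjection_range_eq hinj]
    rfl
  have hmc : meanCurvature F v = ∑ i, ∑ j, H i j • (partialD₂ F i j v -
      ∑ l, ∑ m, (H l m * C i j l) • partialD F m v) := by
    unfold meanCurvature
    refine Finset.sum_congr rfl fun i _ => Finset.sum_congr rfl fun j _ => ?_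
    rw [hproj]
    rfl
  -- The classical identity Σᵢ ∂ᵢ(√g gⁱᵐ) = -√g Σ gⁱʲΓᵐᵢⱼ, divided by √g. The derivative of the
  -- density cancels one of the two terms from the derivative of the inverse metric, and the other
  -- is what the normal projection removes from ∂ᵢ∂ⱼF.
  have hcoef : ∀ m, ∑ i, ((∑ a, ∑ b, H a b * C i a b) * H i m -
        ∑ c, ∑ d, H i c * (C i c d + C i d c) * H d m) =
      -∑ i, ∑ j, ∑ l, H i j * (H l m * C i j l) := by
    intro m
    have e1 : ∑ i, (∑ a, ∑ b, H a b * C i a b) * H i m =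
        ∑ i, ∑ c, ∑ d, H i c * C i d c * H d m := by
      calc ∑ i, (∑ a, ∑ b, H a b * C i a b) * H i m
          = ∑ d, ∑ i, ∑ c, H i c * C i d c * H d m := by
            refine Finset.sum_congr rfl fun d _ => ?_
            rw [Finset.sum_mul]
            refine Finset.sum_congr rfl fun i _ => ?_
            rw [Finset.sum_mul]
            exact Finset.sum_congr rfl fun c _ => by rw [hCs d i c]
        _ = ∑ i, ∑ d, ∑ c, H i c * C i d c * H d m := Finset.sum_comm
        _ = _ := Finset.sum_congr rfl fun i _ => Finset.sum_comm
    rw [Finset.sum_sub_distrib, e1, ← Finset.sum_sub_distrib, ← Finset.sum_neg_distrib]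
    refine Finset.sum_congr rfl fun i _ => ?_
    rw [← Finset.sum_sub_distrib, ← Finset.sum_neg_distrib]
    refine Finset.sum_congr rfl fun c _ => ?_
    rw [← Finset.sum_sub_distrib, ← Finset.sum_neg_distrib]
    exact Finset.sum_congr rfl fun d _ => by ring
  rw [hmc]
  simp only [Finset.sum_add_distrib, smul_sub, Finset.sum_sub_distrib]
  rw [add_comm, sub_eq_add_neg]
  congr 1
  rw [Finset.sum_comm]
  simp only [← Finset.sum_smul, hcoef]
  simp only [neg_smul, Finset.sum_neg_distrib, Finset.smul_sum, smul_smul, Finset.sum_smul]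
  congr 1
  rw [Finset.sum_comm]
  refine Finset.sum_congr rfl fun i _ => ?_
  rw [Finset.sum_comm]
  refine Finset.sum_congr rfl fun j _ => ?_
  rw [Finset.sum_comm]

end IsLocalParametrization

end ChartDivergence

end MinimalMonotonicity

namespace MinimalMonotonicity

/-! ### The first variation formula. -/

section FirstVariation

open Filter Topology

variable {n k : ℕ}

lemma integral_fderiv_eq_zero {φ : EuclideanSpace ℝ (Fin k) → ℝ} (hφ : ContDiff ℝ 1 φ)
    (hc : HasCompactSupport φ) (e : EuclideanSpace ℝ (Fin k)) :
    ∫ v, fderiv ℝ φ v e = 0 := by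
  have hd : Continuous fun v => fderiv ℝ φ v e :=
    (hφ.continuous_fderiv (by simp)).clm_apply continuous_const
  have hdc : HasCompactSupport fun v => fderiv ℝ φ v e := hc.fderiv_apply ℝ e
  have h := integral_mul_fderiv_eq_neg_fderiv_mul_of_integrable (𝕜 := ℝ) (μ := volume)
    (f := fun _ : EuclideanSpace ℝ (Fin k) => (1 : ℝ)) (g := φ) (v := e)
    (by simp) (by simpa using hd.integrable_of_hasCompactSupport hdc)
    (by simpa using hφ.continuous.integrable_of_hasCompactSupport hc)
    (fun x _ => differentiableAt_const _)
    (fun x _ => hφ.differentiable (by simp) x)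
  simpa using h

variable {M : Set (EuclideanSpace ℝ (Fin n))} {V : Set (EuclideanSpace ℝ (Fin k))}
  {F : EuclideanSpace ℝ (Fin k) → EuclideanSpace ℝ (Fin n)}

namespace IsLocalParametrization

/-- The first variation formula in a chart. -/
lemma integral_chart_divergence (h : IsLocalParametrization M V F)
    (hmc : ∀ v ∈ V, meanCurvature F v = 0)
    {Z : EuclideanSpace ℝ (Fin k) → EuclideanSpace ℝ (Fin n)} (hZ : ContDiff ℝ 1 Z)
    (hZc : HasCompactSupport Z) (hZV : tsupport Z ⊆ V) :
    ∫ v in V, volDensity F v * ∑ i, ∑ j, gramInv F i j v *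
      inner ℝ (fderiv ℝ Z v (EuclideanSpace.single i 1)) (partialD F j v) = 0 := by
  -- By the product rule Σᵢ ∂ᵢφᵢ is √g times the divergence of Z plus √g⟨Z, mean curvature⟩. The
  -- latter vanishes, and the total derivatives integrate to zero.
  let φ : Fin k → EuclideanSpace ℝ (Fin k) → ℝ := fun i v => inner ℝ (Z v) (coField F i v)
  have hφ : ∀ i, ContDiff ℝ 1 (φ i) := by
    intro i
    rw [contDiff_iff_contDiffAt]
    intro v
    by_cases hv : v ∈ tsupport Z
    · exact hZ.contDiffAt.inner ℝ (((h.contDiffOn_coField i).contDiffAt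
        (h.isOpen_domain.mem_nhds (hZV hv))).of_le (WithTop.coe_le_coe.2 le_top))
    · have : φ i =ᶠ[𝓝 v] fun _ => 0 := by
        filter_upwards [(isClosed_tsupport Z).isOpen_compl.mem_nhds hv] with w hw
        simp [φ, image_eq_zero_of_notMem_tsupport hw]
      exact contDiffAt_const.congr_of_eventuallyEq this
  have hφc : ∀ i, HasCompactSupport (φ i) := by
    intro i
    refine hZc.mono fun v hv => ?_
    contrapose! hv
    simp only [Function.mem_support, not_not] at hv ⊢
    simp [φ, hv]
  have hint : ∀ i, Integrable (fun v => fderiv ℝ (φ i) v (EuclideanSpace.single i 1)) := fun i =>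
    (((hφ i).continuous_fderiv (by simp)).clm_apply
      continuous_const).integrable_of_hasCompactSupport ((hφc i).fderiv_apply ℝ _)
  have h0 : ∫ v, ∑ i, fderiv ℝ (φ i) v (EuclideanSpace.single i 1) = 0 := by
    rw [integral_finsetSum _ fun i _ => hint i]
    exact Finset.sum_eq_zero fun i _ => integral_fderiv_eq_zero (hφ i) (hφc i) _
  rw [← setIntegral_eq_integral_of_forall_compl_eq_zero (s := V)] at h0
  · refine (setIntegral_congr_fun h.isOpen_domain.measurableSet fun v hv => ?_).trans h0
    have hd : ∀ i, fderiv ℝ (φ i) v (EuclideanSpace.single i 1) =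
        inner ℝ (Z v) (fderiv ℝ (coField F i) v (EuclideanSpace.single i 1)) +
        inner ℝ (fderiv ℝ Z v (EuclideanSpace.single i 1)) (coField F i v) := fun i =>
      fderiv_inner_apply ℝ (hZ.differentiable (by simp) v)
        (h.differentiableAt_of_contDiffOn (h.contDiffOn_coField i) hv) _
    simp only [hd, Finset.sum_add_distrib]
    rw [← inner_sum, h.sum_fderiv_coField hv, hmc v hv]
    simp only [smul_zero, inner_zero_right, zero_add, coField, inner_sum, inner_smul_right,
      Finset.mul_sum, mul_assoc]
  · intro v hv
    refine Finset.sum_eq_zero fun i _ => ?_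
    have : fderiv ℝ (φ i) v = 0 := by
      have : φ i =ᶠ[𝓝 v] fun _ => 0 := by
        filter_upwards [(isClosed_tsupport Z).isOpen_compl.mem_nhds fun h => hv (hZV h)] with w hw
        simp [φ, image_eq_zero_of_notMem_tsupport hw]
      rw [this.fderiv_eq]; simp
    simp [this]

/-- Lets continuity, local finiteness of measure and positivity of measure on M be checked in the
parameter domain. -/
lemma map_nhds_eq (h : IsLocalParametrization M V F) {v : EuclideanSpace ℝ (Fin k)} (hv : v ∈ V) :
    map F (𝓝 v) = 𝓝[M] (F v) := by
  obtain ⟨W, hWo, hW⟩ := h.isOpen_image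
  have h1 := h.isEmbedding.map_nhds_eq ⟨v, hv⟩
  have h2 : map Subtype.val (𝓝 (⟨v, hv⟩ : V)) = 𝓝 v := by
    rw [map_nhds_subtype_val]
    exact h.isOpen_domain.nhdsWithin_eq hv
  have h3 : V.domRestrict F = F ∘ Subtype.val := rfl
  rw [h3, ← Filter.map_map, h2, Set.range_comp, Subtype.range_coe, hW] at h1
  rw [h1]
  have hFv : F v ∈ M ∩ W := hW ▸ ⟨v, hv, rfl⟩
  exact nhdsWithin_inter_of_mem' (mem_nhdsWithin_of_mem_nhds (hWo.mem_nhds hFv.2))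

lemma continuousOn_starProjection (h : IsLocalParametrization M V F) :
    ContinuousOn (fun v => (tangentSpace M (F v)).starProjection) V := by
  have : ContinuousOn (fun v => ∑ i, ∑ j, gramInv F i j v •
      ((innerSL ℝ (partialD F i v)).smulRight (partialD F j v) :
        EuclideanSpace ℝ (Fin n) →L[ℝ] EuclideanSpace ℝ (Fin n))) V := by
    refine continuousOn_finsetSum _ fun i _ => continuousOn_finsetSum _ fun j _ => ?_
    refine (h.contDiffOn_gramInv i j).continuousOn.smul ?_
    have h1 := (innerSL ℝ (E := EuclideanSpace ℝ (Fin n))).continuous.comp_continuousOn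
      (h.contDiffOn_partialD i).continuousOn
    have h2 := (ContinuousLinearMap.smulRightL ℝ (EuclideanSpace ℝ (Fin n))
      (EuclideanSpace ℝ (Fin n))).continuous.comp_continuousOn h1
    exact h2.clm_apply (h.contDiffOn_partialD j).continuousOn
  refine this.congr fun v hv => ?_
  ext1 u
  rw [h.tangentSpace_eq hv, starProjection_range_eq (h.injective_fderiv v hv)]
  simp only [_root_.sum_apply, _root_.smul_apply,
    ContinuousLinearMap.smulRight_apply, innerSL_apply_apply, smul_smul, gramInv, partialD]
  refine Finset.sum_congr rfl fun i _ => Finset.sum_congr rfl fun j _ => ?_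
  rw [real_inner_comm]

lemma finiteAtFilter (h : IsLocalParametrization M V F) {v : EuclideanSpace ℝ (Fin k)}
    (hv : v ∈ V) : μHE[k].FiniteAtFilter (𝓝[M] (F v)) := by
  obtain ⟨B, hBv, hBV, hB⟩ := local_compact_nhds (h.isOpen_domain.mem_nhds hv)
  refine ⟨F '' B, ?_, ?_⟩
  · rw [← h.map_nhds_eq hv]; exact image_mem_map hBv
  · rw [h.measure_image hB.measurableSet hBV]
    have hc : ContinuousOn (volDensity F) B := h.contDiffOn_volDensity.continuousOn.mono hBV
    exact (hc.integrableOn_compact hB).lintegral_lt_top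

lemma measure_pos_of_mem_nhdsWithin (h : IsLocalParametrization M V F)
    {v : EuclideanSpace ℝ (Fin k)} (hv : v ∈ V) {N : Set (EuclideanSpace ℝ (Fin n))}
    (hN : N ∈ 𝓝[M] (F v)) : 0 < μHE[k] N := by
  rw [← h.map_nhds_eq hv, mem_map] at hN
  obtain ⟨B, hBN, hBo, hvB⟩ := mem_nhds_iff.1 (inter_mem hN (h.isOpen_domain.mem_nhds hv))
  have hBV : B ⊆ V := fun w hw => (hBN hw).2
  refine lt_of_lt_of_le ?_ (measure_mono (μ := μHE[k]) (s := F '' B) ?_)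
  · rw [h.measure_image hBo.measurableSet hBV, pos_iff_ne_zero]
    intro h0
    have hm : AEMeasurable (fun w => ENNReal.ofReal (volDensity F w)) (volume.restrict B) :=
      ((h.contDiffOn_volDensity.continuousOn.mono hBV).aemeasurable
        hBo.measurableSet).ennreal_ofReal
    rw [lintegral_eq_zero_iff' hm, Filter.EventuallyEq, ae_restrict_iff' hBo.measurableSet] at h0
    refine (hBo.measure_pos volume ⟨v, hvB⟩).ne' (measure_mono_null (fun w hw => ?_) h0)
    intro hw'
    have := hw' hw
    simp only [Pi.zero_apply, ENNReal.ofReal_eq_zero] at this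
    exact absurd this (not_le.2 (h.volDensity_pos (hBV hw)))
  · rintro _ ⟨w, hw, rfl⟩
    exact (hBN hw).1

end IsLocalParametrization

lemma IsSubmanifold.continuousOn_starProjection (hM : IsSubmanifold k M) :
    ContinuousOn (fun x => (tangentSpace M x).starProjection) M := by
  intro x hx
  obtain ⟨V, F, h, v, hv, rfl⟩ := hM x hx
  rw [ContinuousWithinAt, ← h.map_nhds_eq hv, tendsto_map'_iff]
  exact h.continuousOn_starProjection.continuousAt (h.isOpen_domain.mem_nhds hv)

lemma IsSubmanifold.measure_pos_of_mem_nhdsWithin (hM : IsSubmanifold k M)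
    {x : EuclideanSpace ℝ (Fin n)} (hx : x ∈ M) {N : Set (EuclideanSpace ℝ (Fin n))}
    (hN : N ∈ 𝓝[M] x) : 0 < μHE[k] N := by
  obtain ⟨V, F, h, v, hv, rfl⟩ := hM x hx
  exact h.measure_pos_of_mem_nhdsWithin hv hN

lemma IsSubmanifold.tangentTrace_id (hM : IsSubmanifold k M)
    {x : EuclideanSpace ℝ (Fin n)} (hx : x ∈ M) :
    tangentTrace (tangentSpace M x) (ContinuousLinearMap.id ℝ _) = k := by
  obtain ⟨V, F, h, v, hv, rfl⟩ := hM x hx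
  rw [h.tangentSpace_eq hv, tangentTrace_range_id (h.injective_fderiv v hv)]

variable {U K : Set (EuclideanSpace ℝ (Fin n))}

/-- M is relatively closed in U, hence the intersection of a closed and an open set. The same
condition makes M meet compact subsets of U in compact sets. -/
lemma measurableSet_of_closure_inter_subset (hU : IsOpen U) (hMU : M ⊆ U)
    (hcl : closure M ∩ U ⊆ M) : MeasurableSet M := by
  have : M = closure M ∩ U := Subset.antisymm (subset_inter subset_closure hMU) hcl
  rw [this]
  exact isClosed_closure.measurableSet.inter hU.measurableSet

lemma isCompact_inter_of_closure_inter_subset (hcl : closure M ∩ U ⊆ M) (hK : IsCompact K)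
    (hKU : K ⊆ U) : IsCompact (M ∩ K) := by
  have : M ∩ K = closure M ∩ K := by
    refine Subset.antisymm (inter_subset_inter_left _ subset_closure) fun x hx => ?_
    exact ⟨hcl ⟨hx.1, hKU hx.2⟩, hx.2⟩
  rw [this]
  exact hK.inter_left isClosed_closure

lemma IsSubmanifold.measure_inter_lt_top (hM : IsSubmanifold k M) (hcl : closure M ∩ U ⊆ M)
    (hK : IsCompact K) (hKU : K ⊆ U) : μHE[k] (M ∩ K) < ⊤ := by
  refine (isCompact_inter_of_closure_inter_subset hcl hK hKU).measure_lt_top_of_nhdsWithin ?_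
  intro x hx
  obtain ⟨V, F, h, v, hv, rfl⟩ := hM x hx.1
  exact (h.finiteAtFilter hv).filter_mono (nhdsWithin_mono _ inter_subset_left)

lemma IsSubmanifold.integrableOn_of_continuousOn (hM : IsSubmanifold k M)
    (hcl : closure M ∩ U ⊆ M) (hK : IsCompact K) (hKU : K ⊆ U)
    {g : EuclideanSpace ℝ (Fin n) → ℝ} (hg : ContinuousOn g (M ∩ K)) :
    IntegrableOn g (M ∩ K) μHE[k] := by
  have hc := isCompact_inter_of_closure_inter_subset hcl hK hKU
  obtain ⟨C, hC⟩ := hc.exists_bound_of_continuousOn hg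
  exact IntegrableOn.of_bound (hM.measure_inter_lt_top hcl hK hKU)
    (hg.aestronglyMeasurable hc.measurableSet) C
    ((ae_restrict_iff' hc.measurableSet).2 (Eventually.of_forall hC))

lemma continuous_tangentTrace_aux :
    Continuous fun p : (EuclideanSpace ℝ (Fin n) →L[ℝ] EuclideanSpace ℝ (Fin n)) ×
      (EuclideanSpace ℝ (Fin n) →L[ℝ] EuclideanSpace ℝ (Fin n)) =>
      LinearMap.trace ℝ _ ((p.2 ∘L p.1 : EuclideanSpace ℝ (Fin n) →L[ℝ] _) :
        EuclideanSpace ℝ (Fin n) →ₗ[ℝ] EuclideanSpace ℝ (Fin n)) := by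
  have h1 : Continuous fun B : EuclideanSpace ℝ (Fin n) →L[ℝ] EuclideanSpace ℝ (Fin n) =>
      LinearMap.trace ℝ _ (B : EuclideanSpace ℝ (Fin n) →ₗ[ℝ] EuclideanSpace ℝ (Fin n)) := by
    let T : (EuclideanSpace ℝ (Fin n) →L[ℝ] EuclideanSpace ℝ (Fin n)) →ₗ[ℝ] ℝ :=
      (LinearMap.trace ℝ (EuclideanSpace ℝ (Fin n))).comp (ContinuousLinearMap.coeLM ℝ)
    exact T.continuous_of_finiteDimensional
  exact h1.comp (continuous_snd.clm_comp continuous_fst)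

lemma IsSubmanifold.continuousOn_tangentTrace_fderiv (hM : IsSubmanifold k M) (hU : IsOpen U)
    (hMU : M ⊆ U) {X : EuclideanSpace ℝ (Fin n) → EuclideanSpace ℝ (Fin n)}
    (hX : ContDiffOn ℝ 1 X U) :
    ContinuousOn (fun x => tangentTrace (tangentSpace M x) (fderiv ℝ X x)) M :=
  continuous_tangentTrace_aux.comp_continuousOn (hM.continuousOn_starProjection.prodMk
    ((hX.continuousOn_fderiv_of_isOpen hU (by simp)).mono hMU))

lemma fderiv_eq_zero_of_forall_notMem (hU : IsOpen U) (hK : IsCompact K)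
    {X : EuclideanSpace ℝ (Fin n) → EuclideanSpace ℝ (Fin n)}
    (h0 : ∀ x ∈ U \ K, X x = 0) {x : EuclideanSpace ℝ (Fin n)} (hx : x ∈ U \ K) :
    fderiv ℝ X x = 0 := by
  have : X =ᶠ[𝓝 x] fun _ => 0 := by
    filter_upwards [(hU.sdiff hK.isClosed).mem_nhds hx] with w hw using h0 w hw
  rw [this.fderiv_eq]; simp

/-- The first variation formula for vector fields supported in a single chart. -/
lemma IsLocalParametrization.integral_tangentTrace_fderiv_eq_zero
    (h : IsLocalParametrization M V F) (hmc : ∀ v ∈ V, meanCurvature F v = 0)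
    (hU : IsOpen U) (hMU : M ⊆ U) (hcl : closure M ∩ U ⊆ M) (hK : IsCompact K) (hKU : K ⊆ U)
    (hKF : M ∩ K ⊆ F '' V) {X : EuclideanSpace ℝ (Fin n) → EuclideanSpace ℝ (Fin n)}
    (hX : ContDiffOn ℝ 1 X U) (h0 : ∀ x ∈ U \ K, X x = 0) :
    ∫ x in M, tangentTrace (tangentSpace M x) (fderiv ℝ X x) ∂μHE[k] = 0 := by
  classical
  have hVU : ∀ v ∈ V, F v ∈ U := fun v hv => hMU (h.mem hv)
  -- The chart is a homeomorphism onto a set containing the compact M ∩ K, so the preimage is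
  -- compact. The pulled-back field therefore extends by zero from V to a C¹ field.
  have hQ : IsCompact (V ∩ F ⁻¹' (M ∩ K)) := by
    have h1 := isCompact_inter_of_closure_inter_subset hcl hK hKU
    have h2 := (h.isEmbedding.isInducing.isCompact_preimage_iff (K := M ∩ K)
      (by rwa [Set.range_domRestrict])).2 h1
    convert h2.image continuous_subtype_val using 1
    ext v
    simp [Set.domRestrict]
    tauto
  set Z : EuclideanSpace ℝ (Fin k) → EuclideanSpace ℝ (Fin n) := V.indicator (X ∘ F) with hZdef
  have hZ0 : ∀ v ∉ V ∩ F ⁻¹' (M ∩ K), Z v = 0 := by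
    intro v hv
    by_cases hvV : v ∈ V
    · rw [hZdef, indicator_of_mem hvV]
      exact h0 _ ⟨hVU v hvV, fun hvK => hv ⟨hvV, h.mem hvV, hvK⟩⟩
    · rw [hZdef, indicator_of_notMem hvV]
  have hsupp : tsupport Z ⊆ V ∩ F ⁻¹' (M ∩ K) :=
    closure_minimal (fun v hv => by_contra fun hv' => hv (hZ0 v hv')) hQ.isClosed
  have hZV : ∀ v ∈ V, Z =ᶠ[𝓝 v] X ∘ F := fun v hv => by
    filter_upwards [h.isOpen_domain.mem_nhds hv] with w hw
    rw [hZdef, indicator_of_mem hw]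
  have hXF : ∀ v ∈ V, ContDiffAt ℝ 1 (X ∘ F) v := fun v hv =>
    (hX.contDiffAt (hU.mem_nhds (hVU v hv))).comp v
      ((h.contDiffOn.contDiffAt (h.isOpen_domain.mem_nhds hv)).of_le (WithTop.coe_le_coe.2 le_top))
  have hZ : ContDiff ℝ 1 Z := by
    rw [contDiff_iff_contDiffAt]
    intro v
    by_cases hv : v ∈ V
    · exact (hXF v hv).congr_of_eventuallyEq (hZV v hv)
    · have : Z =ᶠ[𝓝 v] fun _ => 0 := by
        filter_upwards [hQ.isClosed.isOpen_compl.mem_nhds fun h => hv h.1] with w hw using hZ0 w hw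
      exact contDiffAt_const.congr_of_eventuallyEq this
  have key := h.integral_chart_divergence hmc hZ (hQ.of_isClosed_subset (isClosed_tsupport _) hsupp)
    (hsupp.trans inter_subset_left)
  have hm := measurableSet_of_closure_inter_subset hU hMU hcl
  have hsub : ∫ x in M, tangentTrace (tangentSpace M x) (fderiv ℝ X x) ∂μHE[k] =
      ∫ x in F '' V, tangentTrace (tangentSpace M x) (fderiv ℝ X x) ∂μHE[k] := by
    refine setIntegral_eq_of_subset_of_forall_sdiff_eq_zero hm h.image_subset ?_
    intro x hx
    rw [fderiv_eq_zero_of_forall_notMem hU hK h0 ⟨hMU hx.1, fun hxK => hx.2 (hKF ⟨hx.1, hxK⟩)⟩,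
      tangentTrace_zero]
  rw [hsub, h.integral_image, ← key]
  refine setIntegral_congr_fun h.isOpen_domain.measurableSet fun v hv => ?_
  congr 1
  rw [h.tangentSpace_eq hv, tangentTrace_range (h.injective_fderiv v hv), (hZV v hv).fderiv_eq,
    fderiv_comp v ((hX.contDiffAt (hU.mem_nhds (hVU v hv))).differentiableAt (by simp))
      (h.hasFDerivAt hv).differentiableAt]
  rfl

/-- The first variation formula: on a minimal submanifold the divergence of a compactly
supported vector field integrates to zero. -/
lemma IsMinimalSubmanifold.integral_tangentTrace_fderiv_eq_zero (hM : IsMinimalSubmanifold k M)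
    (hU : IsOpen U) (hMU : M ⊆ U) (hcl : closure M ∩ U ⊆ M) (hK : IsCompact K) (hKU : K ⊆ U)
    {X : EuclideanSpace ℝ (Fin n) → EuclideanSpace ℝ (Fin n)}
    (hX : ContDiffOn ℝ 1 X U) (h0 : ∀ x ∈ U \ K, X x = 0) :
    ∫ x in M, tangentTrace (tangentSpace M x) (fderiv ℝ X x) ∂μHE[k] = 0 := by
  classical
  have hm := measurableSet_of_closure_inter_subset hU hMU hcl
  have hchart : ∀ x ∈ M, ∃ (V : Set (EuclideanSpace ℝ (Fin k)))
      (F : EuclideanSpace ℝ (Fin k) → EuclideanSpace ℝ (Fin n)) (χ : ContDiffBump x),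
      IsLocalParametrization M V F ∧ M ∩ Metric.closedBall x χ.rOut ⊆ F '' V := by
    intro x hx
    obtain ⟨V, F, h, hxF⟩ := hM.isSubmanifold x hx
    obtain ⟨W, hWo, hW⟩ := h.isOpen_image
    have hxW : x ∈ W := by rw [hW] at hxF; exact hxF.2
    obtain ⟨ε, hε, hεW⟩ := Metric.nhds_basis_closedBall.mem_iff.1 (hWo.mem_nhds hxW)
    exact ⟨V, F, ⟨ε / 2, ε, half_pos hε, half_lt_self hε⟩, h,
      hW ▸ inter_subset_inter_right _ hεW⟩
  choose! V F χ hF hχ using hchart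
  have hint : ∀ (K : Set (EuclideanSpace ℝ (Fin n))), IsCompact K → K ⊆ U →
      ∀ X : EuclideanSpace ℝ (Fin n) → EuclideanSpace ℝ (Fin n), ContDiffOn ℝ 1 X U →
      (∀ x ∈ U \ K, X x = 0) →
      IntegrableOn (fun x => tangentTrace (tangentSpace M x) (fderiv ℝ X x)) M μHE[k] := by
    intro K hK hKU X hX h0
    have h1 := hM.isSubmanifold.integrableOn_of_continuousOn hcl hK hKU
      ((hM.isSubmanifold.continuousOn_tangentTrace_fderiv hU hMU hX).mono inter_subset_left)
    refine h1.of_forall_sdiff_eq_zero hm fun x hx => ?_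
    rw [fderiv_eq_zero_of_forall_notMem hU hK h0 ⟨hMU hx.1, fun hxK => hx.2 ⟨hx.1, hxK⟩⟩,
      tangentTrace_zero]
  -- Induction on the number of balls replaces a partition of unity. Split X = χX + (1-χ)X with χ
  -- the bump at p: the first part meets M only inside one chart, and the second vanishes on the
  -- inner ball at p, so the remaining centres cover what is left of its support.
  have main : ∀ S : Finset (EuclideanSpace ℝ (Fin n)), (S : Set _) ⊆ M →
      ∀ (K : Set (EuclideanSpace ℝ (Fin n))), IsCompact K → K ⊆ U →
      M ∩ K ⊆ ⋃ x ∈ S, Metric.ball x (χ x).rIn →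
      ∀ X : EuclideanSpace ℝ (Fin n) → EuclideanSpace ℝ (Fin n), ContDiffOn ℝ 1 X U →
      (∀ x ∈ U \ K, X x = 0) →
      ∫ x in M, tangentTrace (tangentSpace M x) (fderiv ℝ X x) ∂μHE[k] = 0 := by
    intro S
    induction S using Finset.induction_on with
    | empty =>
      intro _ K hK hKU hMK X hX h0
      refine setIntegral_eq_zero_of_forall_eq_zero fun x hx => ?_
      rw [fderiv_eq_zero_of_forall_notMem hU hK h0 ⟨hMU hx, fun hxK => by simpa using hMK ⟨hx, hxK⟩⟩,
        tangentTrace_zero]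
    | insert p S hp ih =>
      intro hSM K hK hKU hMK X hX h0
      have hpM : p ∈ M := hSM (by simp)
      have hχs : ContDiff ℝ 1 (χ p) := (χ p).contDiff
      have hX1 : ContDiffOn ℝ 1 (fun x => (χ p) x • X x) U := hχs.contDiffOn.smul hX
      have hX2 : ContDiffOn ℝ 1 (fun x => (1 - (χ p) x) • X x) U :=
        (contDiff_const.sub hχs).contDiffOn.smul hX
      have hK1 : IsCompact (K ∩ Metric.closedBall p (χ p).rOut) :=
        hK.inter_right Metric.isClosed_closedBall
      have hK2 : IsCompact (K \ Metric.ball p (χ p).rIn) := hK.diff Metric.isOpen_ball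
      have z1 : ∀ x ∈ U \ (K ∩ Metric.closedBall p (χ p).rOut), (χ p) x • X x = 0 := by
        intro x hx
        by_cases hxK : x ∈ K
        · rw [(χ p).zero_of_le_dist, zero_smul]
          exact (not_le.1 fun hd => hx.2 ⟨hxK, hd⟩).le
        · rw [h0 x ⟨hx.1, hxK⟩, smul_zero]
      have z2 : ∀ x ∈ U \ (K \ Metric.ball p (χ p).rIn), (1 - (χ p) x) • X x = 0 := by
        intro x hx
        by_cases hxK : x ∈ K
        · rw [(χ p).one_of_mem_closedBall, sub_self, zero_smul]
          exact Metric.ball_subset_closedBall (by_contra fun hd => hx.2 ⟨hxK, hd⟩)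
        · rw [h0 x ⟨hx.1, hxK⟩, smul_zero]
      have e1 := (hF p hpM).integral_tangentTrace_fderiv_eq_zero
        (hM.meanCurvature_eq_zero _ _ (hF p hpM)) hU hMU hcl hK1 (inter_subset_left.trans hKU)
        (fun x hx => hχ p hpM ⟨hx.1, hx.2.2⟩) hX1 z1
      have e2 := ih (fun x hx => hSM (by simp [hx])) _ hK2 (sdiff_subset.trans hKU)
        (fun x hx => by
          have := hMK ⟨hx.1, hx.2.1⟩
          rw [Finset.set_biUnion_insert] at this
          exact this.resolve_left hx.2.2) _ hX2 z2
      have e3 : ∀ x ∈ M, tangentTrace (tangentSpace M x) (fderiv ℝ X x) =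
          tangentTrace (tangentSpace M x) (fderiv ℝ (fun x => (χ p) x • X x) x) +
          tangentTrace (tangentSpace M x) (fderiv ℝ (fun x => (1 - (χ p) x) • X x) x) := by
        intro x hx
        have hd : ∀ {Y : EuclideanSpace ℝ (Fin n) → EuclideanSpace ℝ (Fin n)},
            ContDiffOn ℝ 1 Y U → DifferentiableAt ℝ Y x := fun hY =>
          (hY.contDiffAt (hU.mem_nhds (hMU hx))).differentiableAt (by simp)
        rw [← tangentTrace_add, ← fderiv_fun_add (hd hX1) (hd hX2)]
        congr 2
        ext1 y
        rw [← add_smul]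
        simp
      rw [setIntegral_congr_fun hm e3, integral_add (hint _ hK1 (inter_subset_left.trans hKU) _ hX1 z1)
        (hint _ hK2 (sdiff_subset.trans hKU) _ hX2 z2), e1, e2, add_zero]
  obtain ⟨S, hSM, hS⟩ := (isCompact_inter_of_closure_inter_subset hcl hK hKU).elim_nhds_subcover
    (fun x => Metric.ball x (χ x).rIn) fun x _ => Metric.ball_mem_nhds _ (χ x).rIn_pos
  exact main S (fun x hx => (hSM x hx).1) K hK hKU hS X hX h0

end FirstVariation

end MinimalMonotonicity

namespace MinimalMonotonicity

/-! ### The level function, its derivative and its sublevel sets. -/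

section LevelFunction

open Filter Topology

variable {n k : ℕ} {b x : EuclideanSpace ℝ (Fin n)} {R r q : ℝ}

/-- The affine function `R² - 2⟨b, x - σ(0)⟩`. -/
noncomputable def denom (b : EuclideanSpace ℝ (Fin n)) (R : ℝ) (x : EuclideanSpace ℝ (Fin n)) : ℝ :=
  R ^ 2 - 2 * inner ℝ b (x - refl b R 0)

lemma mem_halfSpace_iff (hb : b ≠ 0) : x ∈ halfSpace b R ↔ 0 < denom b R x := by
  rw [denom, ← two_mul_norm_sq_sub_inner hb]; rfl

lemma isOpen_halfSpace (b : EuclideanSpace ℝ (Fin n)) (R : ℝ) : IsOpen (halfSpace b R) :=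
  isOpen_lt continuous_const (by fun_prop)

lemma levelFun_eq_div_denom (hR : 0 < R) (hb : b ≠ 0) (hx : x ∈ halfSpace b R) :
    levelFun b R x = ‖b‖ ^ 2 * ‖x - refl b R 0‖ ^ 2 / denom b R x := by
  rw [levelFun_eq hR hb hx, denom, two_mul_norm_sq_sub_inner hb]

lemma levelFun_mul_denom (hR : 0 < R) (hb : b ≠ 0) (hx : x ∈ halfSpace b R) :
    levelFun b R x * denom b R x = ‖b‖ ^ 2 * ‖x - refl b R 0‖ ^ 2 := by
  rw [levelFun_eq_div_denom hR hb hx, div_mul_cancel₀ _ ((mem_halfSpace_iff hb).1 hx).ne']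

lemma levelFun_nonneg (hR : 0 < R) (hx : x ∈ halfSpace b R) : 0 ≤ levelFun b R x := by
  have := norm_refl_lt hR hx
  unfold levelFun; positivity

lemma contDiffOn_levelFun (hR : 0 < R) (hb : b ≠ 0) : ContDiffOn ℝ 1 (levelFun b R) (halfSpace b R) := by
  have : ContDiffOn ℝ 1 (fun x => ‖b‖ ^ 2 * ‖x - refl b R 0‖ ^ 2 / denom b R x) (halfSpace b R) := by
    refine ContDiffOn.div ?_ ?_ fun x hx => ((mem_halfSpace_iff hb).1 hx).ne'
    · exact (contDiff_const.mul ((contDiff_id.sub contDiff_const).norm_sq ℝ)).contDiffOn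
    · exact (contDiff_const.sub (contDiff_const.mul
        (contDiff_const.inner ℝ (contDiff_id.sub contDiff_const)))).contDiffOn
  exact this.congr fun x hx => levelFun_eq_div_denom hR hb hx

/-- Differentiate f·D = |b|²|x-a|² along lines rather than the quotient. The result is linear in x-a
and b with f as a coefficient, the form in which the test field can be matched to it. -/
lemma fderiv_levelFun_apply (hR : 0 < R) (hb : b ≠ 0) (hx : x ∈ halfSpace b R)
    (u : EuclideanSpace ℝ (Fin n)) :
    fderiv ℝ (levelFun b R) x u = 2 / denom b R x *
      (‖b‖ ^ 2 * inner ℝ (x - refl b R 0) u + levelFun b R x * inner ℝ b u) := by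
  have hD := (mem_halfSpace_iff hb).1 hx
  have hd := ((contDiffOn_levelFun hR hb).contDiffAt
    ((isOpen_halfSpace b R).mem_nhds hx)).differentiableAt (by simp)
  have h1 := hd.hasFDerivAt.hasLineDerivAt u
  have hy : HasDerivAt (fun t : ℝ => x + t • u - refl b R 0) u 0 := by
    simpa using (((hasDerivAt_id (0 : ℝ)).smul_const u).const_add x).sub_const (refl b R 0)
  have h2 : HasDerivAt (fun t : ℝ => denom b R (x + t • u)) (-(2 * inner ℝ b u)) 0 := by
    have := ((hasDerivAt_const (0 : ℝ) b).inner ℝ hy).const_mul 2 |>.const_sub (R ^ 2)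
    simpa [denom] using this
  have h3 := h1.mul h2
  have h4 : HasDerivAt (fun t : ℝ => ‖b‖ ^ 2 * ‖x + t • u - refl b R 0‖ ^ 2)
      (‖b‖ ^ 2 * (2 * inner ℝ (x - refl b R 0) u)) 0 := by
    have := hy.norm_sq.const_mul (‖b‖ ^ 2)
    simpa using this
  have h5 : ((fun t : ℝ => levelFun b R (x + t • u)) * fun t : ℝ => denom b R (x + t • u)) =ᶠ[𝓝 0]
      fun t : ℝ => ‖b‖ ^ 2 * ‖x + t • u - refl b R 0‖ ^ 2 := by
    have hc : Continuous fun t : ℝ => x + t • u := by fun_prop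
    have : ∀ᶠ t : ℝ in 𝓝 0, x + t • u ∈ halfSpace b R :=
      hc.continuousAt.eventually (by simpa using (isOpen_halfSpace b R).mem_nhds hx)
    filter_upwards [this] with t ht using levelFun_mul_denom hR hb ht
  have h6 := h3.unique (h4.congr_of_eventuallyEq h5)
  simp only [zero_smul, add_zero] at h6
  field_simp
  linear_combination h6

lemma ballImage_subset_halfSpace (hb : b ≠ 0) (hR : 0 < R) (hr : 0 < r) (hrb : r < ‖b‖) :
    ballImage b R r ⊆ halfSpace b R := by
  rw [ballImage_eq hb hR hr hrb]; exact fun x hx => hx.1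

lemma isOpen_ballImage (hb : b ≠ 0) (hR : 0 < R) (hr : 0 < r) (hrb : r < ‖b‖) :
    IsOpen (ballImage b R r) := by
  rw [ballImage_eq_ball hb hR hr hrb]; exact Metric.isOpen_ball

lemma ballImage_mono (b : EuclideanSpace ℝ (Fin n)) (hrq : r ≤ q) : ballImage b R r ⊆ ballImage b R q :=
  image_mono (Metric.ball_subset_ball hrq)

/-- The image of a closed ball under the reflection. -/
def closedBallImage (b : EuclideanSpace ℝ (Fin n)) (R r : ℝ) : Set (EuclideanSpace ℝ (Fin n)) :=
  {x | ‖refl b R x‖ ≤ r}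

lemma isCompact_closedBallImage (hb : b ≠ 0) (hR : 0 < R) (hr : 0 < r) (hrb : r < ‖b‖) :
    IsCompact (closedBallImage b R r) := by
  have : closedBallImage b R r = Metric.closedBall (imageCenter b R r) (imageRadius b R r) := by
    ext x
    obtain ⟨c, hc, h⟩ := norm_refl_sub_radius_sign (x := x) hb hR hr hrb
    rw [Metric.mem_closedBall, dist_eq_norm, ← sub_nonpos, h]
    constructor
    · intro hx
      have hx : ‖refl b R x‖ ≤ r := hx
      exact mul_nonpos_of_nonneg_of_nonpos hc.le (by linarith)
    · intro hx
      have := nonpos_of_mul_nonpos_right hx hc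
      change ‖refl b R x‖ ≤ r
      linarith
  rw [this]
  exact isCompact_closedBall _ _

lemma closedBallImage_subset (hR : 0 < R) (hrq : r < q) : closedBallImage b R r ⊆ ballImage b R q :=
  fun _ hx => (mem_ballImage_iff hR).2 (lt_of_le_of_lt hx hrq)

lemma ballImage_subset_closedBallImage (hR : 0 < R) : ballImage b R r ⊆ closedBallImage b R r :=
  fun _ hx => ((mem_ballImage_iff hR).1 hx).le

lemma levelFun_lt_level_iff (hb : b ≠ 0) (hR : 0 < R) (hr : 0 < r) (hrb : r < ‖b‖)
    (hx : x ∈ halfSpace b R) : levelFun b R x < level b R r ↔ x ∈ ballImage b R r := by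
  rw [ballImage_eq hb hR hr hrb]
  exact ⟨fun h => ⟨hx, h⟩, fun h => h.2⟩

lemma levelFun_pos (hb : b ≠ 0) (hR : 0 < R) (hx : x ∈ halfSpace b R) (hxa : x ≠ refl b R 0) :
    0 < levelFun b R x := by
  have h1 := norm_pos_iff.2 hb
  have h2 := norm_pos_iff.2 (sub_ne_zero.2 hxa)
  have h3 := (mem_halfSpace_iff hb).1 hx
  rw [levelFun_eq_div_denom hR hb hx]
  positivity

lemma refl_zero_mem_ballImage (b : EuclideanSpace ℝ (Fin n)) (R : ℝ) (hr : 0 < r) :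
    refl b R 0 ∈ ballImage b R r := ⟨0, by simpa using hr, rfl⟩

end LevelFunction

/-! ### The first variation of radial test fields. -/

/-- A minimal submanifold `M` of the ball `σ(B_ρ)` with boundary on the boundary of the ball. -/
structure IsMinimalInBall {n : ℕ} (k : ℕ) (M : Set (EuclideanSpace ℝ (Fin n)))
    (b : EuclideanSpace ℝ (Fin n)) (R ρ : ℝ) : Prop where
  one_le : 1 ≤ k
  R_pos : 0 < R
  ne_zero : b ≠ 0
  pos : 0 < ρ
  lt_norm : ρ < ‖b‖
  isMinimal : IsMinimalSubmanifold k M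
  subset : M ⊆ ballImage b R ρ
  boundary : closure M \ M ⊆ frontier (ballImage b R ρ)

namespace IsMinimalInBall

open Filter Topology

variable {n k : ℕ} {M : Set (EuclideanSpace ℝ (Fin n))} {b x : EuclideanSpace ℝ (Fin n)}
  {R ρ r q : ℝ}

lemma isSubmanifold (h : IsMinimalInBall k M b R ρ) : IsSubmanifold k M := h.isMinimal.isSubmanifold

lemma isOpen_ball (h : IsMinimalInBall k M b R ρ) : IsOpen (ballImage b R ρ) := isOpen_ballImage h.ne_zero h.R_pos h.pos h.lt_norm

/-- An open set is disjoint from its frontier. Relative closedness in the ball is the form in which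
the boundary condition is used. -/
lemma closure_inter_subset (h : IsMinimalInBall k M b R ρ) : closure M ∩ ballImage b R ρ ⊆ M := by
  rintro x ⟨hx, hxU⟩
  by_contra hxM
  have := h.boundary ⟨hx, hxM⟩
  rw [h.isOpen_ball.frontier_eq] at this
  exact this.2 hxU

lemma measurableSet (h : IsMinimalInBall k M b R ρ) : MeasurableSet M :=
  measurableSet_of_closure_inter_subset h.isOpen_ball h.subset h.closure_inter_subset

lemma mem_halfSpace (h : IsMinimalInBall k M b R ρ) (hx : x ∈ M) : x ∈ halfSpace b R :=
  ballImage_subset_halfSpace h.ne_zero h.R_pos h.pos h.lt_norm (h.subset hx)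

lemma denom_pos (h : IsMinimalInBall k M b R ρ) (hx : x ∈ M) : 0 < denom b R x :=
  (mem_halfSpace_iff h.ne_zero).1 (h.mem_halfSpace hx)

lemma continuousOn_levelFun (h : IsMinimalInBall k M b R ρ) : ContinuousOn (levelFun b R) M :=
  (contDiffOn_levelFun h.R_pos h.ne_zero).continuousOn.mono fun _ hx => h.mem_halfSpace hx

lemma continuousOn_tangential (h : IsMinimalInBall k M b R ρ) {Y : EuclideanSpace ℝ (Fin n) → EuclideanSpace ℝ (Fin n)}
    (hY : Continuous Y) : ContinuousOn (fun x => tangential M x (Y x)) M :=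
  h.isSubmanifold.continuousOn_starProjection.clm_apply hY.continuousOn

lemma continuousOn_normal (h : IsMinimalInBall k M b R ρ) {Y : EuclideanSpace ℝ (Fin n) → EuclideanSpace ℝ (Fin n)}
    (hY : Continuous Y) : ContinuousOn (fun x => normal M x (Y x)) M := by
  have : (fun x => normal M x (Y x)) = fun x => Y x - tangential M x (Y x) := by
    ext1 x
    rw [eq_sub_iff_add_eq, add_comm]
    exact tangential_add_normal M x (Y x)
  rw [this]
  exact hY.continuousOn.sub (h.continuousOn_tangential hY)

lemma measurableSet_inter_ballImage (h : IsMinimalInBall k M b R ρ) (hr : 0 < r) (hrb : r < ‖b‖) :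
    MeasurableSet (M ∩ ballImage b R r) :=
  h.measurableSet.inter (isOpen_ballImage h.ne_zero h.R_pos hr hrb).measurableSet

lemma measure_inter_closedBallImage_lt_top (h : IsMinimalInBall k M b R ρ) (hr : 0 < r) (hrρ : r < ρ) :
    μHE[k] (M ∩ closedBallImage b R r) < ⊤ :=
  h.isSubmanifold.measure_inter_lt_top h.closure_inter_subset
    (isCompact_closedBallImage h.ne_zero h.R_pos hr (hrρ.trans h.lt_norm))
    (closedBallImage_subset h.R_pos hrρ)

lemma measure_inter_ballImage_lt_top (h : IsMinimalInBall k M b R ρ) (hr : 0 < r) (hrρ : r < ρ) :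
    μHE[k] (M ∩ ballImage b R r) < ⊤ :=
  (measure_mono (inter_subset_inter_right _ (ballImage_subset_closedBallImage h.R_pos))).trans_lt
    (h.measure_inter_closedBallImage_lt_top hr hrρ)

/-- The radial coefficient `(2/(|b|²D)) (|b|⁴|(x-a)^⊤|² - f²|b^⊤|²)` in the first variation. -/
noncomputable def radialCoeff (M : Set (EuclideanSpace ℝ (Fin n))) (b : EuclideanSpace ℝ (Fin n))
    (R : ℝ) (x : EuclideanSpace ℝ (Fin n)) : ℝ :=
  2 / (‖b‖ ^ 2 * denom b R x) * (‖b‖ ^ 4 * ‖tangential M x (x - refl b R 0)‖ ^ 2 -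
    levelFun b R x ^ 2 * ‖tangential M x b‖ ^ 2)

/-- The density `g` in the volume monotonicity. -/
noncomputable def volDefect (M : Set (EuclideanSpace ℝ (Fin n))) (b : EuclideanSpace ℝ (Fin n))
    (R : ℝ) (x : EuclideanSpace ℝ (Fin n)) : ℝ :=
  (‖b‖ ^ 4 * ‖normal M x (x - refl b R 0)‖ ^ 2 + levelFun b R x ^ 2 * ‖tangential M x b‖ ^ 2) /
    (‖b‖ ^ 4 * ‖x - refl b R 0‖ ^ 2)

/-- Substitute D = |b|²|x-a|²/f and use Pythagoras for x-a. The point a is excluded because the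
defect divides by |x-a|², whereas `radialCoeff` is continuous across a; hence the limit argument
works with `radialCoeff`. -/
lemma radialCoeff_eq (h : IsMinimalInBall k M b R ρ) (hx : x ∈ M) (hxa : x ≠ refl b R 0) :
    radialCoeff M b R x = 2 * levelFun b R x * (1 - volDefect M b R x) := by
  have hb := norm_pos_iff.2 h.ne_zero
  have hy := norm_pos_iff.2 (sub_ne_zero.2 hxa)
  have hD := h.denom_pos hx
  have hf := levelFun_mul_denom h.R_pos h.ne_zero (h.mem_halfSpace hx)
  have hp := norm_tangential_sq_add_norm_normal_sq M x (x - refl b R 0)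
  rw [radialCoeff, volDefect]
  set f := levelFun b R x
  have hf' : f = ‖b‖ ^ 2 * ‖x - refl b R 0‖ ^ 2 / denom b R x := by
    rw [← hf, mul_div_cancel_right₀ _ hD.ne']
  have e1 : 2 / (‖b‖ ^ 2 * denom b R x) = 2 * f / (‖b‖ ^ 4 * ‖x - refl b R 0‖ ^ 2) := by
    rw [hf']; field_simp
  rw [e1, eq_sub_of_add_eq hp]
  field_simp
  ring

lemma continuousOn_radialCoeff (h : IsMinimalInBall k M b R ρ) :
    ContinuousOn (radialCoeff M b R) M := by
  have hb := norm_pos_iff.2 h.ne_zero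
  refine ContinuousOn.mul (continuousOn_const.div ?_ fun x hx => ?_) ?_
  · unfold denom; fun_prop
  · have := h.denom_pos hx; positivity
  · exact (continuousOn_const.mul ((h.continuousOn_tangential (by fun_prop)).norm.pow 2)).sub
      ((h.continuousOn_levelFun.pow 2).mul
        ((h.continuousOn_tangential continuous_const).norm.pow 2))

/-- The first variation of a field `h(f)(x - a) + m(f) b`. -/
lemma tangentTrace_fderiv_test (h : IsMinimalInBall k M b R ρ) {H m : ℝ → ℝ} {ψ : ℝ → ℝ}
    (hH : ∀ t, HasDerivAt H (ψ t) t) (hm : ∀ t, HasDerivAt m (-(t * ψ t) / ‖b‖ ^ 2) t)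
    (hx : x ∈ M) :
    tangentTrace (tangentSpace M x) (fderiv ℝ (fun x => H (levelFun b R x) • (x - refl b R 0) +
      m (levelFun b R x) • b) x) =
      k * H (levelFun b R x) + ψ (levelFun b R x) * radialCoeff M b R x := by
  have hb := norm_pos_iff.2 h.ne_zero
  have hD := h.denom_pos hx
  have hxP := h.mem_halfSpace hx
  have hd := (((contDiffOn_levelFun h.R_pos h.ne_zero).contDiffAt
    ((isOpen_halfSpace b R).mem_nhds hxP)).differentiableAt (by simp)).hasFDerivAt
  have h1 := ((hH (levelFun b R x)).comp_hasFDerivAt x hd).smul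
    ((hasFDerivAt_id (𝕜 := ℝ) x).sub_const (refl b R 0))
  have h2 := ((hm (levelFun b R x)).comp_hasFDerivAt x hd).smul_const b
  have h3 := (h1.add h2).fderiv
  have h4 : fderiv ℝ (fun x => H (levelFun b R x) • (x - refl b R 0) +
      m (levelFun b R x) • b) x = H (levelFun b R x) • ContinuousLinearMap.id ℝ _ +
      (ψ (levelFun b R x) • fderiv ℝ (levelFun b R) x).smulRight (x - refl b R 0) +
      ((-(levelFun b R x * ψ (levelFun b R x)) / ‖b‖ ^ 2) • fderiv ℝ (levelFun b R) x).smulRight b :=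
    h3
  rw [h4, tangentTrace_add, tangentTrace_add, tangentTrace_smul, h.isSubmanifold.tangentTrace_id hx,
    tangentTrace_smulRight, tangentTrace_smulRight]
  simp only [_root_.smul_apply, smul_eq_mul]
  have e1 : (tangentSpace M x).starProjection (x - refl b R 0) =
      tangential M x (x - refl b R 0) := rfl
  have e2 : (tangentSpace M x).starProjection b = tangential M x b := rfl
  rw [e1, e2, fderiv_levelFun_apply h.R_pos h.ne_zero hxP, fderiv_levelFun_apply h.R_pos h.ne_zero hxP,
    inner_tangential, inner_tangential M x b b, inner_tangential M x (x - refl b R 0) b,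
    inner_tangential M x b, real_inner_comm (tangential M x (x - refl b R 0)) (tangential M x b),
    real_inner_self_eq_norm_sq, real_inner_self_eq_norm_sq, radialCoeff]
  -- The two ⟨(x-a)^⊤, b^⊤⟩ terms cancel; the derivative prescribed for m is chosen for this.
  field_simp
  ring

/-- The weak form of the monotonicity formulas. -/
lemma integral_test_eq_zero (h : IsMinimalInBall k M b R ρ) (hq : 0 < q) (hqρ : q < ρ) {ψ : ℝ → ℝ}
    (hψ : Continuous ψ) (hψ0 : ∀ t, level b R q ≤ t → ψ t = 0) :
    ∫ x in M, (k * (∫ s in level b R q..levelFun b R x, ψ s) +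
      ψ (levelFun b R x) * radialCoeff M b R x) ∂μHE[k] = 0 := by
  have hqb := hqρ.trans h.lt_norm
  set s := level b R q
  -- Both primitives start at the level of q, beyond which ψ vanishes, so the field vanishes outside
  -- a compact subset of the ball.
  let H : ℝ → ℝ := fun t => ∫ u in s..t, ψ u
  let m : ℝ → ℝ := fun t => ∫ u in s..t, -(u * ψ u) / ‖b‖ ^ 2
  have hψ' : Continuous fun u => -(u * ψ u) / ‖b‖ ^ 2 := by fun_prop
  have hH : ∀ t, HasDerivAt H (ψ t) t := fun t =>
    intervalIntegral.integral_hasDerivAt_right (hψ.intervalIntegrable _ _)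
      (hψ.stronglyMeasurableAtFilter _ _) hψ.continuousAt
  have hm : ∀ t, HasDerivAt m (-(t * ψ t) / ‖b‖ ^ 2) t := fun t =>
    intervalIntegral.integral_hasDerivAt_right (hψ'.intervalIntegrable _ _)
      (hψ'.stronglyMeasurableAtFilter _ _) hψ'.continuousAt
  have hHc : ContDiff ℝ 1 H := contDiff_one_iff_deriv.2
    ⟨fun t => (hH t).differentiableAt, by rwa [funext fun t => (hH t).deriv]⟩
  have hmc : ContDiff ℝ 1 m := contDiff_one_iff_deriv.2
    ⟨fun t => (hm t).differentiableAt, by rwa [funext fun t => (hm t).deriv]⟩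
  have hH0 : ∀ t, s ≤ t → H t = 0 := fun t ht => by
    refine intervalIntegral.integral_zero_ae (Eventually.of_forall fun u hu => hψ0 u ?_)
    rw [uIoc_of_le ht] at hu
    exact hu.1.le
  have hm0 : ∀ t, s ≤ t → m t = 0 := fun t ht => by
    refine intervalIntegral.integral_zero_ae (Eventually.of_forall fun u hu => ?_)
    rw [uIoc_of_le ht] at hu
    rw [hψ0 u hu.1.le]; simp
  have hf : ContDiffOn ℝ 1 (levelFun b R) (ballImage b R ρ) :=
    (contDiffOn_levelFun h.R_pos h.ne_zero).mono
      (ballImage_subset_halfSpace h.ne_zero h.R_pos h.pos h.lt_norm)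
  have key := h.isMinimal.integral_tangentTrace_fderiv_eq_zero h.isOpen_ball h.subset
    h.closure_inter_subset (isCompact_closedBallImage h.ne_zero h.R_pos hq hqb)
    (closedBallImage_subset h.R_pos hqρ)
    (X := fun x => H (levelFun b R x) • (x - refl b R 0) + m (levelFun b R x) • b)
    (((hHc.comp_contDiffOn hf).smul (contDiff_id.sub contDiff_const).contDiffOn).add
      ((hmc.comp_contDiffOn hf).smul contDiffOn_const))
    (fun x hx => by
      have hs : s ≤ levelFun b R x := by
        refine not_lt.1 fun hlt => hx.2 (ballImage_subset_closedBallImage h.R_pos ?_)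
        exact (levelFun_lt_level_iff h.ne_zero h.R_pos hq hqb
          (ballImage_subset_halfSpace h.ne_zero h.R_pos h.pos h.lt_norm hx.1)).1 hlt
      rw [hH0 _ hs, hm0 _ hs]; simp)
  rw [← key]
  exact setIntegral_congr_fun h.measurableSet fun x hx => (h.tangentTrace_fderiv_test hH hm hx).symm

end IsMinimalInBall

end MinimalMonotonicity

namespace MinimalMonotonicity

/-! ### Cutoff functions and the power weight. -/

section Cutoff

open Filter Topology

/-- Continuous cutoff functions converging to the indicator of `[s₀, s₁)`. -/
noncomputable def cutoff (s₀ s₁ : ℝ) (j : ℕ) (t : ℝ) : ℝ :=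
  max 0 (min 1 (min (j * (t - s₀) + 1) (j * (s₁ - t))))

variable {s₀ s₁ t : ℝ}

lemma continuous_cutoff (s₀ s₁ : ℝ) (j : ℕ) : Continuous (cutoff s₀ s₁ j) := by
  unfold cutoff; fun_prop

lemma cutoff_nonneg (s₀ s₁ : ℝ) (j : ℕ) (t : ℝ) : 0 ≤ cutoff s₀ s₁ j t := le_max_left _ _

lemma cutoff_le_one (s₀ s₁ : ℝ) (j : ℕ) (t : ℝ) : cutoff s₀ s₁ j t ≤ 1 :=
  max_le zero_le_one (min_le_left _ _)

lemma cutoff_eq_zero (j : ℕ) (ht : s₁ ≤ t) : cutoff s₀ s₁ j t = 0 := by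
  refine max_eq_left ((min_le_right _ _).trans ((min_le_right _ _).trans ?_))
  exact mul_nonpos_of_nonneg_of_nonpos (by positivity) (by linarith)

lemma tendsto_cutoff (s₀ s₁ t : ℝ) : Tendsto (fun j => cutoff s₀ s₁ j t) atTop
    (𝓝 ((Ico s₀ s₁).indicator (fun _ => 1) t)) := by
  by_cases h1 : s₁ ≤ t
  · rw [indicator_of_notMem fun h => not_lt.2 h1 h.2]
    simp [cutoff_eq_zero _ h1]
  · have hd : 0 < s₁ - t := by linarith [not_le.1 h1]
    have hj := (tendsto_natCast_atTop_atTop (R := ℝ)).atTop_mul_const hd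
    by_cases h0 : s₀ ≤ t
    · rw [indicator_of_mem (show t ∈ Ico s₀ s₁ from ⟨h0, not_le.1 h1⟩)]
      refine tendsto_const_nhds.congr' ?_
      filter_upwards [hj.eventually_ge_atTop 1] with j hj
      have : (0 : ℝ) ≤ j * (t - s₀) := mul_nonneg (by positivity) (by linarith)
      rw [cutoff, min_eq_left (le_min (by linarith) hj), max_eq_right zero_le_one]
    · rw [indicator_of_notMem fun h => h0 h.1]
      have hd : 0 < s₀ - t := by linarith [not_le.1 h0]
      have hj := (tendsto_natCast_atTop_atTop (R := ℝ)).atTop_mul_const hd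
      refine tendsto_const_nhds.congr' ?_
      filter_upwards [hj.eventually_ge_atTop 1] with j hj
      refine (max_eq_left ((min_le_right _ _).trans ((min_le_left _ _).trans ?_))).symm
      linarith

/-- The weight `-d/dt t^{-p}`, made constant below `s₀`. -/
noncomputable def powWeight (p s₀ t : ℝ) : ℝ := p * (max t s₀) ^ (-p - 1)

variable {p : ℝ}

lemma continuous_powWeight (h0 : 0 < s₀) : Continuous (powWeight p s₀) := by
  refine continuous_const.mul (Continuous.rpow_const (by fun_prop) fun t => Or.inl ?_)
  have := lt_max_of_lt_right (b := t) h0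
  exact this.ne'

lemma powWeight_nonneg (h0 : 0 < s₀) (hp : 0 ≤ p) (t : ℝ) : 0 ≤ powWeight p s₀ t :=
  mul_nonneg hp (Real.rpow_nonneg (h0.le.trans (le_max_right _ _)) _)

lemma powWeight_le (h0 : 0 < s₀) (hp : 0 ≤ p) (t : ℝ) : powWeight p s₀ t ≤ p * s₀ ^ (-p - 1) :=
  mul_le_mul_of_nonneg_left
    (Real.rpow_le_rpow_of_nonpos h0 (le_max_right _ _) (by linarith)) hp

lemma integral_powWeight (h0 : 0 < s₀) {u v : ℝ} (hu : s₀ ≤ u) (huv : u ≤ v) :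
    ∫ t in u..v, powWeight p s₀ t = u ^ (-p) - v ^ (-p) := by
  have hd : ∀ t ∈ uIcc u v, HasDerivAt (fun t : ℝ => -t ^ (-p)) (powWeight p s₀ t) t := by
    intro t ht
    rw [uIcc_of_le huv] at ht
    have hst : s₀ ≤ t := hu.trans ht.1
    have := (Real.hasDerivAt_rpow_const (x := t) (p := -p) (Or.inl (by linarith))).fun_neg
    rw [powWeight, max_eq_left hst]
    simpa using this
  rw [intervalIntegral.integral_eq_sub_of_hasDerivAt hd
    ((continuous_powWeight h0).intervalIntegrable _ _)]
  ring

lemma integral_indicator_powWeight (h0 : 0 < s₀) (h01 : s₀ < s₁) (ht : t < s₁) :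
    ∫ u in s₁..t, (Ico s₀ s₁).indicator (powWeight p s₀) u =
      s₁ ^ (-p) - (max t s₀) ^ (-p) := by
  have hae : (Ioc t s₁ ∩ Ico s₀ s₁ : Set ℝ) =ᵐ[volume] Ioc (max t s₀) s₁ := by
    have : (Ioc (max t s₀) s₁ : Set ℝ) = Ioc t s₁ ∩ Ioc s₀ s₁ := by
      rw [Ioc_inter_Ioc, min_self]
    rw [this]
    exact (ae_eq_refl _).inter Ico_ae_eq_Ioc
  rw [intervalIntegral.integral_symm, intervalIntegral.integral_of_le ht.le,
    setIntegral_indicator measurableSet_Ico, setIntegral_congr_set hae,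
    ← intervalIntegral.integral_of_le (max_le ht.le h01.le),
    integral_powWeight h0 (le_max_right _ _) (max_le ht.le h01.le)]
  ring

end Cutoff

/-! ### The volume monotonicity formula. -/

namespace IsMinimalInBall

open Filter Topology

variable {n k : ℕ} {M : Set (EuclideanSpace ℝ (Fin n))} {b x : EuclideanSpace ℝ (Fin n)}
  {R ρ r q : ℝ}

/-- The annulus lies in a compact subset of the ball that avoids a, so the singularity of the
densities at a plays no role. -/
lemma integrableOn_annulus (h : IsMinimalInBall k M b R ρ) (hr : 0 < r) (hrq : r < q)
    (hqρ : q < ρ) {g : EuclideanSpace ℝ (Fin n) → ℝ} (hg : ContinuousOn g (M \ {refl b R 0})) :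
    IntegrableOn g (M ∩ (ballImage b R q \ ballImage b R r)) μHE[k] := by
  have hqb := hqρ.trans h.lt_norm
  have hrb := hrq.trans hqb
  have hK : IsCompact (closedBallImage b R q \ ballImage b R r) :=
    (isCompact_closedBallImage h.ne_zero h.R_pos (hr.trans hrq) hqb).diff
      (isOpen_ballImage h.ne_zero h.R_pos hr hrb)
  refine IntegrableOn.mono_set (h.isSubmanifold.integrableOn_of_continuousOn
    h.closure_inter_subset hK (sdiff_subset.trans (closedBallImage_subset h.R_pos hqρ))
    (hg.mono ?_)) (inter_subset_inter_right _ (sdiff_subset_sdiff_left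
      (ballImage_subset_closedBallImage h.R_pos)))
  rintro x ⟨hxM, hx⟩
  refine ⟨hxM, ?_⟩
  rintro rfl
  exact hx.2 (refl_zero_mem_ballImage b R hr)

lemma levelFun_pos' (h : IsMinimalInBall k M b R ρ) (hx : x ∈ M \ {refl b R 0}) :
    0 < levelFun b R x := levelFun_pos h.ne_zero h.R_pos (h.mem_halfSpace hx.1) hx.2

lemma continuousOn_rpow_levelFun (h : IsMinimalInBall k M b R ρ) (p : ℝ) :
    ContinuousOn (fun x => levelFun b R x ^ p) (M \ {refl b R 0}) :=
  (h.continuousOn_levelFun.mono sdiff_subset).rpow_const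
    fun _ hx => Or.inl (h.levelFun_pos' hx).ne'

lemma norm_sub_pos {a : EuclideanSpace ℝ (Fin n)} (hx : x ∈ M \ {a}) : 0 < ‖x - a‖ :=
  norm_pos_iff.2 (sub_ne_zero.2 hx.2)

lemma continuousOn_volDefect (h : IsMinimalInBall k M b R ρ) :
    ContinuousOn (volDefect M b R) (M \ {refl b R 0}) := by
  have hb := norm_pos_iff.2 h.ne_zero
  refine ContinuousOn.div ?_ (by fun_prop) fun x hx => ?_
  · refine ContinuousOn.mono ?_ sdiff_subset
    exact (continuousOn_const.mul ((h.continuousOn_normal (by fun_prop)).norm.pow 2)).add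
      ((h.continuousOn_levelFun.pow 2).mul
        ((h.continuousOn_tangential continuous_const).norm.pow 2))
  · have := norm_sub_pos hx
    positivity

/-- The weak formula for a discontinuous ψ, obtained from continuous cutoffs by dominated
convergence. This avoids differentiating the volume of M ∩ σ(B_r) in r or using a coarea formula. -/
lemma integral_indicator_add_radialCoeff_eq_zero (h : IsMinimalInBall k M b R ρ) (hr : 0 < r)
    (hrq : r < q) (hqρ : q < ρ) {p : ℝ} (hp : 0 ≤ p) :
    ∫ x in M, (k * (∫ s in level b R q..levelFun b R x,
        (Ico (level b R r) (level b R q)).indicator (powWeight p (level b R r)) s) +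
      (Ico (level b R r) (level b R q)).indicator (powWeight p (level b R r)) (levelFun b R x) *
        radialCoeff M b R x) ∂μHE[k] = 0 := by
  have hq := hr.trans hrq
  have hqb := hqρ.trans h.lt_norm
  have hrb := hrq.trans hqb
  set s₀ := level b R r
  set s₁ := level b R q
  have hs₀ : 0 < s₀ := level_pos h.R_pos hr hrb
  have hs₁ : 0 < s₁ := level_pos h.R_pos hq hqb
  let η := powWeight p s₀
  have hηc : Continuous η := continuous_powWeight hs₀
  set C : ℝ := p * s₀ ^ (-p - 1)
  have hC0 : 0 ≤ C := mul_nonneg hp (Real.rpow_nonneg hs₀.le _)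
  let ψ : ℕ → ℝ → ℝ := fun j t => cutoff s₀ s₁ j t * η t
  have hψc : ∀ j, Continuous (ψ j) := fun j => (continuous_cutoff s₀ s₁ j).mul hηc
  have hψ0 : ∀ j t, s₁ ≤ t → ψ j t = 0 := fun j t ht => by simp [ψ, cutoff_eq_zero j ht]
  have hψC : ∀ j t, ‖ψ j t‖ ≤ C := by
    intro j t
    rw [Real.norm_of_nonneg (mul_nonneg (cutoff_nonneg _ _ _ _) (powWeight_nonneg hs₀ hp t))]
    calc cutoff s₀ s₁ j t * η t ≤ 1 * η t :=
          mul_le_mul_of_nonneg_right (cutoff_le_one _ _ _ _) (powWeight_nonneg hs₀ hp t)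
      _ ≤ C := by rw [one_mul]; exact powWeight_le hs₀ hp t
  have hψt : ∀ t, Tendsto (fun j => ψ j t) atTop (𝓝 ((Ico s₀ s₁).indicator η t)) := by
    intro t
    have := (tendsto_cutoff s₀ s₁ t).mul_const (η t)
    convert this using 2
    by_cases ht : t ∈ Ico s₀ s₁
    · simp [ht]
    · simp [ht]
  have hIt : ∀ t, Tendsto (fun j => ∫ s in s₁..t, ψ j s) atTop
      (𝓝 (∫ s in s₁..t, (Ico s₀ s₁).indicator η s)) := by
    intro t
    refine intervalIntegral.tendsto_integral_filter_of_dominated_convergence (fun _ => C)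
      (Eventually.of_forall fun j => (hψc j).aestronglyMeasurable)
      (Eventually.of_forall fun j => Eventually.of_forall fun s _ => hψC j s)
      intervalIntegrable_const (Eventually.of_forall fun s _ => hψt s)
  have hIcont : ∀ j, Continuous fun t => ∫ s in s₁..t, ψ j s := fun j =>
    intervalIntegral.continuous_primitive (fun a b => (hψc j).intervalIntegrable a b) s₁
  have hI0 : ∀ j t, s₁ ≤ t → ∫ s in s₁..t, ψ j s = 0 := fun j t ht => by
    refine intervalIntegral.integral_zero_ae (Eventually.of_forall fun u hu => hψ0 j u ?_)
    rw [uIoc_of_le ht] at hu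
    exact hu.1.le
  -- Uniform in j because the levels are nonnegative: the primitive only sees an interval of length
  -- at most s₁.
  have hIC : ∀ j t, 0 ≤ t → ‖∫ s in s₁..t, ψ j s‖ ≤ C * s₁ := by
    intro j t ht
    by_cases hts : s₁ ≤ t
    · rw [hI0 j t hts]; simp; positivity
    · refine (intervalIntegral.norm_integral_le_of_norm_le_const fun s _ => hψC j s).trans ?_
      gcongr
      rw [abs_le]; constructor <;> linarith
  have hbound : IntegrableOn (fun x => (ballImage b R q).indicator
      (fun x => k * (C * s₁) + C * ‖radialCoeff M b R x‖) x) M μHE[k] := by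
    have hb' : IntegrableOn (fun x => k * (C * s₁) + C * ‖radialCoeff M b R x‖)
        (M ∩ closedBallImage b R q) μHE[k] :=
      h.isSubmanifold.integrableOn_of_continuousOn h.closure_inter_subset
        (isCompact_closedBallImage h.ne_zero h.R_pos hq hqb) (closedBallImage_subset h.R_pos hqρ)
        ((continuousOn_const.add (continuousOn_const.mul
          h.continuousOn_radialCoeff.norm)).mono inter_subset_left)
    have hm := (isOpen_ballImage h.ne_zero h.R_pos hq hqb).measurableSet
    rw [IntegrableOn, integrable_indicator_iff hm, IntegrableOn, Measure.restrict_restrict hm,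
      inter_comm]
    exact hb'.mono_set (inter_subset_inter_right _ (ballImage_subset_closedBallImage h.R_pos))
  have hlim := tendsto_integral_of_dominated_convergence (μ := μHE[k].restrict M)
    (F := fun j x => k * (∫ s in s₁..levelFun b R x, ψ j s) +
      ψ j (levelFun b R x) * radialCoeff M b R x)
    (f := fun x => k * (∫ s in s₁..levelFun b R x, (Ico s₀ s₁).indicator η s) +
      (Ico s₀ s₁).indicator η (levelFun b R x) * radialCoeff M b R x)
    _ (fun j => ContinuousOn.aestronglyMeasurable
      ((continuousOn_const.mul ((hIcont j).comp_continuousOn h.continuousOn_levelFun)).add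
        (((hψc j).comp_continuousOn h.continuousOn_levelFun).mul h.continuousOn_radialCoeff))
      h.measurableSet) hbound
    (fun j => (ae_restrict_iff' h.measurableSet).2 (Eventually.of_forall fun x hx => by
      by_cases hxq : x ∈ ballImage b R q
      · rw [indicator_of_mem hxq]
        refine (norm_add_le _ _).trans (add_le_add ?_ ?_)
        · rw [norm_mul, Real.norm_natCast]
          exact mul_le_mul_of_nonneg_left
            (hIC j _ (levelFun_nonneg h.R_pos (h.mem_halfSpace hx))) (by positivity)
        · rw [norm_mul]
          exact mul_le_mul_of_nonneg_right (hψC j _) (norm_nonneg _)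
      · have hs : s₁ ≤ levelFun b R x := not_lt.1 fun hlt => hxq
          ((levelFun_lt_level_iff h.ne_zero h.R_pos hq hqb (h.mem_halfSpace hx)).1 hlt)
        rw [indicator_of_notMem hxq, hI0 j _ hs, hψ0 j _ hs]
        simp))
    (Eventually.of_forall fun x => ((hIt _).const_mul _).add ((hψt _).mul_const _))
  have hzero : (fun j => ∫ x in M, (k * (∫ s in s₁..levelFun b R x, ψ j s) +
      ψ j (levelFun b R x) * radialCoeff M b R x) ∂μHE[k]) = fun _ => 0 := by
    ext1 j
    exact h.integral_test_eq_zero hq hqρ (hψc j) (hψ0 j)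
  rw [hzero] at hlim
  exact tendsto_nhds_unique hlim tendsto_const_nhds

lemma integrableOn_volDefect (h : IsMinimalInBall k M b R ρ) (hr : 0 < r) (hrq : r < q)
    (hqρ : q < ρ) :
    IntegrableOn (fun x => levelFun b R x ^ (-((k : ℝ) / 2)) * volDefect M b R x)
      (M ∩ (ballImage b R q \ ballImage b R r)) μHE[k] :=
  h.integrableOn_annulus hr hrq hqρ
    ((h.continuousOn_rpow_levelFun (-((k : ℝ) / 2))).mul h.continuousOn_volDefect)

/-- The volume monotonicity in terms of the levels of `f`. -/
lemma integral_volDefect (h : IsMinimalInBall k M b R ρ) (hr : 0 < r)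
    (hrq : r < q) (hqρ : q < ρ) :
    ∫ x in M ∩ (ballImage b R q \ ballImage b R r),
        levelFun b R x ^ (-((k : ℝ) / 2)) * volDefect M b R x ∂μHE[k] =
      level b R q ^ (-((k : ℝ) / 2)) * (μHE[k] (M ∩ ballImage b R q)).toReal -
      level b R r ^ (-((k : ℝ) / 2)) * (μHE[k] (M ∩ ballImage b R r)).toReal := by
  have hq := hr.trans hrq
  have hqb := hqρ.trans h.lt_norm
  have hrb := hrq.trans hqb
  have hk : (0 : ℝ) < k := by exact_mod_cast h.one_le
  -- With p = k/2 the term 2fψ(f) equals k f^{-k/2} on the annulus and cancels the -k f^{-k/2} in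
  -- kH(f). What remains is constant on σ(B_r), and on the annulus a constant minus k f^{-k/2} times
  -- the defect.
  have key := h.integral_indicator_add_radialCoeff_eq_zero hr hrq hqρ (p := (k : ℝ) / 2)
    (by positivity)
  have hs₀ : 0 < level b R r := level_pos h.R_pos hr hrb
  have hs₀₁ : level b R r < level b R q := level_lt_level h.R_pos hr hrq hqb
  set s₀ := level b R r
  set s₁ := level b R q
  have hmr := (isOpen_ballImage h.ne_zero h.R_pos hr hrb).measurableSet
  have hmq := (isOpen_ballImage h.ne_zero h.R_pos hq hqb).measurableSet
  have hma := hmq.diff hmr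
  have hint := h.integrableOn_volDefect hr hrq hqρ
  have hfr := h.measure_inter_ballImage_lt_top hr (hrq.trans hqρ)
  have hfq := h.measure_inter_ballImage_lt_top hq hqρ
  have hfa : μHE[k] (M ∩ (ballImage b R q \ ballImage b R r)) < ⊤ :=
    (measure_mono (inter_subset_inter_right _ sdiff_subset)).trans_lt hfq
  have hpt : ∀ x ∈ M, (k * (∫ s in s₁..levelFun b R x,
        (Ico s₀ s₁).indicator (powWeight ((k : ℝ) / 2) s₀) s) +
      (Ico s₀ s₁).indicator (powWeight ((k : ℝ) / 2) s₀) (levelFun b R x) *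
        radialCoeff M b R x) =
      (ballImage b R r).indicator (fun _ => k * (s₁ ^ (-((k : ℝ) / 2)) - s₀ ^ (-((k : ℝ) / 2)))) x +
      (ballImage b R q \ ballImage b R r).indicator (fun x => k * (s₁ ^ (-((k : ℝ) / 2)) -
        levelFun b R x ^ (-((k : ℝ) / 2)) * volDefect M b R x)) x := by
    intro x hx
    have hxP := h.mem_halfSpace hx
    have hiq := levelFun_lt_level_iff h.ne_zero h.R_pos hq hqb hxP
    have hir := levelFun_lt_level_iff h.ne_zero h.R_pos hr hrb hxP
    by_cases hxr : x ∈ ballImage b R r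
    · have hxs := hir.2 hxr
      rw [integral_indicator_powWeight hs₀ hs₀₁ (hxs.trans hs₀₁), max_eq_right hxs.le,
        indicator_of_notMem fun hh => not_lt.2 hh.1 hxs, indicator_of_mem hxr,
        indicator_of_notMem fun hh => hh.2 hxr]
      ring
    · have hxs : s₀ ≤ levelFun b R x := not_lt.1 fun hlt => hxr (hir.1 hlt)
      by_cases hxq : x ∈ ballImage b R q
      · have hxs' := hiq.2 hxq
        have hxa : x ≠ refl b R 0 := by
          rintro rfl; exact hxr (refl_zero_mem_ballImage b R hr)
        have hpos : 0 < levelFun b R x := hs₀.trans_le hxs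
        rw [integral_indicator_powWeight hs₀ hs₀₁ hxs', max_eq_left hxs,
          indicator_of_mem (show levelFun b R x ∈ Ico s₀ s₁ from ⟨hxs, hxs'⟩),
          indicator_of_notMem hxr,
          indicator_of_mem (show x ∈ ballImage b R q \ ballImage b R r from ⟨hxq, hxr⟩),
          h.radialCoeff_eq hx hxa, powWeight, max_eq_left hxs]
        have : levelFun b R x ^ (-((k : ℝ) / 2) - 1) * levelFun b R x =
            levelFun b R x ^ (-((k : ℝ) / 2)) := by
          rw [Real.rpow_sub_one hpos.ne', div_mul_cancel₀ _ hpos.ne']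
        linear_combination (k * (1 - volDefect M b R x)) * this
      · have hxs' : s₁ ≤ levelFun b R x := not_lt.1 fun hlt => hxq (hiq.1 hlt)
        have : ∫ s in s₁..levelFun b R x, (Ico s₀ s₁).indicator (powWeight ((k : ℝ) / 2) s₀) s = 0 := by
          refine intervalIntegral.integral_zero_ae (Eventually.of_forall fun u hu => ?_)
          rw [uIoc_of_le hxs'] at hu
          exact indicator_of_notMem (fun hh => not_lt.2 hu.1.le hh.2) _
        rw [this, indicator_of_notMem fun hh => not_lt.2 hxs' hh.2, indicator_of_notMem hxr,
          indicator_of_notMem fun hh => hxq hh.1]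
        simp
  have hconst : ∀ c : ℝ, Integrable (fun _ : EuclideanSpace ℝ (Fin n) => c)
      (μHE[k].restrict (M ∩ (ballImage b R q \ ballImage b R r))) := fun c =>
    integrableOn_const hfa.ne
  have hi1 : IntegrableOn (fun x => (ballImage b R r).indicator
      (fun _ => k * (s₁ ^ (-((k : ℝ) / 2)) - s₀ ^ (-((k : ℝ) / 2)))) x) M μHE[k] := by
    rw [IntegrableOn, integrable_indicator_iff hmr, IntegrableOn, Measure.restrict_restrict hmr,
      inter_comm]
    exact integrableOn_const hfr.ne
  have hi2' : IntegrableOn (fun x => k * (s₁ ^ (-((k : ℝ) / 2)) -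
        levelFun b R x ^ (-((k : ℝ) / 2)) * volDefect M b R x))
        (M ∩ (ballImage b R q \ ballImage b R r)) μHE[k] :=
    ((hconst _).sub hint).const_mul _
  have hi2 : IntegrableOn (fun x => (ballImage b R q \ ballImage b R r).indicator
      (fun x => k * (s₁ ^ (-((k : ℝ) / 2)) -
        levelFun b R x ^ (-((k : ℝ) / 2)) * volDefect M b R x)) x) M μHE[k] := by
    rw [IntegrableOn, integrable_indicator_iff hma, IntegrableOn, Measure.restrict_restrict hma,
      inter_comm]
    exact hi2'
  rw [setIntegral_congr_fun h.measurableSet hpt, integral_add hi1 hi2, setIntegral_indicator hmr,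
    setIntegral_indicator hma, setIntegral_const, integral_const_mul,
    integral_sub (hconst _) hint, setIntegral_const] at key
  have hdiff : μHE[k].real (M ∩ (ballImage b R q \ ballImage b R r)) =
      μHE[k].real (M ∩ ballImage b R q) - μHE[k].real (M ∩ ballImage b R r) := by
    have he : M ∩ (ballImage b R q \ ballImage b R r) =
        (M ∩ ballImage b R q) \ (M ∩ ballImage b R r) := by
      ext x; simp only [mem_inter_iff, Set.mem_sdiff]; tauto
    rw [he, measureReal_sdiff (inter_subset_inter_right _ (ballImage_mono b hrq.le))
      (h.measurableSet.inter hmr) hfq.ne]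
  rw [hdiff] at key
  simp only [smul_eq_mul, measureReal_def] at key
  have hfin : (k : ℝ) * ((∫ x in M ∩ (ballImage b R q \ ballImage b R r),
        levelFun b R x ^ (-((k : ℝ) / 2)) * volDefect M b R x ∂μHE[k]) -
      (s₁ ^ (-((k : ℝ) / 2)) * (μHE[k] (M ∩ ballImage b R q)).toReal -
      s₀ ^ (-((k : ℝ) / 2)) * (μHE[k] (M ∩ ballImage b R r)).toReal)) = 0 := by
    linear_combination -key
  exact sub_eq_zero.1 ((mul_eq_zero.1 hfin).resolve_left hk.ne')

end IsMinimalInBall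

end MinimalMonotonicity

namespace MinimalMonotonicity

/-! ### The weight of the ratios as a function of the radius. -/

section RatioWeight

variable {n k : ℕ} {b x : EuclideanSpace ℝ (Fin n)} {R r q : ℝ}

/-- The factor `((|b|² - r²)/r²)^{k/2}` of the volume ratios. -/
noncomputable def ratioWeight (k : ℕ) (b : EuclideanSpace ℝ (Fin n)) (r : ℝ) : ℝ :=
  ((‖b‖ ^ 2 - r ^ 2) / r ^ 2) ^ ((k : ℝ) / 2)

/-- The function `(|b|² - r²)^{(k-2)/2} / r^{k+1}`, a multiple of `-d/dr ratioWeight`. -/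
noncomputable def ratioWeightDeriv (k : ℕ) (b : EuclideanSpace ℝ (Fin n)) (r : ℝ) : ℝ :=
  (‖b‖ ^ 2 - r ^ 2) ^ (((k : ℝ) - 2) / 2) / r ^ (k + 1)

lemma ratioWeight_eq (hR : 0 < R) (hr : 0 < r) (hrb : r < ‖b‖) :
    R ^ k * level b R r ^ (-((k : ℝ) / 2)) = ratioWeight k b r := by
  have h1 := norm_sq_sub_sq_pos hr hrb
  have h2 : (R : ℝ) ^ k = (R ^ 2) ^ ((k : ℝ) / 2) := by
    rw [← Real.rpow_natCast R 2, ← Real.rpow_mul hR.le, ← Real.rpow_natCast]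
    congr 1; push_cast; ring
  rw [Real.rpow_neg (level_pos hR hr hrb).le, ← Real.inv_rpow (level_pos hR hr hrb).le, h2,
    ← Real.mul_rpow (by positivity) (inv_nonneg.2 (level_pos hR hr hrb).le), ratioWeight, level]
  congr 1
  field_simp

lemma norm_refl_pos (hR : 0 < R) (hxa : x ≠ refl b R 0) : 0 < ‖refl b R x‖ := by
  refine norm_pos_iff.2 fun h0 => hxa ?_
  rw [← h0, refl, EuclideanGeometry.inversion_inversion _ hR.ne']

lemma norm_refl_lt_norm (hR : 0 < R) (hx : x ∈ halfSpace b R) : ‖refl b R x‖ < ‖b‖ := by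
  have := norm_refl_lt hR hx
  exact lt_of_pow_lt_pow_left₀ 2 (norm_nonneg _) (by linarith)

/-- By definition f(x) is the level of the radius |σ(x)|, so this is `ratioWeight_eq` at that
radius. -/
lemma ratioWeight_norm_refl (hR : 0 < R) (hx : x ∈ halfSpace b R) (hxa : x ≠ refl b R 0) :
    ratioWeight k b ‖refl b R x‖ = R ^ k * levelFun b R x ^ (-((k : ℝ) / 2)) :=
  (ratioWeight_eq hR (norm_refl_pos hR hxa) (norm_refl_lt_norm hR hx)).symm

lemma ratioWeightDeriv_pos (hr : 0 < r) (hrb : r < ‖b‖) : 0 < ratioWeightDeriv k b r := by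
  have h1 := norm_sq_sub_sq_pos hr hrb
  exact div_pos (Real.rpow_pos_of_pos h1 _) (by positivity)

lemma hasDerivAt_ratioWeight (hr : 0 < r) (hrb : r < ‖b‖) :
    HasDerivAt (ratioWeight k b) (-(k * ‖b‖ ^ 2 * ratioWeightDeriv k b r)) r := by
  have h1 := norm_sq_sub_sq_pos hr hrb
  have h2 : HasDerivAt (fun r : ℝ => (‖b‖ ^ 2 - r ^ 2) / r ^ 2)
      ((-(2 * r) * r ^ 2 - (‖b‖ ^ 2 - r ^ 2) * (2 * r)) / (r ^ 2) ^ 2) r := by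
    have h3 : HasDerivAt (fun r : ℝ => r ^ 2) (2 * r) r := by
      simpa using hasDerivAt_pow 2 r
    exact (h3.const_sub _).fun_div h3 (by positivity)
  have h4 := h2.rpow_const (p := (k : ℝ) / 2) (Or.inl (by positivity))
  have e2 : (r ^ 2) ^ ((k : ℝ) / 2 - 1) = r ^ k / r ^ 2 := by
    rw [Real.rpow_sub_one (by positivity), ← Real.rpow_natCast r 2, ← Real.rpow_mul hr.le,
      ← Real.rpow_natCast r k]
    congr 2; push_cast; ring
  refine h4.congr_deriv ?_
  rw [Real.div_rpow h1.le (by positivity), e2, ratioWeightDeriv,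
    show ((k : ℝ) - 2) / 2 = (k : ℝ) / 2 - 1 by ring]
  field_simp
  ring

lemma continuousOn_ratioWeightDeriv (hr : 0 < r) (hqb : q < ‖b‖) :
    ContinuousOn (ratioWeightDeriv k b) (Icc r q) := by
  refine ContinuousOn.div (ContinuousOn.rpow_const (by fun_prop) fun t ht => Or.inl ?_)
    (by fun_prop) fun t ht => ?_
  · exact (norm_sq_sub_sq_pos (hr.trans_le ht.1) (ht.2.trans_lt hqb)).ne'
  · have := hr.trans_le ht.1
    positivity

lemma integral_ratioWeightDeriv (hr : 0 < r) (hrq : r ≤ q) (hqb : q < ‖b‖) :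
    k * ‖b‖ ^ 2 * ∫ t in r..q, ratioWeightDeriv k b t = ratioWeight k b r - ratioWeight k b q := by
  have hd : ∀ t ∈ uIcc r q, HasDerivAt (ratioWeight k b)
      (-(k * ‖b‖ ^ 2 * ratioWeightDeriv k b t)) t := by
    intro t ht
    rw [uIcc_of_le hrq] at ht
    exact hasDerivAt_ratioWeight (hr.trans_le ht.1) (ht.2.trans_lt hqb)
  have hc : ContinuousOn (fun t => -(k * ‖b‖ ^ 2 * ratioWeightDeriv k b t)) (uIcc r q) := by
    rw [uIcc_of_le hrq]
    exact (continuousOn_const.mul (continuousOn_ratioWeightDeriv hr hqb)).neg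
  have := intervalIntegral.integral_eq_sub_of_hasDerivAt hd hc.intervalIntegrable
  rw [intervalIntegral.integral_neg, intervalIntegral.integral_const_mul] at this
  linarith

/-- The integral of `ratioWeightDeriv` over the radii in `(r, q]` that exceed `c`. -/
lemma setIntegral_indicator_ratioWeightDeriv (hr : 0 < r) {c : ℝ} (hrq : r ≤ q) (hcq : c ≤ q)
    (hqb : q < ‖b‖) :
    k * ‖b‖ ^ 2 * ∫ t in Ioc r q, (Ioi c).indicator (ratioWeightDeriv k b) t =
      ratioWeight k b (max r c) - ratioWeight k b q := by
  rw [setIntegral_indicator measurableSet_Ioi, Ioc_inter_Ioi,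
    ← intervalIntegral.integral_of_le (max_le hrq hcq),
    integral_ratioWeightDeriv (hr.trans_le (le_max_left _ _)) (max_le hrq hcq) hqb]

end RatioWeight

/-- Lets the point a be discarded, where the fractions take the default value 0/0 = 0 and do not add
up to 1. For k = 0 this would fail. -/
lemma euclideanHausdorffMeasure_singleton {n k : ℕ} (hk : 1 ≤ k) (a : EuclideanSpace ℝ (Fin n)) :
    μHE[k] {a} = 0 := by
  have hk' : (0 : ℝ) < k := by exact_mod_cast hk
  have := Measure.nullSingletonClass_hausdorff (EuclideanSpace ℝ (Fin n)) hk'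
  rw [Measure.euclideanHausdorffMeasure_def, Measure.smul_apply, measure_singleton, smul_zero]

lemma measurable_refl {n : ℕ} (b : EuclideanSpace ℝ (Fin n)) (R : ℝ) : Measurable (refl b R) := by
  rw [show refl b R = _ from funext fun x => refl_eq b x R]
  fun_prop

/-! ### The weighted monotonicity formula. -/

namespace IsMinimalInBall

open Filter Topology

variable {n k : ℕ} {M : Set (EuclideanSpace ℝ (Fin n))} {b x : EuclideanSpace ℝ (Fin n)}
  {R ρ r q : ℝ}

/-- The fraction `|(x-a)^⊥|²/|x-a|²`. -/
noncomputable def normalFraction (M : Set (EuclideanSpace ℝ (Fin n)))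
    (b : EuclideanSpace ℝ (Fin n)) (R : ℝ) (x : EuclideanSpace ℝ (Fin n)) : ℝ :=
  ‖normal M x (x - refl b R 0)‖ ^ 2 / ‖x - refl b R 0‖ ^ 2

/-- The fraction `|(x-a)^⊤|²/|x-a|²`. -/
noncomputable def tangentialFraction (M : Set (EuclideanSpace ℝ (Fin n)))
    (b : EuclideanSpace ℝ (Fin n)) (R : ℝ) (x : EuclideanSpace ℝ (Fin n)) : ℝ :=
  ‖tangential M x (x - refl b R 0)‖ ^ 2 / ‖x - refl b R 0‖ ^ 2

lemma tangentialFraction_add_normalFraction (hxa : x ≠ refl b R 0) :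
    tangentialFraction M b R x + normalFraction M b R x = 1 := by
  have := norm_pos_iff.2 (sub_ne_zero.2 hxa)
  rw [tangentialFraction, normalFraction, ← add_div, norm_tangential_sq_add_norm_normal_sq,
    div_self (by positivity)]

lemma normalFraction_nonneg : 0 ≤ normalFraction M b R x := by unfold normalFraction; positivity

lemma tangentialFraction_nonneg : 0 ≤ tangentialFraction M b R x := by
  unfold tangentialFraction; positivity

lemma continuousOn_normalFraction (h : IsMinimalInBall k M b R ρ) :
    ContinuousOn (normalFraction M b R) (M \ {refl b R 0}) :=
  (((h.continuousOn_normal (by fun_prop)).norm.pow 2).mono sdiff_subset).div (by fun_prop)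
    fun x hx => by have := norm_sub_pos hx; positivity

lemma continuousOn_tangentialFraction (h : IsMinimalInBall k M b R ρ) :
    ContinuousOn (tangentialFraction M b R) (M \ {refl b R 0}) :=
  (((h.continuousOn_tangential (by fun_prop)).norm.pow 2).mono sdiff_subset).div (by fun_prop)
    fun x hx => by have := norm_sub_pos hx; positivity

lemma inter_ae_eq_sdiff (h : IsMinimalInBall k M b R ρ) (r : ℝ) :
    (M ∩ ballImage b R r : Set _) =ᵐ[μHE[k]] ((M ∩ ballImage b R r) \ {refl b R 0} : Set _) :=
  (sdiff_null_ae_eq_self (euclideanHausdorffMeasure_singleton h.one_le _)).symm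

lemma integrableOn_of_continuousOn_of_bounded (h : IsMinimalInBall k M b R ρ) (hr : 0 < r)
    (hrρ : r < ρ) {g : EuclideanSpace ℝ (Fin n) → ℝ} (hg : ContinuousOn g (M \ {refl b R 0}))
    {C : ℝ} (hC : ∀ x ∈ M \ {refl b R 0}, ‖g x‖ ≤ C) :
    IntegrableOn g (M ∩ ballImage b R r) μHE[k] := by
  have hm := (h.measurableSet_inter_ballImage hr (hrρ.trans h.lt_norm)).diff
    (measurableSet_singleton (refl b R 0))
  have hsub : (M ∩ ballImage b R r) \ {refl b R 0} ⊆ M \ {refl b R 0} :=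
    sdiff_subset_sdiff_left inter_subset_left
  rw [integrableOn_congr_set_ae (h.inter_ae_eq_sdiff r)]
  have : IsFiniteMeasure (μHE[k].restrict ((M ∩ ballImage b R r) \ {refl b R 0})) :=
    ⟨by simpa using (measure_mono sdiff_subset).trans_lt (h.measure_inter_ballImage_lt_top hr hrρ)⟩
  exact Integrable.of_bound ((hg.mono hsub).aestronglyMeasurable hm) C
    ((ae_restrict_iff' hm).2 (Eventually.of_forall fun x hx => hC x (hsub hx)))

lemma integrableOn_normalFraction (h : IsMinimalInBall k M b R ρ) (hr : 0 < r) (hrρ : r < ρ) :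
    IntegrableOn (normalFraction M b R) (M ∩ ballImage b R r) μHE[k] :=
  h.integrableOn_of_continuousOn_of_bounded hr hrρ h.continuousOn_normalFraction (C := 1)
    fun x hx => by
      rw [Real.norm_of_nonneg normalFraction_nonneg, ← tangentialFraction_add_normalFraction hx.2]
      exact le_add_of_nonneg_left tangentialFraction_nonneg

lemma integrableOn_tangentialFraction (h : IsMinimalInBall k M b R ρ) (hr : 0 < r) (hrρ : r < ρ) :
    IntegrableOn (tangentialFraction M b R) (M ∩ ballImage b R r) μHE[k] :=
  h.integrableOn_of_continuousOn_of_bounded hr hrρ h.continuousOn_tangentialFraction (C := 1)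
    fun x hx => by
      rw [Real.norm_of_nonneg tangentialFraction_nonneg,
        ← tangentialFraction_add_normalFraction hx.2]
      exact le_add_of_nonneg_right normalFraction_nonneg

/-- The function `N(r) = ∫_{M ∩ σ(B_r)} |(x-a)^⊥|²/|x-a|²`. -/
noncomputable def normalMass (k : ℕ) (M : Set (EuclideanSpace ℝ (Fin n)))
    (b : EuclideanSpace ℝ (Fin n)) (R r : ℝ) : ℝ :=
  ∫ x in M ∩ ballImage b R r, normalFraction M b R x ∂μHE[k]

/-- Pythagoras for x-a, integrated; it holds off the null set {a}. -/
lemma weightedRatio_eq (h : IsMinimalInBall k M b R ρ) (hr : 0 < r) (hrρ : r < ρ) :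
    weightedRatio k M b R r = volRatio k M b R r - ratioWeight k b r * normalMass k M b R r := by
  have hm := (h.measurableSet_inter_ballImage hr (hrρ.trans h.lt_norm)).diff
    (measurableSet_singleton (refl b R 0))
  have h1 : ∫ x in M ∩ ballImage b R r, tangentialFraction M b R x ∂μHE[k] +
      normalMass k M b R r = (μHE[k] (M ∩ ballImage b R r)).toReal := by
    rw [normalMass, ← integral_add (h.integrableOn_tangentialFraction hr hrρ)
      (h.integrableOn_normalFraction hr hrρ), setIntegral_congr_set (h.inter_ae_eq_sdiff r),
      setIntegral_congr_fun hm fun x hx => tangentialFraction_add_normalFraction hx.2,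
      setIntegral_const, smul_eq_mul, mul_one, measureReal_def,
      ← measure_congr (h.inter_ae_eq_sdiff r)]
  rw [volRatio, ← h1]
  change ratioWeight k b r * ∫ x in M ∩ ballImage b R r, tangentialFraction M b R x ∂μHE[k] =
    ratioWeight k b r * _ - _
  ring

/-- The monotonicity formula for the volume. -/
lemma volRatio_sub (h : IsMinimalInBall k M b R ρ) (hr : 0 < r) (hrq : r < q) (hqρ : q < ρ) :
    volRatio k M b R q - volRatio k M b R r =
      R ^ k * ∫ x in M ∩ (ballImage b R q \ ballImage b R r),
        levelFun b R x ^ (-((k : ℝ) / 2)) * volDefect M b R x ∂μHE[k] := by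
  have hqb := hqρ.trans h.lt_norm
  rw [h.integral_volDefect hr hrq hqρ]
  change ratioWeight k b q * _ - ratioWeight k b r * _ = _
  rw [← ratioWeight_eq h.R_pos (hr.trans hrq) hqb, ← ratioWeight_eq h.R_pos hr (hrq.trans hqb)]
  ring

lemma setOf_norm_refl_lt (hR : 0 < R) (t : ℝ) : {x | ‖refl b R x‖ < t} = ballImage b R t :=
  Set.ext fun _ => (mem_ballImage_iff hR).symm

lemma measurableSet_norm_refl_lt (b : EuclideanSpace ℝ (Fin n)) (R : ℝ) :
    MeasurableSet {z : ℝ × EuclideanSpace ℝ (Fin n) | ‖refl b R z.2‖ < z.1} :=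
  measurableSet_lt ((measurable_refl b R).comp measurable_snd).norm measurable_fst

lemma isFiniteMeasure_restrict (h : IsMinimalInBall k M b R ρ) (hq : 0 < q) (hqρ : q < ρ) :
    IsFiniteMeasure (μHE[k].restrict (M ∩ ballImage b R q)) :=
  ⟨by simpa using h.measure_inter_ballImage_lt_top hq hqρ⟩

/-- The integrand for Fubini: the indicator of |σ(x)| < t encodes the growing domain σ(B_t) on the
fixed product space, where the integrand is a product of integrable functions cut off by a
measurable set. -/
lemma integrable_prod_indicator (h : IsMinimalInBall k M b R ρ) (hr : 0 < r)
    (hrq : r < q) (hqρ : q < ρ) :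
    Integrable ({z : ℝ × EuclideanSpace ℝ (Fin n) | ‖refl b R z.2‖ < z.1}.indicator
      fun z => ratioWeightDeriv k b z.1 * normalFraction M b R z.2)
      ((volume.restrict (Ioc r q)).prod (μHE[k].restrict (M ∩ ballImage b R q))) := by
  have := h.isFiniteMeasure_restrict (hr.trans hrq) hqρ
  refine Integrable.indicator (Integrable.mul_prod ?_
    (h.integrableOn_normalFraction (hr.trans hrq) hqρ)) (measurableSet_norm_refl_lt b R)
  exact ((continuousOn_ratioWeightDeriv hr (hqρ.trans h.lt_norm)).integrableOn_Icc).mono_set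
    Ioc_subset_Icc_self

lemma integral_indicator_left (hR : 0 < R) (hq : q < ‖b‖) (hr : 0 < r) {t : ℝ} (ht : t ∈ Ioc r q)
    (hb : b ≠ 0) :
    ∫ x in M ∩ ballImage b R q, ({z : ℝ × EuclideanSpace ℝ (Fin n) |
      ‖refl b R z.2‖ < z.1}.indicator
      fun z => ratioWeightDeriv k b z.1 * normalFraction M b R z.2) (t, x) ∂μHE[k] =
      ratioWeightDeriv k b t * normalMass k M b R t := by
  have e : ∀ x, ({z : ℝ × EuclideanSpace ℝ (Fin n) | ‖refl b R z.2‖ < z.1}.indicator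
      fun z => ratioWeightDeriv k b z.1 * normalFraction M b R z.2) (t, x) =
      (ballImage b R t).indicator
        (fun x => ratioWeightDeriv k b t * normalFraction M b R x) x := by
    intro x
    rw [← setOf_norm_refl_lt hR]
    rfl
  have hm := (isOpen_ballImage hb hR (hr.trans ht.1) (ht.2.trans_lt hq)).measurableSet
  simp_rw [e]
  rw [setIntegral_indicator hm, integral_const_mul, normalMass, inter_assoc,
    inter_eq_self_of_subset_right (ballImage_mono b ht.2)]

lemma intervalIntegrable_normalMass (h : IsMinimalInBall k M b R ρ) (hr : 0 < r)
    (hrq : r < q) (hqρ : q < ρ) :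
    IntervalIntegrable (fun t => ratioWeightDeriv k b t * normalMass k M b R t) volume r q := by
  have := h.isFiniteMeasure_restrict (hr.trans hrq) hqρ
  rw [intervalIntegrable_iff_integrableOn_Ioc_of_le hrq.le]
  refine IntegrableOn.congr_fun (h.integrable_prod_indicator hr hrq hqρ).integral_prod_left
    (fun t ht => ?_) measurableSet_Ioc
  exact integral_indicator_left h.R_pos (hqρ.trans h.lt_norm) hr ht h.ne_zero

lemma integrableOn_annulus_normalFraction (h : IsMinimalInBall k M b R ρ) (hr : 0 < r)
    (hrq : r < q) (hqρ : q < ρ) :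
    IntegrableOn (fun x => levelFun b R x ^ (-((k : ℝ) / 2)) * normalFraction M b R x)
      (M ∩ (ballImage b R q \ ballImage b R r)) μHE[k] :=
  h.integrableOn_annulus hr hrq hqρ
    ((h.continuousOn_rpow_levelFun _).mul h.continuousOn_normalFraction)

lemma measurableSet_annulus (h : IsMinimalInBall k M b R ρ) (hr : 0 < r) (hrq : r < q)
    (hqρ : q < ρ) : MeasurableSet (M ∩ (ballImage b R q \ ballImage b R r)) :=
  h.measurableSet.inter
    ((isOpen_ballImage h.ne_zero h.R_pos (hr.trans hrq) (hqρ.trans h.lt_norm)).measurableSet.diff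
    (isOpen_ballImage h.ne_zero h.R_pos hr (hrq.trans (hqρ.trans h.lt_norm))).measurableSet)

/-- Integration by parts for w and N without differentiating N. After exchanging integrals, the
radii from max(r, |σ(x)|) to q contribute w(max(r, |σ(x)|)) - w(q). This is w(r) - w(q) inside
σ(B_r), while on the annulus w(|σ(x)|) = R^k f^{-k/2}. -/
lemma integral_normalMass (h : IsMinimalInBall k M b R ρ) (hr : 0 < r)
    (hrq : r < q) (hqρ : q < ρ) :
    k * ‖b‖ ^ 2 * ∫ t in r..q, ratioWeightDeriv k b t * normalMass k M b R t =
      ratioWeight k b r * normalMass k M b R r - ratioWeight k b q * normalMass k M b R q +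
      R ^ k * ∫ x in M ∩ (ballImage b R q \ ballImage b R r),
        levelFun b R x ^ (-((k : ℝ) / 2)) * normalFraction M b R x ∂μHE[k] := by
  have hq := hr.trans hrq
  have hqb := hqρ.trans h.lt_norm
  have hrb := hrq.trans hqb
  have := h.isFiniteMeasure_restrict hq hqρ
  have hint := h.integrable_prod_indicator hr hrq hqρ
  have hmr := (isOpen_ballImage h.ne_zero h.R_pos hr hrb).measurableSet
  have hmq := (isOpen_ballImage h.ne_zero h.R_pos hq hqb).measurableSet
  have hMq := h.measurableSet_inter_ballImage hq hqb
  set G : ℝ → EuclideanSpace ℝ (Fin n) → ℝ := fun t x =>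
    ({z : ℝ × EuclideanSpace ℝ (Fin n) | ‖refl b R z.2‖ < z.1}.indicator
      fun z => ratioWeightDeriv k b z.1 * normalFraction M b R z.2) (t, x) with hG
  have hleft : ∫ t in r..q, ratioWeightDeriv k b t * normalMass k M b R t =
      ∫ t in Ioc r q, ∫ x in M ∩ ballImage b R q, G t x ∂μHE[k] := by
    rw [intervalIntegral.integral_of_le hrq.le]
    exact setIntegral_congr_fun measurableSet_Ioc fun t ht =>
      (integral_indicator_left h.R_pos hqb hr ht h.ne_zero).symm
  have hinner : ∀ x ∈ M ∩ ballImage b R q, k * ‖b‖ ^ 2 * ∫ t in Ioc r q, G t x =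
      (ratioWeight k b (max r ‖refl b R x‖) - ratioWeight k b q) * normalFraction M b R x := by
    intro x hx
    rw [← setIntegral_indicator_ratioWeightDeriv hr hrq.le ((mem_ballImage_iff h.R_pos).1 hx.2).le
      hqb, mul_assoc, mul_assoc, mul_assoc, ← integral_mul_const]
    congr 3
    ext t
    by_cases ht : ‖refl b R x‖ < t
    · rw [indicator_of_mem (show t ∈ Ioi ‖refl b R x‖ from ht), hG]
      exact indicator_of_mem (show (t, x) ∈ {z : ℝ × EuclideanSpace ℝ (Fin n) |
        ‖refl b R z.2‖ < z.1} from ht) _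
    · rw [indicator_of_notMem (show t ∉ Ioi ‖refl b R x‖ from ht), hG, zero_mul]
      exact indicator_of_notMem (show (t, x) ∉ {z : ℝ × EuclideanSpace ℝ (Fin n) |
        ‖refl b R z.2‖ < z.1} from ht) _
  have hswap : k * ‖b‖ ^ 2 * ∫ t in r..q, ratioWeightDeriv k b t * normalMass k M b R t =
      ∫ x in M ∩ ballImage b R q, (ratioWeight k b (max r ‖refl b R x‖) - ratioWeight k b q) *
        normalFraction M b R x ∂μHE[k] := by
    rw [hleft, integral_integral_swap (f := G) hint, ← integral_const_mul]
    exact setIntegral_congr_fun hMq hinner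
  have hi : IntegrableOn (fun x => (ratioWeight k b (max r ‖refl b R x‖) - ratioWeight k b q) *
        normalFraction M b R x) (M ∩ ballImage b R q) μHE[k] := by
    refine IntegrableOn.congr_fun (hint.integral_prod_right.const_mul (k * ‖b‖ ^ 2))
      hinner hMq
  have hann : (M ∩ ballImage b R q) \ ballImage b R r =
      M ∩ (ballImage b R q \ ballImage b R r) := inter_sdiff_assoc _ _ _
  have hinr : M ∩ ballImage b R q ∩ ballImage b R r = M ∩ ballImage b R r := by
    rw [inter_assoc, inter_eq_self_of_subset_right (ballImage_mono b hrq.le)]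
  have hν := h.integrableOn_normalFraction hq hqρ
  have hsplit := integral_inter_add_sdiff hmr hi
  have hsplitν := integral_inter_add_sdiff hmr hν
  rw [hann, hinr] at hsplit hsplitν
  have e1 : ∫ x in M ∩ ballImage b R r, (ratioWeight k b (max r ‖refl b R x‖) -
      ratioWeight k b q) * normalFraction M b R x ∂μHE[k] =
      (ratioWeight k b r - ratioWeight k b q) * normalMass k M b R r := by
    rw [normalMass, ← integral_const_mul]
    refine setIntegral_congr_fun (h.measurableSet.inter hmr) fun x hx => ?_
    rw [max_eq_left ((mem_ballImage_iff h.R_pos).1 hx.2).le]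
  have hf := h.integrableOn_annulus_normalFraction hr hrq hqρ
  have e2 : ∫ x in M ∩ (ballImage b R q \ ballImage b R r), (ratioWeight k b (max r ‖refl b R x‖) -
      ratioWeight k b q) * normalFraction M b R x ∂μHE[k] =
      R ^ k * (∫ x in M ∩ (ballImage b R q \ ballImage b R r),
        levelFun b R x ^ (-((k : ℝ) / 2)) * normalFraction M b R x ∂μHE[k]) -
      ratioWeight k b q * ∫ x in M ∩ (ballImage b R q \ ballImage b R r),
        normalFraction M b R x ∂μHE[k] := by
    rw [← integral_const_mul, ← integral_const_mul, ← integral_sub (hf.const_mul _)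
      ((h.integrableOn_annulus hr hrq hqρ h.continuousOn_normalFraction).const_mul _)]
    refine setIntegral_congr_fun (h.measurableSet.inter (hmq.diff hmr)) fun x hx => ?_
    have hxa : x ≠ refl b R 0 := by
      rintro rfl; exact hx.2.2 (refl_zero_mem_ballImage b R hr)
    rw [max_eq_right (not_lt.1 fun hlt => hx.2.2 ((mem_ballImage_iff h.R_pos).2 hlt)),
      ratioWeight_norm_refl h.R_pos (h.mem_halfSpace hx.1) hxa]
    ring
  rw [hswap, ← hsplit, e1, e2]
  have : normalMass k M b R q = normalMass k M b R r +
      ∫ x in M ∩ (ballImage b R q \ ballImage b R r), normalFraction M b R x ∂μHE[k] :=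
    hsplitν.symm
  rw [this]
  ring

/-- The density `|b^⊤|²/(|b|⁴|x-a|²)`. -/
noncomputable def axisDefect (M : Set (EuclideanSpace ℝ (Fin n)))
    (b : EuclideanSpace ℝ (Fin n)) (R : ℝ) (x : EuclideanSpace ℝ (Fin n)) : ℝ :=
  ‖tangential M x b‖ ^ 2 / (‖b‖ ^ 4 * ‖x - refl b R 0‖ ^ 2)

lemma axisDefect_nonneg : 0 ≤ axisDefect M b R x := by unfold axisDefect; positivity

lemma volDefect_nonneg : 0 ≤ volDefect M b R x := by unfold volDefect; positivity

lemma volDefect_eq (h : IsMinimalInBall k M b R ρ) :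
    volDefect M b R x = normalFraction M b R x + levelFun b R x ^ 2 * axisDefect M b R x := by
  have hb := norm_pos_iff.2 h.ne_zero
  rw [volDefect, normalFraction, axisDefect, add_div, mul_div_mul_left _ _ (by positivity),
    mul_div_assoc]

lemma continuousOn_axisDefect (h : IsMinimalInBall k M b R ρ) :
    ContinuousOn (axisDefect M b R) (M \ {refl b R 0}) := by
  have hb := norm_pos_iff.2 h.ne_zero
  exact (((h.continuousOn_tangential continuous_const).norm.pow 2).mono sdiff_subset).div
    (by fun_prop) fun x hx => by have := norm_sub_pos hx; positivity

lemma integrableOn_axisDefect (h : IsMinimalInBall k M b R ρ) (hr : 0 < r) (hrq : r < q)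
    (hqρ : q < ρ) :
    IntegrableOn (fun x => levelFun b R x ^ (-(((k : ℝ) - 4) / 2)) * axisDefect M b R x)
      (M ∩ (ballImage b R q \ ballImage b R r)) μHE[k] :=
  h.integrableOn_annulus hr hrq hqρ
    ((h.continuousOn_rpow_levelFun _).mul h.continuousOn_axisDefect)

/-- The monotonicity formula for the weighted volume. -/
lemma weightedRatio_sub (h : IsMinimalInBall k M b R ρ) (hr : 0 < r) (hrq : r < q) (hqρ : q < ρ) :
    weightedRatio k M b R q - weightedRatio k M b R r =
      R ^ k * (∫ x in M ∩ (ballImage b R q \ ballImage b R r),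
        levelFun b R x ^ (-(((k : ℝ) - 4) / 2)) * axisDefect M b R x ∂μHE[k]) +
      k * ‖b‖ ^ 2 * ∫ t in r..q, ratioWeightDeriv k b t * normalMass k M b R t := by
  have hqb := hqρ.trans h.lt_norm
  have hf := h.integrableOn_annulus_normalFraction hr hrq hqρ
  have hm := h.measurableSet_annulus hr hrq hqρ
  have e : ∫ x in M ∩ (ballImage b R q \ ballImage b R r),
        levelFun b R x ^ (-((k : ℝ) / 2)) * volDefect M b R x ∂μHE[k] =
      (∫ x in M ∩ (ballImage b R q \ ballImage b R r),
        levelFun b R x ^ (-((k : ℝ) / 2)) * normalFraction M b R x ∂μHE[k]) +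
      ∫ x in M ∩ (ballImage b R q \ ballImage b R r),
        levelFun b R x ^ (-(((k : ℝ) - 4) / 2)) * axisDefect M b R x ∂μHE[k] := by
    rw [← integral_add hf (h.integrableOn_axisDefect hr hrq hqρ)]
    refine setIntegral_congr_fun hm fun x hx => ?_
    have hxa : x ≠ refl b R 0 := by
      rintro rfl; exact hx.2.2 (refl_zero_mem_ballImage b R hr)
    have hpos : 0 < levelFun b R x := h.levelFun_pos' ⟨hx.1, hxa⟩
    -- The exponent -(k-4)/2 comes from absorbing the factor f² of the axis term into f^{-k/2}.
    rw [h.volDefect_eq, show -(((k : ℝ) - 4) / 2) = -((k : ℝ) / 2) + (2 : ℕ) by push_cast; ring,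
      Real.rpow_add_natCast hpos.ne']
    ring
  -- The boundary values of wN on the left match those in `integral_normalMass`, whose annulus
  -- integral is the normal half of the formula for J.
  rw [h.weightedRatio_eq (hr.trans hrq) hqρ, h.weightedRatio_eq hr (hrq.trans hqρ),
    h.integral_normalMass hr hrq hqρ]
  have hv := h.volRatio_sub hr hrq hqρ
  rw [e] at hv
  linear_combination hv

lemma volRatio_monotoneOn (h : IsMinimalInBall k M b R ρ) :
    MonotoneOn (volRatio k M b R) (Ioo 0 ρ) := by
  intro r hr q hq hrq
  rcases hrq.eq_or_lt with rfl | hrq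
  · exact le_rfl
  rw [← sub_nonneg, h.volRatio_sub hr.1 hrq hq.2]
  refine mul_nonneg (pow_nonneg h.R_pos.le _)
    (setIntegral_nonneg (h.measurableSet_annulus hr.1 hrq hq.2) fun x hx => ?_)
  exact mul_nonneg (Real.rpow_nonneg (levelFun_nonneg h.R_pos (h.mem_halfSpace hx.1)) _)
    volDefect_nonneg

lemma integral_axisDefect_nonneg (h : IsMinimalInBall k M b R ρ) (hr : 0 < r) (hrq : r < q)
    (hqρ : q < ρ) :
    0 ≤ ∫ x in M ∩ (ballImage b R q \ ballImage b R r),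
        levelFun b R x ^ (-(((k : ℝ) - 4) / 2)) * axisDefect M b R x ∂μHE[k] :=
  setIntegral_nonneg (h.measurableSet_annulus hr hrq hqρ) fun _ hx =>
    mul_nonneg (Real.rpow_nonneg (levelFun_nonneg h.R_pos (h.mem_halfSpace hx.1)) _)
      axisDefect_nonneg

lemma normalMass_nonneg : 0 ≤ normalMass k M b R r :=
  integral_nonneg fun _ => normalFraction_nonneg

lemma integral_normalMass_nonneg (h : IsMinimalInBall k M b R ρ) (hr : 0 < r) (hrq : r < q)
    (hqρ : q < ρ) : 0 ≤ ∫ t in r..q, ratioWeightDeriv k b t * normalMass k M b R t :=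
  intervalIntegral.integral_nonneg hrq.le fun _ ht => mul_nonneg
    (ratioWeightDeriv_pos (hr.trans_le ht.1) ((ht.2.trans_lt hqρ).trans h.lt_norm)).le
    normalMass_nonneg

lemma weightedRatio_monotoneOn (h : IsMinimalInBall k M b R ρ) :
    MonotoneOn (weightedRatio k M b R) (Ioo 0 ρ) := by
  intro r hr q hq hrq
  rcases hrq.eq_or_lt with rfl | hrq
  · exact le_rfl
  rw [← sub_nonneg, h.weightedRatio_sub hr.1 hrq hq.2]
  exact add_nonneg (mul_nonneg (pow_nonneg h.R_pos.le _)
    (h.integral_axisDefect_nonneg hr.1 hrq hq.2))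
    (mul_nonneg (by positivity) (h.integral_normalMass_nonneg hr.1 hrq hq.2))

end IsMinimalInBall

end MinimalMonotonicity

namespace MinimalMonotonicity

/-! ### Submanifolds with tangential position vector. -/

section Cone

open Filter Topology

variable {n k : ℕ} {M U : Set (EuclideanSpace ℝ (Fin n))} {a x z : EuclideanSpace ℝ (Fin n)}

/-- If the position vector relative to `a` is tangent to a submanifold, then the submanifold
contains a piece of each ray from `a` that meets it. -/
lemma IsSubmanifold.eventually_ray_mem (hM : IsSubmanifold k M)
    (ht : ∀ x ∈ M, x - a ∈ tangentSpace M x) (hx : x ∈ M) :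
    ∀ᶠ s : ℝ in 𝓝 1, a + s • (x - a) ∈ M := by
  obtain ⟨V, F, h, v, hv, rfl⟩ := hM x hx
  -- The coordinates of the tangent field x-a in the chart. Along an integral curve α, F∘α - a
  -- solves y' = y and equals e^t(F v - a); putting t = log s gives the ray.
  let ξ : EuclideanSpace ℝ (Fin k) → EuclideanSpace ℝ (Fin k) := fun w =>
    ∑ i, ∑ j, (gramInv F i j w * inner ℝ (F w - a) (partialD F i w)) •
      EuclideanSpace.single j (1 : ℝ)
  have hξ : ContDiffOn ℝ ∞ ξ V := by
    refine ContDiffOn.sum fun i _ => ContDiffOn.sum fun j _ => ?_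
    exact ((h.contDiffOn_gramInv i j).mul ((h.contDiffOn.sub contDiffOn_const).inner ℝ
      (h.contDiffOn_partialD i))).smul contDiffOn_const
  have hDξ : ∀ w ∈ V, fderiv ℝ F w (ξ w) = F w - a := by
    intro w hw
    have h1 := ht _ (h.mem hw)
    rw [h.tangentSpace_eq hw, ← Submodule.starProjection_eq_self_iff,
      starProjection_range_eq (h.injective_fderiv w hw)] at h1
    conv_rhs => rw [← h1]
    simp only [ξ, map_sum, map_smul]
    rfl
  obtain ⟨α, hα0, ε, hε, hα⟩ :=
    ((hξ.contDiffAt (h.isOpen_domain.mem_nhds hv)).of_le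
      (WithTop.coe_le_coe.2 le_top)).exists_forall_mem_closedBall_exists_eq_forall_mem_Ioo_hasDerivAt₀ 0
  have hα' : ∀ᶠ t in 𝓝 (0 : ℝ), HasDerivAt α (ξ (α t)) t := by
    filter_upwards [Ioo_mem_nhds (show 0 - ε < 0 by linarith) (show (0 : ℝ) < 0 + ε by linarith)]
      with t ht using hα t ht
  have hαV : ∀ᶠ t in 𝓝 (0 : ℝ), α t ∈ V :=
    hα'.self_of_nhds.continuousAt.eventually (hα0 ▸ h.isOpen_domain.mem_nhds hv)
  have heq : (fun t => F (α t) - a) =ᶠ[𝓝 0] fun t => Real.exp t • (F v - a) := by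
    refine ODE_solution_unique_of_eventually (v := fun _ y => y) (s := fun _ => univ) (K := 1)
      (Eventually.of_forall fun _ => LipschitzWith.id.lipschitzOnWith) ?_
      (Eventually.of_forall fun t => ⟨(Real.hasDerivAt_exp t).smul_const _, trivial⟩) ?_
    · filter_upwards [hα', hαV] with t h1 h2
      refine ⟨?_, trivial⟩
      have := ((h.hasFDerivAt h2).comp_hasDerivAt t h1).sub_const a
      rw [hDξ _ h2] at this
      exact this
    · simp [hα0]
  have hlog : Tendsto Real.log (𝓝 1) (𝓝 0) := by
    have := Real.continuousAt_log (x := 1) one_ne_zero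
    rwa [ContinuousAt, Real.log_one] at this
  filter_upwards [hlog.eventually heq, hlog.eventually hαV, Ioi_mem_nhds zero_lt_one]
    with s h1 h2 h3
  rw [Real.exp_log h3] at h1
  rw [← h1, add_sub_cancel]
  exact h.mem h2

/-- A submanifold relatively closed in a convex open set contains the rays from `a` within this
set if the position vector relative to `a` is tangent to it. -/
lemma IsSubmanifold.ray_mem (hM : IsSubmanifold k M) (hU : Convex ℝ U)
    (hcl : closure M ∩ U ⊆ M) (hMU : M ⊆ U) (ht : ∀ x ∈ M, x - a ∈ tangentSpace M x) (hx : x ∈ M)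
    {s : ℝ} (hs : 0 < s) (hsU : a + s • (x - a) ∈ U) : a + s • (x - a) ∈ M := by
  have hc : Continuous fun s : ℝ => a + s • (x - a) := by fun_prop
  -- By convexity of U the admissible parameters form a connected set, and those whose point lies in
  -- M form an open set that is relatively closed in it.
  let I : Set ℝ := Ioi 0 ∩ (fun s : ℝ => a + s • (x - a)) ⁻¹' U
  let u : Set ℝ := Ioi 0 ∩ (fun s : ℝ => a + s • (x - a)) ⁻¹' M
  have hI : Convex ℝ I := by
    refine (convex_Ioi 0).inter ?_
    intro s₁ h₁ s₂ h₂ c₁ c₂ hc₁ hc₂ hc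
    have := hU h₁ h₂ hc₁ hc₂ hc
    change a + (c₁ • s₁ + c₂ • s₂) • (x - a) ∈ U
    convert this using 1
    rw [smul_add, smul_add, add_add_add_comm, ← add_smul, hc, one_smul, add_smul, smul_assoc,
      smul_assoc]
  have hu : IsOpen u := by
    rw [isOpen_iff_mem_nhds]
    rintro s₀ ⟨hs₀, hsM⟩
    have hs₀ : (0 : ℝ) < s₀ := hs₀
    have h1 := hM.eventually_ray_mem ht hsM
    have h2 : Tendsto (fun s : ℝ => s / s₀) (𝓝 s₀) (𝓝 1) := by
      have : Tendsto (fun s : ℝ => s / s₀) (𝓝 s₀) (𝓝 (s₀ / s₀)) :=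
        (continuous_id.div_const s₀).tendsto s₀
      rwa [div_self hs₀.ne'] at this
    filter_upwards [h2.eventually h1, Ioi_mem_nhds hs₀] with s h3 h4
    refine ⟨h4, ?_⟩
    rwa [add_sub_cancel_left, smul_smul, div_mul_cancel₀ _ hs₀.ne'] at h3
  have h1u : (I ∩ u).Nonempty := by
    refine ⟨1, ⟨mem_Ioi.2 zero_lt_one, ?_⟩, ⟨mem_Ioi.2 zero_lt_one, ?_⟩⟩
    · change a + (1 : ℝ) • (x - a) ∈ U
      rw [one_smul, add_sub_cancel]; exact hMU hx
    · change a + (1 : ℝ) • (x - a) ∈ M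
      rwa [one_smul, add_sub_cancel]
  have hclu : closure u ∩ I ⊆ u := by
    rintro s ⟨hsu, hsI⟩
    refine ⟨hsI.1, hcl ⟨?_, hsI.2⟩⟩
    exact map_mem_closure (f := fun s : ℝ => a + s • (x - a)) hc hsu fun t ht => ht.2
  exact (hI.isPreconnected.subset_of_closure_inter_subset hu h1u hclu ⟨hs, hsU⟩).2

/-- A submanifold with tangential position vector, relatively closed in a convex open set around
the origin `a`, is a piece of an affine subspace. -/
lemma IsSubmanifold.eq_of_forall_sub_mem_tangentSpace (hM : IsSubmanifold k M) (hU : Convex ℝ U)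
    (hcl : closure M ∩ U ⊆ M) (hMU : M ⊆ U) (ht : ∀ x ∈ M, x - a ∈ tangentSpace M x)
    (haU : a ∈ U) (hne : M.Nonempty) :
    a ∈ M ∧ M = {x | x - a ∈ tangentSpace M a} ∩ U := by
  have hseg : ∀ x ∈ M, ∀ s : ℝ, 0 < s → s ≤ 1 → a + s • (x - a) ∈ M := fun x hx s hs hs1 =>
    hM.ray_mem hU hcl hMU ht hx hs (hU.add_smul_sub_mem haU (hMU hx) ⟨hs.le, hs1⟩)
  -- The ray from a through a point of M stays in M down to a, and M is relatively closed in U.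
  have haM : a ∈ M := by
    obtain ⟨x, hx⟩ := hne
    refine hcl ⟨?_, haU⟩
    have hlim : Tendsto (fun s : ℝ => a + s • (x - a)) (𝓝[>] 0) (𝓝 a) := by
      have : Continuous fun s : ℝ => a + s • (x - a) := by fun_prop
      have := (this.tendsto 0).mono_left (nhdsWithin_le_nhds (s := Ioi 0))
      simpa using this
    refine mem_closure_of_tendsto hlim ?_
    filter_upwards [Ioc_mem_nhdsGT (zero_lt_one' ℝ)] with s hs
    exact hseg x hx s hs.1 hs.2
  refine ⟨haM, Subset.antisymm (fun x hx => ⟨?_, hMU hx⟩) ?_⟩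
  · refine Submodule.subset_span (mem_tangentConeAt_of_segment_subset ?_)
    rw [segment_eq_image']
    rintro _ ⟨s, hs, rfl⟩
    rcases hs.1.eq_or_lt with rfl | hs0
    · simpa using haM
    · exact hseg x hx s hs0 hs.2
  · rintro x ⟨hxT, hxU⟩
    obtain ⟨V, F, h, v, hv, hva⟩ := hM a haM
    set T := tangentSpace M a
    have hT : T = (fderiv ℝ F v).range := by rw [← h.tangentSpace_eq hv, hva]
    have hsub : ∀ w ∈ V, F w - a ∈ T := fun w hw => by
      refine Submodule.subset_span (mem_tangentConeAt_of_segment_subset ?_)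
      rw [segment_eq_image']
      rintro _ ⟨s, hs, rfl⟩
      rcases hs.1.eq_or_lt with rfl | hs0
      · simpa using haM
      · exact hseg _ (h.mem hw) s hs0 hs.2
    -- The chart takes values in a + T, and G has surjective derivative at v, so M contains a
    -- neighbourhood of a in a + T. Every x in (a + T) ∩ U is then reached along the ray through a
    -- point of M close to a.
    let G : EuclideanSpace ℝ (Fin k) → T := fun w => T.orthogonalProjectionOnto (F w - a)
    have hG : HasStrictFDerivAt G (T.orthogonalProjectionOnto ∘L fderiv ℝ F v) v :=
      T.orthogonalProjectionOnto.hasStrictFDerivAt.comp v ((h.hasStrictFDerivAt hv).sub_const a)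
    have hsurj : (T.orthogonalProjectionOnto ∘L fderiv ℝ F v).range = ⊤ := by
      rw [LinearMap.range_eq_top]
      rintro ⟨y, hy⟩
      obtain ⟨w, rfl⟩ : y ∈ (fderiv ℝ F v).range := hT ▸ hy
      exact ⟨w, Submodule.orthogonalProjectionOnto_mem_subspace_eq_self (⟨_, hy⟩ : T)⟩
    have hmap := hG.map_nhds_eq_of_surj hsurj
    have hG0 : G v = 0 := by simp [G, hva]
    have hV : ∀ᶠ y : T in 𝓝 0, ∃ w ∈ V, G w = y := by
      rw [← hG0, ← hmap]
      exact image_mem_map (h.isOpen_domain.mem_nhds hv)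
    have hray : Tendsto (fun s : ℝ => s • (⟨x - a, hxT⟩ : T)) (𝓝[>] 0) (𝓝 0) := by
      have : Continuous fun s : ℝ => s • (⟨x - a, hxT⟩ : T) := by fun_prop
      have := (this.tendsto 0).mono_left (nhdsWithin_le_nhds (s := Ioi 0))
      simpa using this
    obtain ⟨s, ⟨w, hw, hGw⟩, hs⟩ := ((hray.eventually hV).and self_mem_nhdsWithin).exists
    have hs : (0 : ℝ) < s := hs
    have hFw : F w = a + s • (x - a) := by
      have h1 : T.orthogonalProjectionOnto (F w - a) = (⟨F w - a, hsub w hw⟩ : T) :=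
        Submodule.orthogonalProjectionOnto_mem_subspace_eq_self (⟨_, hsub w hw⟩ : T)
      have h2 := congrArg Subtype.val (h1.symm.trans hGw)
      rw [← sub_eq_iff_eq_add']
      exact h2
    have hxeq : a + s⁻¹ • (F w - a) = x := by
      rw [hFw, add_sub_cancel_left, smul_smul, inv_mul_cancel₀ hs.ne', one_smul, add_sub_cancel]
    rw [← hxeq]
    exact hM.ray_mem hU hcl hMU ht (h.mem hw) (inv_pos.2 hs) (hxeq.symm ▸ hxU)

lemma IsSubmanifold.finrank_tangentSpace (hM : IsSubmanifold k M) (hx : x ∈ M) :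
    Module.finrank ℝ (tangentSpace M x) = k := by
  obtain ⟨V, F, h, v, hv, rfl⟩ := hM x hx
  rw [h.tangentSpace_eq hv, LinearMap.finrank_range_of_inj (h.injective_fderiv v hv),
    finrank_euclideanSpace_fin]

/-- A continuous function on a submanifold vanishes if it vanishes almost everywhere. -/
lemma IsSubmanifold.eq_zero_of_measure_eq_zero (hM : IsSubmanifold k M) {E : Type*}
    [NormedAddCommGroup E] {g : EuclideanSpace ℝ (Fin n) → E} (hx : x ∈ M)
    (hg : ContinuousWithinAt g M x) {N : Set (EuclideanSpace ℝ (Fin n))} (hN : N ∈ 𝓝[M] x)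
    (h0 : μHE[k] {y ∈ N | g y ≠ 0} = 0) : g x = 0 := by
  by_contra hne
  have := hM.measure_pos_of_mem_nhdsWithin hx (inter_mem hN (hg.eventually_ne hne))
  exact this.ne' h0

end Cone

/-! ### The equality case. -/

namespace IsMinimalInBall

open Filter Topology

variable {n k : ℕ} {M : Set (EuclideanSpace ℝ (Fin n))} {b x : EuclideanSpace ℝ (Fin n)}
  {R ρ r q : ℝ}

/-- Choose radii strictly on either side of |σ(x)|. On this annulus, a neighbourhood of x in M, g
vanishes almost everywhere, hence at x by continuity, because neighbourhoods in a submanifold have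
positive measure. -/
lemma eq_zero_of_setIntegral_eq_zero (h : IsMinimalInBall k M b R ρ)
    {g : EuclideanSpace ℝ (Fin n) → ℝ} (hg : ContinuousOn g (M \ {refl b R 0}))
    (hg0 : ∀ x ∈ M, 0 ≤ g x)
    (hint : ∀ r q, 0 < r → r < q → q < ρ →
      ∫ x in M ∩ (ballImage b R q \ ballImage b R r), g x ∂μHE[k] = 0)
    (hx : x ∈ M \ {refl b R 0}) : g x = 0 := by
  have hc : 0 < ‖refl b R x‖ := norm_refl_pos h.R_pos hx.2
  have hcρ : ‖refl b R x‖ < ρ := (mem_ballImage_iff h.R_pos).1 (h.subset hx.1)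
  obtain ⟨r, hr, hrc⟩ := exists_between hc
  obtain ⟨q, hcq, hqρ⟩ := exists_between hcρ
  have hrq := hrc.trans hcq
  have hq := hr.trans hrq
  have hqb := hqρ.trans h.lt_norm
  have hrb := hrq.trans hqb
  have hnhds : M ∩ (ballImage b R q \ ballImage b R r) ∈ 𝓝[M] x := by
    refine inter_mem self_mem_nhdsWithin (mem_nhdsWithin_of_mem_nhds ?_)
    refine mem_of_superset (inter_mem
      ((isOpen_ballImage h.ne_zero h.R_pos hq hqb).mem_nhds ((mem_ballImage_iff h.R_pos).2 hcq))
      ((isCompact_closedBallImage h.ne_zero h.R_pos hr hrb).isClosed.isOpen_compl.mem_nhds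
        (show x ∉ closedBallImage b R r from not_le.2 hrc))) ?_
    exact fun y hy => ⟨hy.1, fun hyr => hy.2 (ballImage_subset_closedBallImage h.R_pos hyr)⟩
  have hm := h.measurableSet_annulus hr hrq hqρ
  have h0 := hint r q hr hrq hqρ
  rw [setIntegral_eq_zero_iff_of_nonneg_ae
    ((ae_restrict_iff' hm).2 (Eventually.of_forall fun y hy => hg0 y hy.1))
    (h.integrableOn_annulus hr hrq hqρ hg), EventuallyEq, ae_restrict_iff' hm] at h0
  have hgx : ContinuousWithinAt g M x := by
    have := hg x hx
    rwa [sdiff_eq, continuousWithinAt_inter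
      (isClosed_singleton.isOpen_compl.mem_nhds hx.2)] at this
  refine h.isSubmanifold.eq_zero_of_measure_eq_zero hx.1 hgx hnhds
    (measure_mono_null (fun y hy => ?_) h0)
  exact fun hy' => hy.2 (hy' hy.1)

/-- The conclusion of the equality case at the level of tangent spaces. -/
lemma tangential_eq_zero_of_axisDefect (h : IsMinimalInBall k M b R ρ)
    (hax : ∀ x ∈ M \ {refl b R 0}, axisDefect M b R x = 0) (hx : x ∈ M) :
    tangential M x b = 0 := by
  have hb := norm_pos_iff.2 h.ne_zero
  -- The defect carries no information at a itself, so b^⊤ = 0 is extended to a by continuity; it is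
  -- later used exactly there.
  refine h.isSubmanifold.eq_zero_of_measure_eq_zero (g := fun y => tangential M y b) hx
    (h.continuousOn_tangential continuous_const x hx) self_mem_nhdsWithin
    (measure_mono_null (fun y hy => ?_)
      (euclideanHausdorffMeasure_singleton h.one_le (refl b R 0)))
  by_contra hya
  have h1 := hax y ⟨hy.1, hya⟩
  have h2 := norm_sub_pos (x := y) (a := refl b R 0) ⟨hy.1, hya⟩
  rw [axisDefect, div_eq_zero_iff, or_iff_left (by positivity)] at h1
  exact hy.2 (norm_eq_zero.1 (pow_eq_zero_iff two_ne_zero |>.1 h1))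

lemma sub_mem_tangentSpace_of_normalFraction
    (hν : ∀ x ∈ M \ {refl b R 0}, normalFraction M b R x = 0) (hx : x ∈ M) :
    x - refl b R 0 ∈ tangentSpace M x := by
  by_cases hxa : x = refl b R 0
  · rw [hxa, sub_self]; exact zero_mem _
  have h1 := hν x ⟨hx, hxa⟩
  have h2 := norm_sub_pos (x := x) (a := refl b R 0) ⟨hx, hxa⟩
  rw [normalFraction, div_eq_zero_iff, or_iff_left (by positivity)] at h1
  have h3 : normal M x (x - refl b R 0) = 0 :=
    norm_eq_zero.1 (pow_eq_zero_iff two_ne_zero |>.1 h1)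
  rw [← tangential_add_normal M x (x - refl b R 0), h3, add_zero]
  exact Submodule.starProjection_apply_mem _ _

lemma defects_eq_zero_of_volRatio (h : IsMinimalInBall k M b R ρ) {c : ℝ}
    (hc : ∀ r ∈ Ioo 0 ρ, volRatio k M b R r = c) (hx : x ∈ M \ {refl b R 0}) :
    normalFraction M b R x = 0 ∧ axisDefect M b R x = 0 := by
  have hpos := h.levelFun_pos' hx
  have h1 := h.eq_zero_of_setIntegral_eq_zero
    (g := fun x => levelFun b R x ^ (-((k : ℝ) / 2)) * volDefect M b R x)
    ((h.continuousOn_rpow_levelFun _).mul h.continuousOn_volDefect)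
    (fun y hy => mul_nonneg (Real.rpow_nonneg (levelFun_nonneg h.R_pos (h.mem_halfSpace hy)) _)
      volDefect_nonneg)
    (fun r q hr hrq hqρ => by
      have := h.volRatio_sub hr hrq hqρ
      rw [hc r ⟨hr, hrq.trans hqρ⟩, hc q ⟨hr.trans hrq, hqρ⟩, sub_self, eq_comm] at this
      exact (mul_eq_zero.1 this).resolve_left (pow_pos h.R_pos _).ne') hx
  have h2 := (mul_eq_zero.1 h1).resolve_left (Real.rpow_pos_of_pos hpos _).ne'
  rw [h.volDefect_eq, add_eq_zero_iff_of_nonneg normalFraction_nonneg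
    (mul_nonneg (by positivity) axisDefect_nonneg)] at h2
  exact ⟨h2.1, (mul_eq_zero.1 h2.2).resolve_left (pow_pos hpos 2).ne'⟩

lemma normalMass_mono (h : IsMinimalInBall k M b R ρ) (hrq : r ≤ q) (hq : 0 < q) (hqρ : q < ρ) :
    normalMass k M b R r ≤ normalMass k M b R q :=
  setIntegral_mono_set (h.integrableOn_normalFraction hq hqρ)
    (Eventually.of_forall fun _ => normalFraction_nonneg)
    (inter_subset_inter_right _ (ballImage_mono b hrq)).eventuallyLE

/-- N is nonnegative and nondecreasing and the weight is positive, so the integral is at least N(r)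
times a positive number. -/
lemma normalMass_eq_zero_of_integral (h : IsMinimalInBall k M b R ρ) (hr : 0 < r) (hrq : r < q)
    (hqρ : q < ρ) (h0 : ∫ t in r..q, ratioWeightDeriv k b t * normalMass k M b R t = 0) :
    normalMass k M b R r = 0 := by
  have hqb := hqρ.trans h.lt_norm
  have hk : (0 : ℝ) < k := by exact_mod_cast h.one_le
  have hi : IntervalIntegrable (ratioWeightDeriv k b) volume r q := by
    refine ContinuousOn.intervalIntegrable ?_
    rw [uIcc_of_le hrq.le]
    exact continuousOn_ratioWeightDeriv hr hqb
  have h1 : (∫ t in r..q, ratioWeightDeriv k b t) * normalMass k M b R r ≤ 0 := by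
    rw [← intervalIntegral.integral_mul_const, ← h0]
    refine intervalIntegral.integral_mono_on hrq.le (hi.mul_const _)
      (h.intervalIntegrable_normalMass hr hrq hqρ) fun t ht => ?_
    exact mul_le_mul_of_nonneg_left
      (h.normalMass_mono ht.1 (hr.trans_le ht.1) (ht.2.trans_lt hqρ))
      (ratioWeightDeriv_pos (hr.trans_le ht.1) (ht.2.trans_lt hqb)).le
  have h2 : 0 < ∫ t in r..q, ratioWeightDeriv k b t :=
    intervalIntegral.intervalIntegral_pos_of_pos_on hi
      (fun t ht => ratioWeightDeriv_pos (hr.trans ht.1) (ht.2.trans hqb)) hrq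
  exact le_antisymm (nonpos_of_mul_nonpos_right h1 h2) normalMass_nonneg

lemma defects_eq_zero_of_weightedRatio (h : IsMinimalInBall k M b R ρ) {c : ℝ}
    (hc : ∀ r ∈ Ioo 0 ρ, weightedRatio k M b R r = c) (hx : x ∈ M \ {refl b R 0}) :
    normalFraction M b R x = 0 ∧ axisDefect M b R x = 0 := by
  have hb := norm_pos_iff.2 h.ne_zero
  have hk : (0 : ℝ) < k := by exact_mod_cast h.one_le
  have key : ∀ r q, 0 < r → r < q → q < ρ →
      (∫ x in M ∩ (ballImage b R q \ ballImage b R r),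
        levelFun b R x ^ (-(((k : ℝ) - 4) / 2)) * axisDefect M b R x ∂μHE[k]) = 0 ∧
      ∫ t in r..q, ratioWeightDeriv k b t * normalMass k M b R t = 0 := by
    intro r q hr hrq hqρ
    have := h.weightedRatio_sub hr hrq hqρ
    rw [hc r ⟨hr, hrq.trans hqρ⟩, hc q ⟨hr.trans hrq, hqρ⟩, sub_self, eq_comm,
      add_eq_zero_iff_of_nonneg (mul_nonneg (pow_nonneg h.R_pos.le _)
        (h.integral_axisDefect_nonneg hr hrq hqρ))
      (mul_nonneg (by positivity) (h.integral_normalMass_nonneg hr hrq hqρ))] at this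
    exact ⟨(mul_eq_zero.1 this.1).resolve_left (pow_pos h.R_pos _).ne',
      (mul_eq_zero.1 this.2).resolve_left (by positivity)⟩
  have hN : ∀ q, 0 < q → q < ρ → normalMass k M b R q = 0 := by
    intro q hq hqρ
    obtain ⟨s, hqs, hsρ⟩ := exists_between hqρ
    exact h.normalMass_eq_zero_of_integral hq hqs hsρ (key q s hq hqs hsρ).2
  constructor
  · refine h.eq_zero_of_setIntegral_eq_zero h.continuousOn_normalFraction
      (fun _ _ => normalFraction_nonneg) (fun r q hr hrq hqρ => ?_) hx
    refine le_antisymm ?_ (integral_nonneg fun _ => normalFraction_nonneg)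
    rw [← hN q (hr.trans hrq) hqρ]
    exact setIntegral_mono_set (h.integrableOn_normalFraction (hr.trans hrq) hqρ)
      (Eventually.of_forall fun _ => normalFraction_nonneg)
      (inter_subset_inter_right _ sdiff_subset).eventuallyLE
  · have hpos := h.levelFun_pos' hx
    have h1 := h.eq_zero_of_setIntegral_eq_zero
      (g := fun x => levelFun b R x ^ (-(((k : ℝ) - 4) / 2)) * axisDefect M b R x)
      ((h.continuousOn_rpow_levelFun _).mul h.continuousOn_axisDefect)
      (fun y hy => mul_nonneg (Real.rpow_nonneg (levelFun_nonneg h.R_pos (h.mem_halfSpace hy)) _)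
        axisDefect_nonneg) (fun r q hr hrq hqρ => (key r q hr hrq hqρ).1) hx
    exact (mul_eq_zero.1 h1).resolve_left (Real.rpow_pos_of_pos hpos _).ne'

/-- The ball `σ(B_r)` meets the hyperplane through `a` orthogonal to `b` in a flat ball. -/
lemma mem_ballImage_iff_of_inner_eq_zero (hb : b ≠ 0) (hR : 0 < R) (hr : 0 < r) (hrb : r < ‖b‖)
    (hx : inner ℝ b (x - refl b R 0) = 0) : x ∈ ballImage b R r ↔
      ‖x - refl b R 0‖ < R ^ 2 * r / (‖b‖ * √(‖b‖ ^ 2 - r ^ 2)) := by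
  have h0 := norm_pos_iff.2 hb
  have h1 := norm_sq_sub_sq_pos hr hrb
  have h2 := Real.sqrt_pos.2 h1
  have h3 := Real.sq_sqrt h1.le
  rw [mem_ballImage_iff_mul hb hR hr hrb, hx, mul_zero, sub_zero, level, lt_div_iff₀ (by positivity),
    ← pow_lt_pow_iff_left₀ (a := _ * (_ * _)) (by positivity) (by positivity) two_ne_zero,
    div_mul_eq_mul_div, lt_div_iff₀ h1]
  have e1 : (‖x - refl b R 0‖ * (‖b‖ * √(‖b‖ ^ 2 - r ^ 2))) ^ 2 =
      ‖b‖ ^ 2 * ‖x - refl b R 0‖ ^ 2 * (‖b‖ ^ 2 - r ^ 2) := by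
    rw [mul_pow, mul_pow, h3]; ring
  have e2 : (R ^ 2 * r) ^ 2 = R ^ 2 * r ^ 2 * R ^ 2 := by ring
  rw [e1, e2]

/-- The equality case: if the defects vanish, then `M` is a flat disk. -/
lemma eq_disk_of_defects (h : IsMinimalInBall k M b R ρ) (hne : M.Nonempty)
    (hd : ∀ x ∈ M \ {refl b R 0}, normalFraction M b R x = 0 ∧ axisDefect M b R x = 0) :
    ∃ T : Submodule ℝ (EuclideanSpace ℝ (Fin n)),
      Module.finrank ℝ T = k ∧ (∀ v ∈ T, inner ℝ v b = 0) ∧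
      M = {x | x - refl b R 0 ∈ T ∧
        ‖x - refl b R 0‖ < R ^ 2 * ρ / (‖b‖ * √(‖b‖ ^ 2 - ρ ^ 2))} := by
  have hconv : Convex ℝ (ballImage b R ρ) := by
    rw [ballImage_eq_ball h.ne_zero h.R_pos h.pos h.lt_norm]
    exact convex_ball _ _
  obtain ⟨ha, hM⟩ := h.isSubmanifold.eq_of_forall_sub_mem_tangentSpace hconv
    h.closure_inter_subset h.subset
    (fun x hx => sub_mem_tangentSpace_of_normalFraction (fun y hy => (hd y hy).1) hx)
    (refl_zero_mem_ballImage b R h.pos) hne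
  have hbT : ∀ v ∈ tangentSpace M (refl b R 0), inner ℝ v b = 0 := by
    have h0 := h.tangential_eq_zero_of_axisDefect (fun y hy => (hd y hy).2) ha
    rw [tangential, Submodule.starProjection_apply_eq_zero_iff, Submodule.mem_orthogonal] at h0
    exact h0
  refine ⟨tangentSpace M (refl b R 0), h.isSubmanifold.finrank_tangentSpace ha, hbT, ?_⟩
  conv_lhs => rw [hM]
  ext x
  refine and_congr_right fun hx => mem_ballImage_iff_of_inner_eq_zero h.ne_zero h.R_pos h.pos
    h.lt_norm ?_
  rw [real_inner_comm]
  exact hbT _ hx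

end IsMinimalInBall

end MinimalMonotonicity

open MinimalMonotonicity in
theorem proposition3p1 {n k : ℕ} (hk : 1 ≤ k) (R : ℝ) (hR : 0 < R)
    (b : EuclideanSpace ℝ (Fin n)) (hb : b ≠ 0)
    (a : EuclideanSpace ℝ (Fin n)) (ha : a = refl b R 0) :
    -- the function `f` is well defined on the half-space and has the second expression
    (∀ x ∈ halfSpace b R, 0 < ‖b‖ ^ 2 - ‖refl b R x‖ ^ 2 ∧
      levelFun b R x = ‖b‖ ^ 2 * ‖x - a‖ ^ 2 / (2 * ‖b‖ ^ 2 - R ^ 2 - 2 * inner ℝ b x)) ∧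
    -- the images of balls are the sublevel sets of `f`
    (∀ r : ℝ, 0 < r → r < ‖b‖ →
      ballImage b R r =
        {x ∈ halfSpace b R | levelFun b R x < R ^ 2 * r ^ 2 / (‖b‖ ^ 2 - r ^ 2)} ∧
      frontier (ballImage b R r) = refl b R '' Metric.sphere 0 r) ∧
    ∀ (rbar : ℝ), 0 < rbar → rbar < ‖b‖ → ∀ M : Set (EuclideanSpace ℝ (Fin n)),
      IsMinimalSubmanifold k M → M ⊆ ballImage b R rbar →
      -- the boundary of `M` lies in the boundary of the ball
      closure M \ M ⊆ frontier (ballImage b R rbar) →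
      -- the quantities in the definitions of `J` and `I` are finite
      (∀ r ∈ Set.Ioo 0 rbar,
        μHE[k] (M ∩ ballImage b R r) < ⊤ ∧
        IntegrableOn (fun x => ‖tangential M x (x - a)‖ ^ 2 / ‖x - a‖ ^ 2)
          (M ∩ ballImage b R r) μHE[k] ∧
        IntegrableOn (fun x => ‖normal M x (x - a)‖ ^ 2 / ‖x - a‖ ^ 2)
          (M ∩ ballImage b R r) μHE[k]) ∧
      (∀ r q : ℝ, 0 < r → r < q → q < rbar →
        -- volume monotonicity
        (IntegrableOn (fun x => levelFun b R x ^ (-((k : ℝ) / 2)) *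
            ((‖b‖ ^ 4 * ‖normal M x (x - a)‖ ^ 2 + levelFun b R x ^ 2 * ‖tangential M x b‖ ^ 2) /
              (‖b‖ ^ 4 * ‖x - a‖ ^ 2)))
          (M ∩ (ballImage b R q \ ballImage b R r)) μHE[k] ∧
        volRatio k M b R q - volRatio k M b R r =
          R ^ k * ∫ x in M ∩ (ballImage b R q \ ballImage b R r),
            levelFun b R x ^ (-((k : ℝ) / 2)) *
            ((‖b‖ ^ 4 * ‖normal M x (x - a)‖ ^ 2 + levelFun b R x ^ 2 * ‖tangential M x b‖ ^ 2) /
              (‖b‖ ^ 4 * ‖x - a‖ ^ 2)) ∂μHE[k]) ∧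
        -- weighted monotonicity
        (IntegrableOn (fun x => levelFun b R x ^ (-(((k : ℝ) - 4) / 2)) *
            (‖tangential M x b‖ ^ 2 / (‖b‖ ^ 4 * ‖x - a‖ ^ 2)))
          (M ∩ (ballImage b R q \ ballImage b R r)) μHE[k] ∧
        IntervalIntegrable (fun ρ : ℝ =>
            (‖b‖ ^ 2 - ρ ^ 2) ^ (((k : ℝ) - 2) / 2) / ρ ^ (k + 1) *
              ∫ x in M ∩ ballImage b R ρ, ‖normal M x (x - a)‖ ^ 2 / ‖x - a‖ ^ 2 ∂μHE[k])
          volume r q ∧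
        weightedRatio k M b R q - weightedRatio k M b R r =
          R ^ k * (∫ x in M ∩ (ballImage b R q \ ballImage b R r),
            levelFun b R x ^ (-(((k : ℝ) - 4) / 2)) *
            (‖tangential M x b‖ ^ 2 / (‖b‖ ^ 4 * ‖x - a‖ ^ 2)) ∂μHE[k]) +
          k * ‖b‖ ^ 2 * ∫ ρ in r..q,
            (‖b‖ ^ 2 - ρ ^ 2) ^ (((k : ℝ) - 2) / 2) / ρ ^ (k + 1) *
              ∫ x in M ∩ ballImage b R ρ,
                ‖normal M x (x - a)‖ ^ 2 / ‖x - a‖ ^ 2 ∂μHE[k])) ∧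
      -- both ratios are increasing
      MonotoneOn (volRatio k M b R) (Set.Ioo 0 rbar) ∧
      MonotoneOn (weightedRatio k M b R) (Set.Ioo 0 rbar) ∧
      -- rigidity: `M` is the flat disk in the ball, through `a` and orthogonal to `b`
      (M.Nonempty →
        ((∃ c, ∀ r ∈ Set.Ioo 0 rbar, volRatio k M b R r = c) ∨
          (∃ c, ∀ r ∈ Set.Ioo 0 rbar, weightedRatio k M b R r = c)) →
        ∃ T : Submodule ℝ (EuclideanSpace ℝ (Fin n)),
          Module.finrank ℝ T = k ∧ (∀ v ∈ T, inner ℝ v b = 0) ∧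
          M = {x | x - a ∈ T ∧
            ‖x - a‖ < R ^ 2 * rbar / (‖b‖ * Real.sqrt (‖b‖ ^ 2 - rbar ^ 2))}) := by
  subst ha
  refine ⟨fun x hx => ⟨norm_refl_lt hR hx, levelFun_eq hR hb hx⟩, fun r hr hrb =>
    ⟨ballImage_eq hb hR hr hrb, frontier_ballImage hb hR hr hrb⟩, ?_⟩
  intro rbar hr hrb M hmin hsub hbd
  have h : IsMinimalInBall k M b R rbar := ⟨hk, hR, hb, hr, hrb, hmin, hsub, hbd⟩
  refine ⟨fun r hr => ⟨h.measure_inter_ballImage_lt_top hr.1 hr.2,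
    h.integrableOn_tangentialFraction hr.1 hr.2, h.integrableOn_normalFraction hr.1 hr.2⟩,
    fun r q hr hrq hq => ⟨⟨h.integrableOn_volDefect hr hrq hq, h.volRatio_sub hr hrq hq⟩,
      h.integrableOn_axisDefect hr hrq hq, h.intervalIntegrable_normalMass hr hrq hq,
      h.weightedRatio_sub hr hrq hq⟩,
    h.volRatio_monotoneOn, h.weightedRatio_monotoneOn, fun hne hc => h.eq_disk_of_defects hne ?_⟩
  rcases hc with ⟨c, hc⟩ | ⟨c, hc⟩
  · exact fun x hx => h.defects_eq_zero_of_volRatio hc hx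
  · exact fun x hx => h.defects_eq_zero_of_weightedRatio hc hx
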